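/- Let $n\ge 1$ and let $S$ be a smooth, connected (Hausdorff, second countable) manifold without boundary of dimension $n-1$, with a smooth Riemannian metric $\gamma$, a smooth one-form $\boldsymbol s$ and a smooth function $h$. The associated near horizon geometry (NHG) is the $(n+1)$-dimensional Lorentzian manifold $M=S\times\mathbb R_v\times\mathbb R_u$ with metric $$g=2\,dv\Big(du+2u\,s_A\,dx^A+\tfrac12u^2h\,dv\Big)+\gamma_{AB}\,dx^A\,dx^B ,$$ and its horizon is $\mathcal H=\{u=0\}$. *Order of the horizon.* A Killing horizon of a Killing vector $\xi$ is a smooth embedded null hypersurface $\mathcal H_\xi$ on which $\xi$ is null, nowhere zero and tangent to $\mathcal H_\xi$; if $\mathcal H_\xi$ is not connected, the interior of its closure (the set of points around which the closure is a smooth embedded hypersurface) is also required to be a connected smooth hypersurface. Let $\mathcal A_{\mathcal H}$ be the set consisting of $0$ and of all Killing vectors $\xi$ of $(M,g)$ having a Killing horizon $\mathcal H_\xi$ with $\overline{\mathcal H_\xi}=\overline{\mathcal H}$. For $m\ge 2$, $\mathcal H$ is a multiple Killing horizon of order $m$ if it is a smooth embedded null hypersurface and $\mathcal A_{\mathcal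 H}$ is a real vector space of dimension $m$. *The space $\mathcal K_{S_0}$.* Identify $S$ with a cut $S_0=\{u=0,\ v=v_0\}$, whose induced metric is $\gamma$. Let $\mathcal K_{S_0}$ be the set of smooth Killing vector fields $\varsigma$ of $(S_0,\gamma)$ such that either $\varsigma=0$, or there are a smooth function $f:S_0\to\mathbb R$ with $df$ nowhere zero and smooth functions $Q,P$ on the range of $f$, $Q\not\equiv0$, solving $$\frac{dQ}{df}=Q\,P,\qquad \frac{d}{df}\Big(\frac{dP}{df}+P^2\Big)+P\Big(\frac{dP}{df}+P^2\Big)=0,$$ such that, with $N:=\gamma^\sharp(df,df)$, $$\gamma(\varsigma,\cdot)=\frac{Q(f)}{N}\,df,\qquad \boldsymbol s=\frac12\Big(\frac{dN}{N}-P(f)\,df\Big),\qquad h=\frac12N\Big(\frac{dP}{df}+P^2\Big)(f).$$ **Theorem.** For every integer $m\ge2$, the horizon $\mathcal H=\{u=0\}$ is a multiple Killing horizon of order $m$ if and only if $\mathcal K_{S_0}$ is a real vector space of dimension $m-2$. Moreover, $\mathcal K_{S_0}$ is a real vector space of finite dimension $\dim\mathcal K_{S_0}\le n-1$ (so that the order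 always exists and is at least $2$). -/

import Mathlib

open Set
open scoped Manifold ContDiff Bundle

noncomputable section

namespace NHG

/-! ### Tensor fields, vector fields and Killing vectors on a manifold without boundary -/

section General

variable {E : Type*} [NormedAddCommGroup E] [NormedSpace ℝ E]
  {H : Type*} [TopologicalSpace H] (I : ModelWithCorners ℝ E H)
  {M : Type*} [TopologicalSpace M] [ChartedSpace H M]

/-- A (rough) vector field on `M`. -/
abbrev VField (M : Type*) [TopologicalSpace M] [ChartedSpace H M] : Type _ :=
  ∀ p : M, TangentSpace I p

/-- A (rough) field of bilinear forms, i.e. a covariant 2-tensor field on `M`. -/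
abbrev Tensor2 (M : Type*) [TopologicalSpace M] [ChartedSpace H M] : Type _ :=
  ∀ p : M, TangentSpace I p →L[ℝ] TangentSpace I p →L[ℝ] ℝ

variable {I}

/-- The vector field `X` is smooth (`X ∈ 𝔛(M)`). -/
def SmoothField [IsManifold I 1 M] (X : VField I M) : Prop :=
  ContMDiff I I.tangent ∞ (fun p ↦ (⟨p, X p⟩ : TangentBundle I M))

/-- The components of the vector field `X` in the preferred chart at `x₀`, as functions of the
coordinates `y`. -/
def coordField (X : VField I M) (x₀ : M) (y : E) : E :=
  mfderiv I 𝓘(ℝ, E) (extChartAt I x₀) ((extChartAt I x₀).symm y) (X ((extChartAt I x₀).symm y))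

/-- The components `g_{μν} a^μ b^ν` of the tensor field `g` in the preferred chart at `x₀`, as
functions of the coordinates `y`. -/
def coordTensor (g : Tensor2 I M) (x₀ : M) (y : E) (a b : E) : ℝ :=
  g ((extChartAt I x₀).symm y)
    (mfderiv 𝓘(ℝ, E) I (extChartAt I x₀).symm y a)
    (mfderiv 𝓘(ℝ, E) I (extChartAt I x₀).symm y b)

/-- The components of the Lie derivative,
`(L_X g)_{μν} = X^ρ ∂_ρ g_{μν} + g_{ρν} ∂_μ X^ρ + g_{μρ} ∂_ν X^ρ`, contracted with `a^μ b^ν`,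
in the preferred chart at `x₀`. -/
def coordLieDeriv (g : Tensor2 I M) (X : VField I M) (x₀ : M) (y : E) (a b : E) : ℝ :=
  fderiv ℝ (fun z ↦ coordTensor g x₀ z a b) y (coordField X x₀ y)
    + coordTensor g x₀ y (fderiv ℝ (coordField X x₀) y a) b
    + coordTensor g x₀ y a (fderiv ℝ (coordField X x₀) y b)

/-- `X` is a Killing vector field of the (smooth) metric `g`: it is smooth and `L_X g = 0`. -/
def IsKilling [IsManifold I 1 M] (g : Tensor2 I M) (X : VField I M) : Prop :=
  SmoothField X ∧
    ∀ x₀ : M, ∀ y ∈ (extChartAt I x₀).target, ∀ a b : E, coordLieDeriv g X x₀ y a b = 0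

variable (I)

/-! ### Hypersurfaces, null hypersurfaces and Killing horizons -/

/-- `F` is a smooth function with nowhere zero differential on the open set `U ∋ p`, and
`N ∩ U = {q ∈ U | F q = 0}`. -/
structure IsLocalDefiningFunction (N : Set M) (p : M) (U : Set M) (F : M → ℝ) : Prop where
  isOpen : IsOpen U
  mem : p ∈ U
  smooth : ContMDiffOn I 𝓘(ℝ, ℝ) ∞ F U
  regular : ∀ q ∈ U, mfderiv I 𝓘(ℝ, ℝ) F q ≠ 0
  inter_eq : N ∩ U = {q ∈ U | F q = 0}

/-- `N` is a smooth embedded hypersurface of `M` (possibly with several components). -/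
def IsHypersurface (N : Set M) : Prop :=
  ∀ p ∈ N, ∃ U F, IsLocalDefiningFunction I N p U F

/-- The vector `w ∈ T_p M` is tangent to the hypersurface `N` at `p ∈ N`. -/
def TangentTo (N : Set M) (p : M) (w : TangentSpace I p) : Prop :=
  ∃ U F, IsLocalDefiningFunction I N p U F ∧ mfderiv I 𝓘(ℝ, ℝ) F p w = 0

variable {I}

/-- `N` is a smooth embedded null hypersurface: the metric induced by `g` on `N` is degenerate at
every point. -/
def IsNullHypersurface (g : Tensor2 I M) (N : Set M) : Prop :=
  IsHypersurface I N ∧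
    ∀ p ∈ N, ∃ k : TangentSpace I p, k ≠ 0 ∧ TangentTo I N p k ∧
      ∀ w : TangentSpace I p, TangentTo I N p w → g p k w = 0

variable (I) in
/-- The interior of `A` in the sense of hypersurfaces: the points of `A` around which `A` is a
smooth embedded hypersurface (without boundary). -/
def hypersurfaceInterior (A : Set M) : Set M :=
  {p ∈ A | ∃ U : Set M, IsOpen U ∧ p ∈ U ∧ IsHypersurface I (A ∩ U)}

/-- `N` is a Killing horizon of the Killing vector `ξ` of the metric `g`. -/
structure IsKillingHorizon [IsManifold I 1 M] (g : Tensor2 I M) (ξ : VField I M) (N : Set M) :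
    Prop where
  killing : IsKilling g ξ
  null_hypersurface : IsNullHypersurface g N
  null : ∀ p ∈ N, g p (ξ p) (ξ p) = 0
  ne_zero : ∀ p ∈ N, ξ p ≠ 0
  tangent : ∀ p ∈ N, TangentTo I N p (ξ p)
  interior_closure : ¬ IsPreconnected N →
    IsHypersurface I (hypersurfaceInterior I (closure N)) ∧
      IsConnected (hypersurfaceInterior I (closure N))

/-- The set of all Killing vectors of `g` (together with the zero field) that have a
Killing horizon with the same closure as `N`. -/
def killingGenerators [IsManifold I 1 M] (g : Tensor2 I M) (N : Set M) : Set (VField I M) :=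
  {ξ | ξ = 0 ∨ ∃ Nξ : Set M, IsKillingHorizon g ξ Nξ ∧ closure Nξ = closure N}

end General

/-- The subset `A` of the real vector space `V` is a linear subspace, of finite dimension `m`. -/
def IsSubspaceOfDim {V : Type*} [AddCommGroup V] [Module ℝ V] (A : Set V) (m : ℕ) : Prop :=
  ∃ W : Submodule ℝ V, (W : Set V) = A ∧ FiniteDimensional ℝ W ∧ Module.finrank ℝ W = m

/-- `N` is a multiple Killing horizon of order `m` of the metric `g`: an embedded null hypersurface
such that the Killing vectors having a horizon with the same closure as `N` form a vector space of
dimension `m`, where `m ≥ 2`. -/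
structure IsMultipleKillingHorizon {E : Type*} [NormedAddCommGroup E] [NormedSpace ℝ E]
    {H : Type*} [TopologicalSpace H] {I : ModelWithCorners ℝ E H}
    {M : Type*} [TopologicalSpace M] [ChartedSpace H M] [IsManifold I 1 M]
    (g : Tensor2 I M) (N : Set M) (m : ℕ) : Prop where
  null_hypersurface : IsNullHypersurface g N
  two_le : 2 ≤ m
  dim : IsSubspaceOfDim (killingGenerators g N) m

/-! ### Near horizon geometries -/

section NearHorizon

variable {d : ℕ} {S : Type*} [TopologicalSpace S] [ChartedSpace (EuclideanSpace ℝ (Fin d)) S]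
  [IsManifold (𝓡 d) ∞ S]

/-- Riemannian metrics on `S`, smooth. -/
abbrev RMetric (d : ℕ) (S : Type*) [TopologicalSpace S]
    [ChartedSpace (EuclideanSpace ℝ (Fin d)) S] [IsManifold (𝓡 d) ∞ S] : Type _ :=
  Bundle.ContMDiffRiemannianMetric (𝓡 d) ∞ (EuclideanSpace ℝ (Fin d))
    (fun x : S ↦ TangentSpace (𝓡 d) x)

/-- One-forms on `S`, smooth sections of the cotangent bundle. -/
structure OneForm (d : ℕ) (S : Type*) [TopologicalSpace S]
    [ChartedSpace (EuclideanSpace ℝ (Fin d)) S] [IsManifold (𝓡 d) ∞ S] where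
  toFun : ∀ x : S, TangentSpace (𝓡 d) x →L[ℝ] ℝ
  smooth : ContMDiff (𝓡 d) ((𝓡 d).prod 𝓘(ℝ, EuclideanSpace ℝ (Fin d) →L[ℝ] ℝ)) ∞
    (fun x ↦ Bundle.TotalSpace.mk' (EuclideanSpace ℝ (Fin d) →L[ℝ] ℝ)
      (E := fun x : S ↦ (TangentSpace (𝓡 d) x →L[ℝ] ℝ)) x (toFun x))

/-- The underlying manifold of a near horizon geometry: points are `(x, (v, u))`. -/
abbrev NHGSpace (S : Type*) : Type _ := S × (ℝ × ℝ)

/-- The model with corners (without boundary) of `NHGSpace S`, of dimension `d + 2`. -/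
abbrev nhgModel (d : ℕ) := (𝓡 d).prod 𝓘(ℝ, ℝ × ℝ)

/-- The differential `dv` of the coordinate `v`. -/
def dv (p : NHGSpace S) : TangentSpace (nhgModel d) p →L[ℝ] ℝ :=
  mfderiv (nhgModel d) 𝓘(ℝ, ℝ) (fun q : NHGSpace S ↦ q.2.1) p

/-- The differential `du` of the coordinate `u`. -/
def du (p : NHGSpace S) : TangentSpace (nhgModel d) p →L[ℝ] ℝ :=
  mfderiv (nhgModel d) 𝓘(ℝ, ℝ) (fun q : NHGSpace S ↦ q.2.2) p

/-- The differential of the projection to `S`. -/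
def dpr (p : NHGSpace S) : TangentSpace (nhgModel d) p →L[ℝ] TangentSpace (𝓡 d) p.1 :=
  mfderiv (nhgModel d) (𝓡 d) (Prod.fst : NHGSpace S → S) p

/-- The tensor product `(α ⊗ β)(X, Y) = α(X) β(Y)` of two covectors. -/
def tensor {V : Type*} [AddCommGroup V] [Module ℝ V] [TopologicalSpace V] [IsTopologicalAddGroup V]
    [ContinuousSMul ℝ V] (α β : V →L[ℝ] ℝ) : V →L[ℝ] V →L[ℝ] ℝ := α.smulRight β

/-- The pullback `β(L X)` of a covector along a linear map. -/
def pullback1 {V W : Type*} [AddCommGroup V] [Module ℝ V] [TopologicalSpace V]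
    [AddCommGroup W] [Module ℝ W] [TopologicalSpace W]
    (L : V →L[ℝ] W) (β : W →L[ℝ] ℝ) : V →L[ℝ] ℝ := β.comp L

/-- The pullback `B(L X, L Y)` of a bilinear form along a linear map. -/
def pullback2 {V W : Type*} [AddCommGroup V] [Module ℝ V] [TopologicalSpace V]
    [IsTopologicalAddGroup V] [ContinuousSMul ℝ V]
    [AddCommGroup W] [Module ℝ W] [TopologicalSpace W] [IsTopologicalAddGroup W]
    [ContinuousSMul ℝ W]
    (L : V →L[ℝ] W) (B : W →L[ℝ] W →L[ℝ] ℝ) : V →L[ℝ] V →L[ℝ] ℝ :=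
  ((ContinuousLinearMap.precomp ℝ L).comp B).comp L

/-- The near horizon metric
`g = 2 dv (du + 2 u s_A dx^A + (1/2) u² h dv) + γ_{AB} dx^A dx^B` on `NHGSpace S`, where juxtaposed
one-forms `α β` stand for the symmetrized product `(α ⊗ β + β ⊗ α) / 2`. -/
def nhgMetric (γ : RMetric d S) (s : OneForm d S) (h : S → ℝ) :
    Tensor2 (nhgModel d) (NHGSpace S) := fun p ↦
  let α : TangentSpace (nhgModel d) p →L[ℝ] ℝ :=
    du p + (2 * p.2.2) • pullback1 (dpr p) (s.toFun p.1) + ((1 / 2) * p.2.2 ^ 2 * h p.1) • dv p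
  tensor (dv p) α + tensor α (dv p) + pullback2 (dpr p) (γ.inner p.1)

/-- The horizon `{u = 0}`. -/
def horizon (S : Type*) : Set (NHGSpace S) := {p | p.2.2 = 0}

/-- The metric at `x` as a bilinear form. -/
def metricForm (γ : RMetric d S) (x : S) : LinearMap.BilinForm ℝ (TangentSpace (𝓡 d) x) :=
  LinearMap.mk₂ ℝ (fun a b ↦ γ.inner x a b) (by simp) (by simp) (by simp) (by simp)

theorem metricForm_nondegenerate (γ : RMetric d S) (x : S) : (metricForm γ x).Nondegenerate := by
  constructor
  · intro a ha
    by_contra hne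
    exact (γ.pos x a hne).ne' (ha a)
  · intro a ha
    by_contra hne
    exact (γ.pos x a hne).ne' (ha a)

instance (x : S) : FiniteDimensional ℝ (TangentSpace (𝓡 d) x) :=
  inferInstanceAs (FiniteDimensional ℝ (EuclideanSpace ℝ (Fin d)))

/-- The contravariant metric `γ^♯` on covectors at `x`: `γ^♯(α, β) = α (β^♯)`, where `β^♯` is the
vector metrically related to `β`. -/
def coMetric (γ : RMetric d S) (x : S) (α β : TangentSpace (𝓡 d) x →L[ℝ] ℝ) : ℝ :=
  α (((metricForm γ x).toDual (metricForm_nondegenerate γ x)).symm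
    (β : TangentSpace (𝓡 d) x →ₗ[ℝ] ℝ))

/-- The differential of a function on `S`. -/
def diff (f : S → ℝ) (x : S) : TangentSpace (𝓡 d) x →L[ℝ] ℝ := mfderiv (𝓡 d) 𝓘(ℝ, ℝ) f x

/-- `N = γ^♯(df, df)`. -/
def normSqDiff (γ : RMetric d S) (f : S → ℝ) (x : S) : ℝ :=
  coMetric γ x (diff f x) (diff f x)

/-- `(Q, P)` solves the system `Q' = Q P`, `(P' + P²)' + P (P' + P²) = 0` on the set `J` of values,
smoothly, with `Q` not identically zero. -/
structure SolvesODEs (Q P : ℝ → ℝ) (J : Set ℝ) : Prop where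
  smooth_Q : ∀ t ∈ J, ContDiffAt ℝ ∞ Q t
  smooth_P : ∀ t ∈ J, ContDiffAt ℝ ∞ P t
  ode_Q : ∀ t ∈ J, deriv Q t = Q t * P t
  ode_P : ∀ t ∈ J,
    deriv (fun r ↦ deriv P r + P r ^ 2) t + P t * (deriv P t + P t ^ 2) = 0
  nontrivial : ∃ t ∈ J, Q t ≠ 0

/-- `ς` is represented by `f` and a solution `(Q, P)` of the system of ODEs on the range of `f`:
`df` vanishes nowhere, the one-form metrically related to `ς` is `(Q(f)/N) df`, and
`s = (1/2) (dN/N - P(f) df)`, `h = (1/2) N (P' + P²)(f)`. -/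
structure IsRepresentedBy (γ : RMetric d S) (s : OneForm d S) (h : S → ℝ)
    (ς : VField (𝓡 d) S) (f : S → ℝ) (Q P : ℝ → ℝ) : Prop where
  smooth_f : ContMDiff (𝓡 d) 𝓘(ℝ, ℝ) ∞ f
  diff_ne_zero : ∀ x : S, diff (d := d) f x ≠ 0
  ode : SolvesODEs Q P (range f)
  field_eq : ∀ x : S, γ.inner x (ς x) = (Q (f x) / normSqDiff γ f x) • diff (d := d) f x
  s_eq : ∀ x : S, s.toFun x =
    (1 / 2 : ℝ) • ((normSqDiff γ f x)⁻¹ • diff (d := d) (normSqDiff γ f) x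
      - P (f x) • diff (d := d) f x)
  h_eq : ∀ x : S, h x = 1 / 2 * normSqDiff γ f x * (deriv P (f x) + P (f x) ^ 2)

/-- `S` is identified with the cut `S₀ = {u = 0, v = v₀}` of the horizon, whose first fundamental
form is `γ`. The set `𝒦_{S₀}` of admissible hypersurface-orthogonal Killing vectors of `(S₀, γ)`,
depending on the torsion one-form `s` and the function `h`: Killing vectors of `γ` which are
either zero or represented by some `f`, `Q`, `P`. -/
def cutKilling (γ : RMetric d S) (s : OneForm d S) (h : S → ℝ) : Set (VField (𝓡 d) S) :=
  {ς | IsKilling (I := 𝓡 d) (fun x ↦ γ.inner x) ς ∧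
    (ς = 0 ∨ ∃ f Q P, IsRepresentedBy γ s h ς f Q P)}

end NearHorizon

end NHG

end

/-! The proof parametrizes both sides of the equivalence by one space of functions on the cut, the
potentials: smooth `f` on `S` satisfying three equations linear in `f`, namely `L_{∇f} γ = 2 (s ⊗ df
+ df ⊗ s)`, `h df + d(s(∇f)) + 2 s(∇f) s - 2 L_{∇f} s = 0` and `∇f(h) = 2 h s(∇f)`.

Spacetime side. A Killing vector whose horizon is dense in `{u = 0}` is, by continuity, a multiple
`F ∂_v` of `∂_v` there. The components of the Killing equation along `∂_u` are differential
equations in `u` that recover the whole field from `F`. The remaining components are polynomials in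
`u`; their coefficients say that `F = c v + f` with `c` constant and `f` a potential. Conversely
every pair `(c, f)` gives a Killing vector, and if it is nonzero, the zeros of `c v + f` have empty
interior in the horizon, so removing them leaves a dense Killing horizon. Thus the generators form a
space isomorphic to `ℝ × potentials` (`exists_eq_killingLift`, `range_killingLiftMap`).

Cut side. The Hessian equation is a linear total differential equation for `df`, so on connected `S`
the differential of a potential vanishes everywhere or nowhere. If it vanishes nowhere, put `N =
|∇f|²`, `p = 2 s(∇f) / N`, `r = 2 h / N`. The three equations become `s = (dN/N - p df) / 2`, `dp =
(r - p²) df`, `dr = -p r df`. These are solved by `p = w'/w`, `r = w''/w` with `w` a polynomial of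
degree at most two in `f`, which is the representation with `Q = c w` and `P = w'/w`
(`ratio_eq_quad`). Every factor `Q/N` solves `dq = -2 q s`, whose solution space on connected `S` is
at most a line, so a single nowhere vanishing `μ` serves for all representations and `𝒦_{S₀}` is the
image of the potentials under `f ↦ μ ∇f` (`exists_cutKilling_eq`). The kernel consists of the
constants.

Hence `dim 𝒦_{S₀} = dim potentials - 1`, while the generators have dimension `dim potentials + 1`:
the two differ by 2. A potential is determined by its value and differential at one point, so `dim
potentials ≤ d + 1` and `dim 𝒦_{S₀} ≤ d = n - 1`. -/

open Topology

noncomputable section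

set_option synthInstance.maxHeartbeats 400000
set_option linter.unusedSectionVars false

namespace NHG

/-! ### Calculus in a chart -/

section Chart

variable {E : Type*} [NormedAddCommGroup E] [NormedSpace ℝ E]

/-- The Lie derivative of a field of bilinear maps on a normed space. -/
def lieForm (B : E → E → E → ℝ) (Z : E → E) (y a b : E) : ℝ :=
  fderiv ℝ (fun z ↦ B z a b) y (Z y) + B y (fderiv ℝ Z y a) b + B y a (fderiv ℝ Z y b)

/-- The near horizon metric in coordinates `(y, (v, u))`. -/
def nhgForm (G : E → E →L[ℝ] E →L[ℝ] ℝ) (σ : E → E →L[ℝ] ℝ) (η : E → ℝ)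
    (z a b : E × (ℝ × ℝ)) : ℝ :=
  a.2.1 * (b.2.2 + 2 * z.2.2 * σ z.1 b.1 + 1 / 2 * z.2.2 ^ 2 * η z.1 * b.2.1)
    + (a.2.2 + 2 * z.2.2 * σ z.1 a.1 + 1 / 2 * z.2.2 ^ 2 * η z.1 * a.2.1) * b.2.1
    + G z.1 a.1 b.1

theorem HasFDerivAt.bilin_apply {F : Type*} [NormedAddCommGroup F] [NormedSpace ℝ F]
    {G : E → F →L[ℝ] F →L[ℝ] ℝ} {G' : E →L[ℝ] F →L[ℝ] F →L[ℝ] ℝ}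
    {y : E} (hG : HasFDerivAt G G' y) {Z W : E → F} {Z' W' : E →L[ℝ] F}
    (hZ : HasFDerivAt Z Z' y) (hW : HasFDerivAt W W' y) (c : E) :
    fderiv ℝ (fun z ↦ G z (Z z) (W z)) y c
      = G' c (Z y) (W y) + G y (Z' c) (W y) + G y (Z y) (W' c) := by
  have := (hG.clm_apply hZ).clm_apply hW
  rw [this.fderiv]
  simp [ContinuousLinearMap.flip_apply]
  ring

theorem hasFDerivAt_nhgForm {G : E → E →L[ℝ] E →L[ℝ] ℝ} {σ : E → E →L[ℝ] ℝ} {η : E → ℝ}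
    {G' : E →L[ℝ] E →L[ℝ] E →L[ℝ] ℝ} {σ' : E →L[ℝ] E →L[ℝ] ℝ} {η' : E →L[ℝ] ℝ}
    {z : E × (ℝ × ℝ)} (hG : HasFDerivAt G G' z.1) (hσ : HasFDerivAt σ σ' z.1)
    (hη : HasFDerivAt η η' z.1) (a b X : E × (ℝ × ℝ)) :
    DifferentiableAt ℝ (fun z ↦ nhgForm G σ η z a b) z ∧
    fderiv ℝ (fun z ↦ nhgForm G σ η z a b) z X =
      a.2.1 * (2 * X.2.2 * σ z.1 b.1 + 2 * z.2.2 * σ' X.1 b.1 + z.2.2 * X.2.2 * η z.1 * b.2.1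
          + 1 / 2 * z.2.2 ^ 2 * η' X.1 * b.2.1)
        + (2 * X.2.2 * σ z.1 a.1 + 2 * z.2.2 * σ' X.1 a.1 + z.2.2 * X.2.2 * η z.1 * a.2.1
          + 1 / 2 * z.2.2 ^ 2 * η' X.1 * a.2.1) * b.2.1
        + G' X.1 a.1 b.1 := by
  have h1 : HasFDerivAt (fun z : E × (ℝ × ℝ) ↦ z.1) (ContinuousLinearMap.fst ℝ E (ℝ × ℝ)) z :=
    hasFDerivAt_fst
  have hu : HasFDerivAt (fun z : E × (ℝ × ℝ) ↦ z.2.2)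
      ((ContinuousLinearMap.snd ℝ ℝ ℝ).comp (ContinuousLinearMap.snd ℝ E (ℝ × ℝ))) z :=
    hasFDerivAt_snd.comp z hasFDerivAt_snd
  have hσ1 := HasFDerivAt.comp z hσ h1
  have hη1 := HasFDerivAt.comp z hη h1
  have hs (c : E) := hσ1.clm_apply (hasFDerivAt_const c z)
  have hg := HasFDerivAt.comp z
    ((hG.clm_apply (hasFDerivAt_const a.1 z.1)).clm_apply (hasFDerivAt_const b.1 z.1)) h1
  have hA (c : E × (ℝ × ℝ)) := ((((hu.const_mul 2).mul (hs c.1)).const_add c.2.2).add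
    ((((hu.pow 2).const_mul (1 / 2)).mul hη1).mul_const c.2.1))
  have key := (((hA b).const_mul a.2.1).add ((hA a).mul_const b.2.1)).add hg
  have key' : HasFDerivAt (fun z ↦ nhgForm G σ η z a b) _ z :=
    key.congr_of_eventuallyEq (Filter.Eventually.of_forall fun w ↦ by
      simp [nhgForm])
  refine ⟨key'.differentiableAt, ?_⟩
  rw [key'.fderiv]
  simp
  ring

/-- The vector field `-u Z + F ∂_v + (-u F_v + u² κ) ∂_u` in coordinates. -/
def liftForm (F Fv κ : E × ℝ → ℝ) (Z : E × ℝ → E) (z : E × (ℝ × ℝ)) : E × (ℝ × ℝ) :=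
  (-z.2.2 • Z (z.1, z.2.1), (F (z.1, z.2.1), -z.2.2 * Fv (z.1, z.2.1) + z.2.2 ^ 2 * κ (z.1, z.2.1)))

theorem hasFDerivAt_liftForm {F Fv κ : E × ℝ → ℝ} {Z : E × ℝ → E}
    {F' Fv' κ' : E × ℝ →L[ℝ] ℝ} {Z' : E × ℝ →L[ℝ] E} {z : E × (ℝ × ℝ)}
    (hF : HasFDerivAt F F' (z.1, z.2.1)) (hFv : HasFDerivAt Fv Fv' (z.1, z.2.1))
    (hκ : HasFDerivAt κ κ' (z.1, z.2.1)) (hZ : HasFDerivAt Z Z' (z.1, z.2.1))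
    (a : E × (ℝ × ℝ)) :
    fderiv ℝ (liftForm F Fv κ Z) z a =
      (-a.2.2 • Z (z.1, z.2.1) - z.2.2 • Z' (a.1, a.2.1), (F' (a.1, a.2.1),
        -a.2.2 * Fv (z.1, z.2.1) - z.2.2 * Fv' (a.1, a.2.1)
          + 2 * z.2.2 * a.2.2 * κ (z.1, z.2.1) + z.2.2 ^ 2 * κ' (a.1, a.2.1))) := by
  have hu : HasFDerivAt (fun z : E × (ℝ × ℝ) ↦ z.2.2)
      ((ContinuousLinearMap.snd ℝ ℝ ℝ).comp (ContinuousLinearMap.snd ℝ E (ℝ × ℝ))) z :=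
    hasFDerivAt_snd.comp z hasFDerivAt_snd
  have hp : HasFDerivAt (fun z : E × (ℝ × ℝ) ↦ (z.1, z.2.1))
      ((ContinuousLinearMap.fst ℝ E (ℝ × ℝ)).prod
        ((ContinuousLinearMap.fst ℝ ℝ ℝ).comp (ContinuousLinearMap.snd ℝ E (ℝ × ℝ)))) z :=
    hasFDerivAt_fst.prodMk (hasFDerivAt_fst.comp z hasFDerivAt_snd)
  have hF1 := HasFDerivAt.comp z hF hp
  have hFv1 := HasFDerivAt.comp z hFv hp
  have hκ1 := HasFDerivAt.comp z hκ hp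
  have hZ1 := HasFDerivAt.comp z hZ hp
  have key := (hu.neg.smul hZ1).prodMk
    (hF1.prodMk ((hu.neg.mul hFv1).add ((hu.pow 2).mul hκ1)))
  have key' : HasFDerivAt (liftForm F Fv κ Z) _ z := key
  rw [key'.fderiv]
  refine Prod.ext ?_ (Prod.ext ?_ ?_)
  · simp; abel
  · simp
  · simp; ring

/-- The Lie derivative of the near horizon metric along `liftForm F Fv κ Z`. -/
theorem lieForm_nhgForm_liftForm {G : E → E →L[ℝ] E →L[ℝ] ℝ} {σ : E → E →L[ℝ] ℝ} {η : E → ℝ}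
    {G' : E →L[ℝ] E →L[ℝ] E →L[ℝ] ℝ} {σ' : E →L[ℝ] E →L[ℝ] ℝ} {η' : E →L[ℝ] ℝ}
    {y : E} {v : ℝ} (u : ℝ) (hG : HasFDerivAt G G' y) (hσ : HasFDerivAt σ σ' y)
    (hη : HasFDerivAt η η' y) {F Fv κ : E × ℝ → ℝ} {Z : E × ℝ → E}
    {F' Fv' κ' : E × ℝ →L[ℝ] ℝ} {Z' : E × ℝ →L[ℝ] E}
    (hF : HasFDerivAt F F' (y, v)) (hFv : HasFDerivAt Fv Fv' (y, v))
    (hκ : HasFDerivAt κ κ' (y, v)) (hZ : HasFDerivAt Z Z' (y, v))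
    (a b : E) (av au bv bu : ℝ) :
    lieForm (nhgForm G σ η) (liftForm F Fv κ Z) (y, (v, u)) (a, (av, au)) (b, (bv, bu)) =
      let X : E × (ℝ × ℝ) := liftForm F Fv κ Z (y, (v, u))
      let D : E → ℝ → ℝ → E × (ℝ × ℝ) := fun c cv cu ↦
        (-cu • Z (y, v) - u • Z' (c, cv), (F' (c, cv),
          -cu * Fv (y, v) - u * Fv' (c, cv) + 2 * u * cu * κ (y, v) + u ^ 2 * κ' (c, cv)))
      (av * (2 * X.2.2 * σ y b + 2 * u * σ' X.1 b + u * X.2.2 * η y * bv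
          + 1 / 2 * u ^ 2 * η' X.1 * bv)
        + (2 * X.2.2 * σ y a + 2 * u * σ' X.1 a + u * X.2.2 * η y * av
          + 1 / 2 * u ^ 2 * η' X.1 * av) * bv + G' X.1 a b)
      + nhgForm G σ η (y, (v, u)) (D a av au) (b, (bv, bu))
      + nhgForm G σ η (y, (v, u)) (a, (av, au)) (D b bv bu) := by
  unfold lieForm
  rw [(hasFDerivAt_nhgForm (z := (y, (v, u))) hG hσ hη (a, (av, au)) (b, (bv, bu)) _).2,
    hasFDerivAt_liftForm (z := (y, (v, u))) hF hFv hκ hZ,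
    hasFDerivAt_liftForm (z := (y, (v, u))) hF hFv hκ hZ]

end Chart

/-! ### Gradient fields and the potential equations in a chart -/

section Potential

variable {E : Type*} [NormedAddCommGroup E] [NormedSpace ℝ E]

theorem fderiv_fderiv_symm {f : E → ℝ} {y : E} (hf : ContDiffAt ℝ ∞ f y) (a b : E) :
    fderiv ℝ (fderiv ℝ f) y a b = fderiv ℝ (fderiv ℝ f) y b a :=
  (hf.isSymmSndFDerivAt (by simpa using ENat.LEInfty.out)).eq a b

theorem ContDiffAt.fderiv_top {F : Type*} [NormedAddCommGroup F] [NormedSpace ℝ F]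
    {f : E → F} {y : E} (hf : ContDiffAt ℝ ∞ f y) :
    ContDiffAt ℝ ∞ (fderiv ℝ f) y := hf.fderiv_right le_rfl

theorem fderiv_clm_apply_const {σ : E → E →L[ℝ] ℝ} {y : E} (hσ : DifferentiableAt ℝ σ y)
    (a b : E) : fderiv ℝ (fun z ↦ σ z b) y a = fderiv ℝ σ y a b := by
  rw [(hσ.hasFDerivAt.clm_apply (hasFDerivAt_const b y)).fderiv]
  simp

theorem fderiv_clm_apply_field {σ : E → E →L[ℝ] ℝ} {Z : E → E} {y : E}
    (hσ : DifferentiableAt ℝ σ y) (hZ : DifferentiableAt ℝ Z y) (b : E) :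
    fderiv ℝ (fun z ↦ σ z (Z z)) y b = fderiv ℝ σ y b (Z y) + σ y (fderiv ℝ Z y b) := by
  rw [(hσ.hasFDerivAt.clm_apply hZ.hasFDerivAt).fderiv]
  simp [add_comm]

/-- The exterior derivative of `(dN / N - p df) / 2`. -/
theorem fderiv_antisymm_of_eq {σ : E → E →L[ℝ] ℝ} {N p f : E → ℝ} {y : E}
    (hσ : ContDiffAt ℝ ∞ σ y) (hN : ContDiffAt ℝ ∞ N y) (hp : ContDiffAt ℝ ∞ p y)
    (hf : ContDiffAt ℝ ∞ f y) (hN0 : N y ≠ 0)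
    (h : ∀ᶠ z in 𝓝 y, ∀ b, σ z b = 1 / 2 * ((N z)⁻¹ * fderiv ℝ N z b - p z * fderiv ℝ f z b))
    (a b : E) :
    fderiv ℝ σ y a b - fderiv ℝ σ y b a
      = -(1 / 2) * (fderiv ℝ p y a * fderiv ℝ f y b - fderiv ℝ p y b * fderiv ℝ f y a) := by
  have hσd := hσ.differentiableAt (by simp)
  have hNd := hN.differentiableAt (by simp)
  have hpd := hp.differentiableAt (by simp)
  have hdN := (ContDiffAt.fderiv_top hN).differentiableAt (by simp)
  have hdf := (ContDiffAt.fderiv_top hf).differentiableAt (by simp)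
  have key (a b : E) : fderiv ℝ σ y a b = 1 / 2 * (-(fderiv ℝ N y a * fderiv ℝ N y b) / N y ^ 2
      + (N y)⁻¹ * fderiv ℝ (fderiv ℝ N) y a b
      - (fderiv ℝ p y a * fderiv ℝ f y b + p y * fderiv ℝ (fderiv ℝ f) y a b)) := by
    rw [← fderiv_clm_apply_const hσd]
    have h1 : (fun z ↦ σ z b) =ᶠ[𝓝 y]
        fun z ↦ 1 / 2 * ((N z)⁻¹ * fderiv ℝ N z b - p z * fderiv ℝ f z b) :=
      h.mono fun z hz ↦ hz b
    rw [h1.fderiv_eq]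
    have hinv : HasFDerivAt (fun z ↦ (N z)⁻¹) (-(N y ^ 2)⁻¹ • fderiv ℝ N y) y :=
      (hasDerivAt_inv hN0).comp_hasFDerivAt y hNd.hasFDerivAt
    have hd : HasFDerivAt
        (fun z ↦ 1 / 2 * ((N z)⁻¹ * fderiv ℝ N z b - p z * fderiv ℝ f z b)) _ y :=
      ((hinv.mul (hdN.hasFDerivAt.clm_apply (hasFDerivAt_const b y))).sub
        (hpd.hasFDerivAt.mul (hdf.hasFDerivAt.clm_apply (hasFDerivAt_const b y)))).const_mul
          (1 / 2)
    rw [hd.fderiv]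
    simp
    ring
  -- Antisymmetrizing removes `dN ⊗ dN` and both second derivatives; only `dp ∧ df` survives.
  rw [key a b, key b a, fderiv_fderiv_symm hN a b, fderiv_fderiv_symm hf a b]
  ring

/-- `Z` is the gradient of `f` with respect to the symmetric form `G`, near `y`. -/
structure IsGradient (G : E → E →L[ℝ] E →L[ℝ] ℝ) (f : E → ℝ) (Z : E → E) (y : E) : Prop where
  smooth_G : ContDiffAt ℝ ∞ G y
  symm : ∀ᶠ z in 𝓝 y, ∀ a b, G z a b = G z b a
  pos : ∀ᶠ z in 𝓝 y, ∀ a, a ≠ 0 → 0 < G z a a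
  smooth_f : ContDiffAt ℝ ∞ f y
  smooth_Z : ContDiffAt ℝ ∞ Z y
  grad : ∀ᶠ z in 𝓝 y, ∀ b, G z (Z z) b = fderiv ℝ f z b

namespace IsGradient

variable {G : E → E →L[ℝ] E →L[ℝ] ℝ} {f : E → ℝ} {Z : E → E} {y : E}

theorem hasFDerivAt_G (h : IsGradient G f Z y) : HasFDerivAt G (fderiv ℝ G y) y :=
  (h.smooth_G.differentiableAt (by simp)).hasFDerivAt

theorem fderiv_G (h : IsGradient G f Z y) (a b c : E) :
    fderiv ℝ (fun z ↦ G z a b) y c = fderiv ℝ G y c a b := by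
  rw [HasFDerivAt.bilin_apply h.hasFDerivAt_G (hasFDerivAt_const a y) (hasFDerivAt_const b y)]
  simp

/-- Differentiating `G(Z, b) = df(b)` along `a` trades the derivative of `Z` for second derivatives
of `f` and first derivatives of `G`, with no Christoffel symbols needed. -/
theorem hess_eq (h : IsGradient G f Z y) (a b : E) :
    fderiv ℝ G y a (Z y) b + G y (fderiv ℝ Z y a) b = fderiv ℝ (fderiv ℝ f) y a b := by
  have hZ := h.smooth_Z.differentiableAt (by simp)
  have hdf := (ContDiffAt.fderiv_top h.smooth_f).differentiableAt (by simp)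
  have h1 : (fun z ↦ G z (Z z) b) =ᶠ[𝓝 y] fun z ↦ fderiv ℝ f z b :=
    h.grad.mono fun z hz ↦ hz b
  have h2 := h1.fderiv_eq (𝕜 := ℝ)
  have h3 := congrArg (fun L ↦ L a) h2
  rw [fderiv_clm_apply_const hdf, HasFDerivAt.bilin_apply h.hasFDerivAt_G hZ.hasFDerivAt
    (hasFDerivAt_const b y)] at h3
  simpa using h3

theorem lieForm_eq (h : IsGradient G f Z y) (a b : E) :
    lieForm (fun z a b ↦ G z a b) Z y a b = 2 * fderiv ℝ (fderiv ℝ f) y a b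
      + fderiv ℝ G y (Z y) a b - fderiv ℝ G y a (Z y) b - fderiv ℝ G y b (Z y) a := by
  unfold lieForm
  rw [h.fderiv_G]
  have h1 := h.hess_eq a b
  have h2 := h.hess_eq b a
  rw [fderiv_fderiv_symm h.smooth_f b a] at h2
  have h3 := h.symm.self_of_nhds a (fderiv ℝ Z y b)
  beta_reduce
  rw [h3]
  linarith

theorem contDiffAt_normSq (h : IsGradient G f Z y) :
    ContDiffAt ℝ ∞ (fun z ↦ fderiv ℝ f z (Z z)) y :=
  (ContDiffAt.fderiv_top h.smooth_f).clm_apply h.smooth_Z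

theorem normSq_pos (h : IsGradient G f Z y) (hf : fderiv ℝ f y ≠ 0) : 0 < fderiv ℝ f y (Z y) := by
  have hZ : Z y ≠ 0 := by
    intro h0
    apply hf
    ext b
    rw [← h.grad.self_of_nhds b, h0]
    simp
  rw [← h.grad.self_of_nhds]
  exact h.pos.self_of_nhds _ hZ

/-- Both sides are `2 Hess f (∇f, ·)`, so an equation for `L_{∇f} γ` determines `dN` algebraically.
-/
theorem fderiv_normSq (h : IsGradient G f Z y) (b : E) :
    fderiv ℝ (fun z ↦ fderiv ℝ f z (Z z)) y b = lieForm (fun z a b ↦ G z a b) Z y (Z y) b := by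
  have hZ := h.smooth_Z.differentiableAt (by simp)
  have hdf := (ContDiffAt.fderiv_top h.smooth_f).differentiableAt (by simp)
  rw [fderiv_clm_apply_field hdf hZ, h.lieForm_eq, ← h.grad.self_of_nhds, ← h.hess_eq,
    fderiv_fderiv_symm h.smooth_f (Z y) b, ← h.hess_eq, h.symm.self_of_nhds (Z y)]
  ring

end IsGradient

/-- The equation `L_{∇f} γ = 2 (s ⊗ df + df ⊗ s)` at `y`. -/
def HessianEq (G : E → E →L[ℝ] E →L[ℝ] ℝ) (σ : E → E →L[ℝ] ℝ) (f : E → ℝ) (Z : E → E)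
    (y : E) : Prop :=
  ∀ a b, lieForm (fun z a b ↦ G z a b) Z y a b
    = 2 * (σ y a * fderiv ℝ f y b + σ y b * fderiv ℝ f y a)

/-- The equation `h df + d(s(∇f)) + 2 s(∇f) s - 2 L_{∇f} s = 0` at `y`. -/
def TorsionEq (σ : E → E →L[ℝ] ℝ) (η f : E → ℝ) (Z : E → E) (y : E) : Prop :=
  ∀ b, η y * fderiv ℝ f y b + fderiv ℝ (fun z ↦ σ z (Z z)) y b + 2 * σ y (Z y) * σ y b
    - 2 * (fderiv ℝ σ y (Z y) b + σ y (fderiv ℝ Z y b)) = 0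

/-- The equation `∇f(h) = 2 h s(∇f)` at `y`. -/
def ScalarEq (σ : E → E →L[ℝ] ℝ) (η : E → ℝ) (Z : E → E) (y : E) : Prop :=
  fderiv ℝ η y (Z y) = 2 * η y * σ y (Z y)

variable {G : E → E →L[ℝ] E →L[ℝ] ℝ} {σ : E → E →L[ℝ] ℝ} {η : E → ℝ} {f : E → ℝ} {Z : E → E}
  {y : E}

/-- Solved for `σ`, this contraction of the Hessian equation with `∇f` reads `s = (dN/N - p df) / 2`
with `p = 2 s(∇f) / N`, the form of `s` in a representation. -/
theorem HessianEq.fderiv_normSq (h1 : HessianEq G σ f Z y) (h : IsGradient G f Z y) (b : E) :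
    fderiv ℝ (fun z ↦ fderiv ℝ f z (Z z)) y b
      = 2 * (σ y (Z y) * fderiv ℝ f y b + fderiv ℝ f y (Z y) * σ y b) := by
  rw [h.fderiv_normSq, h1]
  ring

/-- The equations satisfied by `p = 2 s(∇f) / N` and `r = 2 h / N`, from the equations on `f`. -/
theorem TorsionEq.fderiv_p {p r : E → ℝ} (h : IsGradient G f Z y) (hσ : ContDiffAt ℝ ∞ σ y)
    (hp : ContDiffAt ℝ ∞ p y)
    (h1 : ∀ᶠ z in 𝓝 y, HessianEq G σ f Z z) (hg : ∀ᶠ z in 𝓝 y, IsGradient G f Z z)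
    (h2 : TorsionEq σ η f Z y) (hf : ∀ᶠ z in 𝓝 y, fderiv ℝ f z ≠ 0)
    (hpe : ∀ᶠ z in 𝓝 y, 2 * σ z (Z z) = p z * fderiv ℝ f z (Z z))
    (hre : 2 * η y = r y * fderiv ℝ f y (Z y)) (b : E) :
    fderiv ℝ p y b = (r y - p y ^ 2) * fderiv ℝ f y b := by
  set N : E → ℝ := fun z ↦ fderiv ℝ f z (Z z) with hN
  have hNs : ContDiffAt ℝ ∞ N y := h.contDiffAt_normSq
  have hN0 : N y ≠ 0 := (h.normSq_pos hf.self_of_nhds).ne'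
  have hs : ∀ᶠ z in 𝓝 y, ∀ b,
      σ z b = 1 / 2 * ((N z)⁻¹ * fderiv ℝ N z b - p z * fderiv ℝ f z b) := by
    filter_upwards [h1, hg, hpe, hf] with z hz1 hz2 hz3 hz4 b
    have hN0 : N z ≠ 0 := (hz2.normSq_pos hz4).ne'
    rw [hN, hz1.fderiv_normSq hz2 b]
    change 2 * σ z (Z z) = p z * N z at hz3
    change _ = 1 / 2 * ((N z)⁻¹ * (2 * (σ z (Z z) * fderiv ℝ f z b + N z * σ z b))
      - p z * fderiv ℝ f z b)
    have : σ z (Z z) = p z * N z / 2 := by linarith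
    rw [this]
    field_simp
    ring
  have hanti := fderiv_antisymm_of_eq hσ hNs hp h.smooth_f hN0 hs
  have hσd := hσ.differentiableAt (by simp)
  have hZd := h.smooth_Z.differentiableAt (by simp)
  have hκ (b : E) : fderiv ℝ (fun z ↦ σ z (Z z)) y b
      = 1 / 2 * (fderiv ℝ p y b * N y + p y * fderiv ℝ N y b) := by
    have : (fun z ↦ σ z (Z z)) =ᶠ[𝓝 y] fun z ↦ 1 / 2 * (p z * N z) := by
      filter_upwards [hpe] with z hz
      change _ = p z * N z at hz
      linarith
    have hd : HasFDerivAt (fun z ↦ 1 / 2 * (p z * N z)) _ y :=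
      ((hp.differentiableAt (by simp)).hasFDerivAt.mul
        (hNs.differentiableAt (by simp)).hasFDerivAt).const_mul (1 / 2)
    rw [this.fderiv_eq, hd.fderiv]
    simp
    ring
  -- Cartan's formula `L_Z s = d(s(Z)) + i_Z ds` with `ds = -(1/2) dp ∧ df` turns the torsion
  -- equation into a proportionality of `dp` and `df`. The factor still contains `dp(Z)`, which the
  -- choice `b = Z` then determines.
  have key (b : E) : 3 / 2 * N y * fderiv ℝ p y b
      = (1 / 2 * r y * N y - 1 / 2 * p y ^ 2 * N y + fderiv ℝ p y (Z y)) * fderiv ℝ f y b := by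
    have e1 := h2 b
    have e2 := hanti (Z y) b
    have e3 := hκ b
    rw [fderiv_clm_apply_field hσd hZd] at e1 e3
    have e4 := h1.self_of_nhds.fderiv_normSq h b
    change fderiv ℝ N y b = 2 * (σ y (Z y) * fderiv ℝ f y b + N y * σ y b) at e4
    have e5 := hpe.self_of_nhds
    change _ = p y * N y at e5
    have e6 : fderiv ℝ f y (Z y) = N y := rfl
    rw [e6] at e2 hre
    have e7 : σ y (Z y) = p y * N y / 2 := by linarith
    have e8 : η y = r y * N y / 2 := by linarith
    rw [e7] at e4 e1
    rw [e4] at e3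
    rw [e8] at e1
    linear_combination (-1) * e1 - 2 * e2 - e3
  have k1 := key (Z y)
  have k2 : fderiv ℝ p y (Z y) = (r y - p y ^ 2) * N y := by
    have e6 : fderiv ℝ f y (Z y) = N y := rfl
    rw [e6] at k1
    have : N y * fderiv ℝ p y (Z y) = N y * ((r y - p y ^ 2) * N y) := by linarith
    exact mul_left_cancel₀ hN0 this
  have k3 := key b
  rw [k2] at k3
  have : N y * fderiv ℝ p y b = N y * ((r y - p y ^ 2) * fderiv ℝ f y b) := by linarith
  exact mul_left_cancel₀ hN0 this

theorem ScalarEq.fderiv_r {p r : E → ℝ} (h : IsGradient G f Z y)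
    (hη : ContDiffAt ℝ ∞ η y) (hp : ContDiffAt ℝ ∞ p y) (hr : ContDiffAt ℝ ∞ r y)
    (h1 : HessianEq G σ f Z y) (h3 : ScalarEq σ η Z y) (hf : fderiv ℝ f y ≠ 0)
    (hpe : 2 * σ y (Z y) = p y * fderiv ℝ f y (Z y))
    (hre : ∀ᶠ z in 𝓝 y, 2 * η z = r z * fderiv ℝ f z (Z z))
    (hdp : ∀ᶠ z in 𝓝 y, ∀ b, fderiv ℝ p z b = (r z - p z ^ 2) * fderiv ℝ f z b) (b : E) :
    fderiv ℝ r y b = -(p y * r y) * fderiv ℝ f y b := by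
  have hpd := hp.differentiableAt (by simp)
  have hrd := hr.differentiableAt (by simp)
  have hdf := (ContDiffAt.fderiv_top h.smooth_f).differentiableAt (by simp)
  have hdpd := (ContDiffAt.fderiv_top hp).differentiableAt (by simp)
  have hNs := h.contDiffAt_normSq
  have hNd := hNs.differentiableAt (by simp)
  have hN0 : fderiv ℝ f y (Z y) ≠ 0 := (h.normSq_pos hf).ne'
  have hess (a b : E) : fderiv ℝ (fderiv ℝ p) y a b
      = (fderiv ℝ r y a - 2 * p y * fderiv ℝ p y a) * fderiv ℝ f y b
        + (r y - p y ^ 2) * fderiv ℝ (fderiv ℝ f) y a b := by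
    rw [← fderiv_clm_apply_const hdpd]
    have e1 : (fun z ↦ fderiv ℝ p z b) =ᶠ[𝓝 y] fun z ↦ (r z - p z ^ 2) * fderiv ℝ f z b :=
      hdp.mono fun z hz ↦ hz b
    have hd : HasFDerivAt (fun z ↦ (r z - p z ^ 2) * fderiv ℝ f z b) _ y :=
      (hrd.hasFDerivAt.sub (hpd.hasFDerivAt.pow 2)).mul
        (hdf.hasFDerivAt.clm_apply (hasFDerivAt_const b y))
    rw [e1.fderiv_eq, hd.fderiv]
    simp
    ring
  -- Symmetry of the second derivative of `p`, with `dp = (r - p²) df`, gives `dr ∧ df = 0`, that is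
  -- `N dr = dr(Z) df`.
  have e1 := hess (Z y) b
  have e2 := hess b (Z y)
  rw [fderiv_fderiv_symm hp (Z y) b, e2, fderiv_fderiv_symm h.smooth_f (Z y) b,
    hdp.self_of_nhds, hdp.self_of_nhds] at e1
  -- Differentiating `2 h = r N` along `Z` and inserting the scalar equation yields the missing
  -- value `dr(Z) = -p r N`.
  have e3 : 2 * fderiv ℝ η y (Z y) = fderiv ℝ r y (Z y) * fderiv ℝ f y (Z y)
      + r y * fderiv ℝ (fun z ↦ fderiv ℝ f z (Z z)) y (Z y) := by
    have : (fun z ↦ 2 * η z) =ᶠ[𝓝 y] fun z ↦ r z * fderiv ℝ f z (Z z) := hre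
    have h2 := congrArg (fun L ↦ L (Z y)) (this.fderiv_eq (𝕜 := ℝ))
    have hd : HasFDerivAt (fun z ↦ r z * fderiv ℝ f z (Z z)) _ y :=
      hrd.hasFDerivAt.mul hNd.hasFDerivAt
    rw [((hη.differentiableAt (by simp)).hasFDerivAt.const_mul 2).fderiv, hd.fderiv] at h2
    simp at h2
    linarith
  rw [h1.fderiv_normSq h, h3] at e3
  have e4 := hre.self_of_nhds
  generalize fderiv ℝ f y (Z y) = N at *
  have e5 : σ y (Z y) = p y * N / 2 := by linarith
  have e6 : η y = r y * N / 2 := by linarith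
  rw [e5, e6] at e3
  have e7 : fderiv ℝ r y (Z y) = -(p y * r y) * N := by
    apply mul_left_cancel₀ hN0
    linear_combination (-1) * e3
  rw [e7] at e1
  apply mul_left_cancel₀ hN0
  linear_combination e1

/-- The equations on `f` from those on `p` and `r`. -/
theorem potentialEq_of_fderiv {p r : E → ℝ} (h : IsGradient G f Z y)
    (hσ : ContDiffAt ℝ ∞ σ y)
    (hp : ContDiffAt ℝ ∞ p y) (hr : ContDiffAt ℝ ∞ r y)
    (h1 : ∀ᶠ z in 𝓝 y, HessianEq G σ f Z z) (hg : ∀ᶠ z in 𝓝 y, IsGradient G f Z z)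
    (hf : ∀ᶠ z in 𝓝 y, fderiv ℝ f z ≠ 0)
    (hs : ∀ᶠ z in 𝓝 y, ∀ b, σ z b = 1 / 2 * ((fderiv ℝ f z (Z z))⁻¹
      * fderiv ℝ (fun x ↦ fderiv ℝ f x (Z x)) z b - p z * fderiv ℝ f z b))
    (hre : ∀ᶠ z in 𝓝 y, 2 * η z = r z * fderiv ℝ f z (Z z))
    (hdp : ∀ b, fderiv ℝ p y b = (r y - p y ^ 2) * fderiv ℝ f y b)
    (hdr : ∀ b, fderiv ℝ r y b = -(p y * r y) * fderiv ℝ f y b) :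
    TorsionEq σ η f Z y ∧ ScalarEq σ η Z y := by
  set N : E → ℝ := fun z ↦ fderiv ℝ f z (Z z) with hN
  have hNs : ContDiffAt ℝ ∞ N y := h.contDiffAt_normSq
  have hNd := hNs.differentiableAt (by simp)
  have hN0 : N y ≠ 0 := (h.normSq_pos hf.self_of_nhds).ne'
  have hσd := hσ.differentiableAt (by simp)
  have hZd := h.smooth_Z.differentiableAt (by simp)
  -- Evaluating the formula for `s` on `Z`, with `dN(Z) = 4 N s(Z)` from the Hessian equation, shows
  -- that `p` is necessarily `2 s(∇f) / N`.
  have hpe : ∀ᶠ z in 𝓝 y, 2 * σ z (Z z) = p z * N z := by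
    filter_upwards [h1, hg, hs, hf] with z hz1 hz2 hz3 hz4
    have hN0 : N z ≠ 0 := (hz2.normSq_pos hz4).ne'
    have e1 := hz3 (Z z)
    have e2 := hz1.fderiv_normSq hz2 (Z z)
    change fderiv ℝ N z (Z z) = 2 * (σ z (Z z) * N z + N z * σ z (Z z)) at e2
    change σ z (Z z) = 1 / 2 * ((N z)⁻¹ * fderiv ℝ N z (Z z) - p z * N z) at e1
    rw [e2] at e1
    field_simp at e1
    linarith
  have hanti := fderiv_antisymm_of_eq hσ hNs hp h.smooth_f hN0 hs
  have e5 := hpe.self_of_nhds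
  have e8 := hre.self_of_nhds
  have e4 (b : E) : fderiv ℝ N y b = 2 * (σ y (Z y) * fderiv ℝ f y b + N y * σ y b) :=
    h1.self_of_nhds.fderiv_normSq h b
  have e6 : fderiv ℝ f y (Z y) = N y := rfl
  have e9 : σ y (Z y) = p y * N y / 2 := by linarith
  have e10 : η y = r y * N y / 2 := by linarith
  constructor
  · intro b
    have e3 : fderiv ℝ (fun z ↦ σ z (Z z)) y b
        = 1 / 2 * (fderiv ℝ p y b * N y + p y * fderiv ℝ N y b) := by
      have : (fun z ↦ σ z (Z z)) =ᶠ[𝓝 y] fun z ↦ 1 / 2 * (p z * N z) := by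
        filter_upwards [hpe] with z hz
        linarith
      have hd : HasFDerivAt (fun z ↦ 1 / 2 * (p z * N z)) _ y :=
        ((hp.differentiableAt (by simp)).hasFDerivAt.mul hNd.hasFDerivAt).const_mul (1 / 2)
      rw [this.fderiv_eq, hd.fderiv]
      simp
      ring
    have e2 := hanti (Z y) b
    rw [fderiv_clm_apply_field hσd hZd] at e3 ⊢
    rw [hdp, hdp, e6] at e2
    rw [hdp, e4, e9] at e3
    rw [e9, e10]
    linear_combination (-1) * e3 - 2 * e2
  · have e3 : 2 * fderiv ℝ η y (Z y) = fderiv ℝ r y (Z y) * N y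
        + r y * fderiv ℝ N y (Z y) := by
      have : η =ᶠ[𝓝 y] fun z ↦ 1 / 2 * (r z * N z) := by
        filter_upwards [hre] with z hz
        change _ = r z * N z at hz
        linarith
      have hd : HasFDerivAt (fun z ↦ 1 / 2 * (r z * N z)) _ y :=
        ((hr.differentiableAt (by simp)).hasFDerivAt.mul hNd.hasFDerivAt).const_mul (1 / 2)
      rw [this.fderiv_eq, hd.fderiv]
      simp
      ring
    rw [hdr, e4, e6, e9] at e3
    unfold ScalarEq
    rw [e9, e10]
    linarith

/-- The Lie derivative along `q Z`. -/
theorem IsGradient.lieForm_smul (h : IsGradient G f Z y) {q : E → ℝ}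
    (hq : DifferentiableAt ℝ q y) (a b : E) :
    lieForm (fun z a b ↦ G z a b) (fun z ↦ q z • Z z) y a b
      = q y * lieForm (fun z a b ↦ G z a b) Z y a b + fderiv ℝ q y a * fderiv ℝ f y b
        + fderiv ℝ q y b * fderiv ℝ f y a := by
  have hZ := h.smooth_Z.differentiableAt (by simp)
  unfold lieForm
  have hd : HasFDerivAt (fun z ↦ q z • Z z) _ y := hq.hasFDerivAt.smul hZ.hasFDerivAt
  rw [hd.fderiv, ← h.grad.self_of_nhds a,
    ← h.grad.self_of_nhds b, h.symm.self_of_nhds (Z y) a]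
  simp
  ring

end Potential

/-! ### Uniqueness for linear homogeneous total differential equations -/

section Gronwall

variable {E V : Type*} [NormedAddCommGroup E] [NormedSpace ℝ E] [NormedAddCommGroup V]
  [NormedSpace ℝ V]

/-- A solution of a linear homogeneous total differential equation which vanishes at a point
vanishes nearby. -/
theorem eventually_eq_zero_of_norm_fderiv_le {z : E → V} {y : E} {C : ℝ}
    (h : ∀ᶠ x in 𝓝 y, DifferentiableAt ℝ z x ∧ ‖fderiv ℝ z x‖ ≤ C * ‖z x‖) (h0 : z y = 0) :
    ∀ᶠ x in 𝓝 y, z x = 0 := by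
  obtain ⟨ε, hε, hb⟩ := Metric.eventually_nhds_iff_ball.1 h
  refine Metric.eventually_nhds_iff_ball.2 ⟨ε, hε, fun x hx ↦ ?_⟩
  have hmem : ∀ t ∈ Icc (0 : ℝ) 1, y + t • (x - y) ∈ Metric.ball y ε := by
    intro t ht
    have := (convex_ball y ε).add_smul_sub_mem (Metric.mem_ball_self hε) hx ht
    exact this
  have hd : ∀ t ∈ Icc (0 : ℝ) 1, HasDerivAt (fun t : ℝ ↦ z (y + t • (x - y)))
      (fderiv ℝ z (y + t • (x - y)) (x - y)) t := by
    intro t ht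
    have h1 : HasDerivAt (fun t : ℝ ↦ y + t • (x - y)) (x - y) t := by
      simpa using ((hasDerivAt_id t).smul_const (x - y)).const_add y
    exact (hb _ (hmem t ht)).1.hasFDerivAt.comp_hasDerivAt t h1
  -- Gronwall's inequality on the segment from `y` to `x`, which stays in the ball.
  have := eq_zero_of_abs_deriv_le_mul_abs_self_of_eq_zero_right (a := 0) (b := 1)
    (K := C * ‖x - y‖)
    (fun t ht ↦ (hd t ht).continuousAt.continuousWithinAt)
    (fun t ht ↦ (hd t ⟨ht.1, ht.2.le⟩).hasDerivWithinAt) (by simp [h0])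
    (fun t ht ↦ by
      refine (ContinuousLinearMap.le_opNorm _ _).trans ?_
      have := mul_le_mul_of_nonneg_right (hb _ (hmem t ⟨ht.1, ht.2.le⟩)).2 (norm_nonneg (x - y))
      linarith) 1 (by simp)
  simpa using this

theorem norm_fderiv_le_of_continuousAt {z : E → V} {y : E} {c : E → ℝ} (hc : ContinuousAt c y)
    (h : ∀ᶠ x in 𝓝 y, DifferentiableAt ℝ z x ∧ ‖fderiv ℝ z x‖ ≤ c x * ‖z x‖) :
    ∃ C, ∀ᶠ x in 𝓝 y, DifferentiableAt ℝ z x ∧ ‖fderiv ℝ z x‖ ≤ C * ‖z x‖ := by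
  refine ⟨c y + 1, ?_⟩
  filter_upwards [h, hc.eventually (gt_mem_nhds (lt_add_one (c y)))] with x hx hx'
  exact ⟨hx.1, hx.2.trans (mul_le_mul_of_nonneg_right hx'.le (norm_nonneg _))⟩

/-- `G` is Lipschitz near `y` with some constant `B`, so each scalar function `z ↦ G z v w` is
Lipschitz with constant `B ‖v‖ ‖w‖`, which bounds its derivative. -/
theorem exists_fderiv_bilin_le {G : E → E →L[ℝ] E →L[ℝ] ℝ} {y : E} (hG : ContDiffAt ℝ ∞ G y) :
    ∃ B : NNReal, ∀ᶠ z in 𝓝 y, ∀ u v w, |fderiv ℝ G z u v w| ≤ B * ‖u‖ * ‖v‖ * ‖w‖ := by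
  obtain ⟨B, t, ht, hB⟩ := (hG.of_le (m := 1) (by simp)).exists_lipschitzOnWith
  refine ⟨B, ?_⟩
  filter_upwards [eventually_mem_nhds_iff.2 ht, (hG.of_le (m := 1) (by simp)).eventually (by simp)] with z hz hGz u v w
  have hd := (hGz.differentiableAt (by simp)).hasFDerivAt
  have h1 : fderiv ℝ (fun x ↦ G x v w) z u = fderiv ℝ G z u v w := by
    rw [HasFDerivAt.bilin_apply hd (hasFDerivAt_const v z) (hasFDerivAt_const w z)]
    simp
  have h2 : LipschitzOnWith (B * ‖v‖₊ * ‖w‖₊) (fun x ↦ G x v w) t := by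
    refine LipschitzOnWith.of_dist_le_mul fun x hx x' hx' ↦ ?_
    have := hB.dist_le_mul x hx x' hx'
    rw [dist_eq_norm] at this ⊢
    have h3 : ‖(G x - G x') v w‖ ≤ ‖G x - G x'‖ * ‖v‖ * ‖w‖ := (G x - G x').le_opNorm₂ v w
    refine h3.trans ?_
    have := mul_le_mul_of_nonneg_right this (mul_nonneg (norm_nonneg v) (norm_nonneg w))
    simp only [NNReal.coe_mul, coe_nnnorm]
    linarith
  have h4 := (fderiv ℝ (fun x ↦ G x v w) z).le_of_opNorm_le
    (norm_fderiv_le_of_lipschitzOn ℝ hz h2) u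
  rw [h1, Real.norm_eq_abs] at h4
  refine h4.trans (le_of_eq ?_)
  simp only [NNReal.coe_mul, coe_nnnorm]
  ring

/-- The differential of a solution of the Hessian equation solves a linear equation. -/
theorem HessianEq.exists_norm_le {G : E → E →L[ℝ] E →L[ℝ] ℝ}
    {σ : E → E →L[ℝ] ℝ} {f : E → ℝ} {Z : E → E} {y : E} (hσ : ContinuousAt σ y)
    (h : IsGradient G f Z y)
    (h1 : ∀ᶠ z in 𝓝 y, HessianEq G σ f Z z) (hg : ∀ᶠ z in 𝓝 y, IsGradient G f Z z)
    {K : ℝ} (hZ : ∀ᶠ z in 𝓝 y, ‖Z z‖ ≤ K * ‖fderiv ℝ f z‖) :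
    ∃ C, ∀ᶠ z in 𝓝 y, DifferentiableAt ℝ (fderiv ℝ f) z
      ∧ ‖fderiv ℝ (fderiv ℝ f) z‖ ≤ C * ‖fderiv ℝ f z‖ := by
  have hK : ∀ᶠ z in 𝓝 y, ‖Z z‖ ≤ |K| * ‖fderiv ℝ f z‖ := hZ.mono fun z hz ↦
    hz.trans (mul_le_mul_of_nonneg_right (le_abs_self K) (norm_nonneg _))
  obtain ⟨B, hB⟩ := exists_fderiv_bilin_le h.smooth_G
  refine norm_fderiv_le_of_continuousAt (c := fun z ↦ 2 * ‖σ z‖ + 2 * B * |K|)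
    (by fun_prop) ?_
  filter_upwards [h1, hg, hK, hB] with z hz1 hz2 hz3 b3
  refine ⟨(ContDiffAt.fderiv_top hz2.smooth_f).differentiableAt (by simp), ?_⟩
  refine ContinuousLinearMap.opNorm_le_bound₂ _ (by positivity) fun a b ↦ ?_
  have e1 := hz1 a b
  rw [hz2.lieForm_eq] at e1
  have b2 (L : E →L[ℝ] ℝ) (u : E) : |L u| ≤ ‖L‖ * ‖u‖ := L.le_opNorm u
  have c1 := b3 (Z z) a b
  have c2 := b3 a (Z z) b
  have c3 := b3 b (Z z) a
  have d1 : B * ‖Z z‖ ≤ B * (|K| * ‖fderiv ℝ f z‖) := by gcongr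
  have d2 := mul_le_mul_of_nonneg_right d1 (mul_nonneg (norm_nonneg a) (norm_nonneg b))
  have m1 : |σ z a * fderiv ℝ f z b| ≤ ‖σ z‖ * ‖a‖ * (‖fderiv ℝ f z‖ * ‖b‖) := by
    rw [abs_mul]; exact mul_le_mul (b2 _ _) (b2 _ _) (abs_nonneg _) (by positivity)
  have m2 : |σ z b * fderiv ℝ f z a| ≤ ‖σ z‖ * ‖b‖ * (‖fderiv ℝ f z‖ * ‖a‖) := by
    rw [abs_mul]; exact mul_le_mul (b2 _ _) (b2 _ _) (abs_nonneg _) (by positivity)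
  have hpos : 0 ≤ (B : ℝ) * (|K| * ‖fderiv ℝ f z‖) * (‖a‖ * ‖b‖) := by positivity
  -- The Hessian equation solved for the second derivative: each term on the right is linear in `df`
  -- or in `Z`, and `‖Z‖` is controlled by `‖df‖`.
  have e2 : fderiv ℝ (fderiv ℝ f) z a b = σ z a * fderiv ℝ f z b + σ z b * fderiv ℝ f z a
      - 1 / 2 * (fderiv ℝ G z (Z z) a b - fderiv ℝ G z a (Z z) b - fderiv ℝ G z b (Z z) a) := by
    linarith
  rw [e2, Real.norm_eq_abs, abs_le]
  rw [abs_le] at c1 c2 c3 m1 m2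
  constructor <;> linarith [c1.1, c1.2, c2.1, c2.2, c3.1, c3.2, m1.1, m1.2, m2.1, m2.2]

end Gronwall

section ChartGlobal

variable {E V : Type*} [NormedAddCommGroup E] [NormedSpace ℝ E] [NormedAddCommGroup V]
  [NormedSpace ℝ V] {H : Type*} [TopologicalSpace H] {I : ModelWithCorners ℝ E H}
  {M : Type*} [TopologicalSpace M] [ChartedSpace H M]

/-- Pull a property holding near the coordinates of `x` back to the manifold. -/
theorem eventually_of_chart {x : M} {P : M → Prop}
    (h : ∀ᶠ y in 𝓝 (extChartAt I x x), P ((extChartAt I x).symm y)) : ∀ᶠ p in 𝓝 x, P p := by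
  filter_upwards [(continuousAt_extChartAt (I := I) x).eventually h,
    extChartAt_source_mem_nhds (I := I) x] with p hp hps
  rwa [(extChartAt I x).left_inv hps] at hp

/-- A solution of a linear homogeneous total differential equation on a connected manifold
which vanishes at a point vanishes everywhere. -/
theorem eq_zero_of_chart_norm_le [PreconnectedSpace M] {z : M → V}
    (h : ∀ x : M, ∃ C, ∀ᶠ y in 𝓝 (extChartAt I x x),
      DifferentiableAt ℝ (z ∘ (extChartAt I x).symm) y ∧
        ‖fderiv ℝ (z ∘ (extChartAt I x).symm) y‖ ≤ C * ‖(z ∘ (extChartAt I x).symm) y‖)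
    {x₁ : M} (h1 : z x₁ = 0) (x : M) : z x = 0 := by
  have hcont : Continuous z := by
    refine continuous_iff_continuousAt.2 fun x ↦ ?_
    obtain ⟨C, hC⟩ := h x
    have h1 := ContinuousAt.comp (x := x) hC.self_of_nhds.1.continuousAt
      (continuousAt_extChartAt (I := I) x)
    refine h1.congr ?_
    filter_upwards [extChartAt_source_mem_nhds (I := I) x] with p hp
    exact congrArg z ((extChartAt I x).left_inv hp)
  have hclopen : IsClopen {x | z x = 0} := by
    refine ⟨isClosed_eq hcont continuous_const, isOpen_iff_mem_nhds.2 fun x hx ↦ ?_⟩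
    obtain ⟨C, hC⟩ := h x
    have := eventually_eq_zero_of_norm_fderiv_le hC (by simpa using hx)
    exact eventually_of_chart (I := I) this
  have : x ∈ {x | z x = 0} := hclopen.eq_univ ⟨x₁, h1⟩ ▸ mem_univ x
  exact this

end ChartGlobal

/-! ### Vector fields and covariant tensors in the charts of a manifold -/

section ChartApi

variable {E V : Type*} [NormedAddCommGroup E] [NormedSpace ℝ E] [NormedAddCommGroup V]
  [NormedSpace ℝ V] {H : Type*} [TopologicalSpace H] {I : ModelWithCorners ℝ E H}
  [I.Boundaryless]
  {M : Type*} [TopologicalSpace M] [ChartedSpace H M]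

theorem mfderiv_chart_symm_apply [IsManifold I 1 M] {x : M} {y : E}
    (hy : y ∈ (extChartAt I x).target) (a : E) :
    mfderiv I 𝓘(ℝ, E) (extChartAt I x) ((extChartAt I x).symm y)
      (mfderiv 𝓘(ℝ, E) I (extChartAt I x).symm y a) = a := by
  have := mfderiv_extChartAt_comp_mfderivWithin_extChartAt_symm hy
  rw [I.range_eq_univ, mfderivWithin_univ] at this
  exact congrArg (fun L ↦ L a) this

theorem mfderiv_symm_chart_apply [IsManifold I 1 M] {x : M} {y : E}
    (hy : y ∈ (extChartAt I x).target)
    (w : TangentSpace I ((extChartAt I x).symm y)) :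
    mfderiv 𝓘(ℝ, E) I (extChartAt I x).symm y
      (mfderiv I 𝓘(ℝ, E) (extChartAt I x) ((extChartAt I x).symm y) w) = w := by
  have := mfderivWithin_extChartAt_symm_comp_mfderiv_extChartAt hy
  rw [I.range_eq_univ, mfderivWithin_univ] at this
  exact congrArg (fun L ↦ L w) this

theorem contMDiffAt_symm [IsManifold I ∞ M] {x : M} {y : E}
    (hy : y ∈ (extChartAt I x).target) :
    ContMDiffAt 𝓘(ℝ, E) I ∞ (extChartAt I x).symm y :=
  (contMDiffOn_extChartAt_symm x).contMDiffAt ((isOpen_extChartAt_target x).mem_nhds hy)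

theorem contMDiff_iff_chart [IsManifold I ∞ M] {f : M → V} :
    ContMDiff I 𝓘(ℝ, V) ∞ f ↔ ∀ x : M, ∀ y ∈ (extChartAt I x).target,
      ContDiffAt ℝ ∞ (f ∘ (extChartAt I x).symm) y := by
  constructor
  · intro h x y hy
    exact (h.contMDiffAt.comp y (contMDiffAt_symm hy)).contDiffAt
  · intro h x
    have h1 := (h x _ (mem_extChartAt_target (I := I) x)).contMDiffAt.comp x
      (contMDiffAt_extChartAt (I := I) (n := ∞))
    refine h1.congr_of_eventuallyEq ?_
    filter_upwards [extChartAt_source_mem_nhds (I := I) x] with p hp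
    exact (congrArg f ((extChartAt I x).left_inv hp)).symm

/-- This identifies the fibre coordinate of the tangent bundle with the derivative of the chart, so
that smoothness of a section is smoothness of its `coordField`. -/
theorem trivializationAt_tangent_apply [IsManifold I 1 M] {x p : M}
    (hp : p ∈ (extChartAt I x).source) (w : TangentSpace I p) :
    (trivializationAt E (TangentSpace I) x ⟨p, w⟩).2 = mfderiv I 𝓘(ℝ, E) (extChartAt I x) p w := by
  rw [extChartAt_source] at hp
  have h := congrArg (fun L ↦ L w) (TangentBundle.continuousLinearMapAt_trivializationAt hp)
  refine Eq.trans ?_ h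
  have h2 := Bundle.Trivialization.coe_linearMapAt_of_mem (R := ℝ)
    (trivializationAt E (TangentSpace I) x) (b := p) (by simpa using hp)
  exact (congrFun h2 w).symm

theorem smoothField_iff_chart [IsManifold I ∞ M] [IsManifold I 1 M] {X : VField I M} :
    SmoothField X ↔ ∀ x : M, ∀ y ∈ (extChartAt I x).target,
      ContDiffAt ℝ ∞ (coordField X x) y := by
  constructor
  · intro h x y hy
    have hp := (extChartAt I x).map_target hy
    have h1 := ((trivializationAt E (TangentSpace I) x).contMDiffAt_section_iff
      (by simpa using hp)).1 (h ((extChartAt I x).symm y))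
    refine ((h1.comp y (contMDiffAt_symm hy)).contDiffAt).congr_of_eventuallyEq ?_
    filter_upwards [(isOpen_extChartAt_target x).mem_nhds hy] with z hz
    exact (trivializationAt_tangent_apply ((extChartAt I x).map_target hz) _).symm
  · intro h x
    refine (Bundle.contMDiffAt_section x).2 ?_
    have h1 := (h x _ (mem_extChartAt_target (I := I) x)).contMDiffAt.comp x
      (contMDiffAt_extChartAt (I := I) (n := ∞))
    refine h1.congr_of_eventuallyEq ?_
    filter_upwards [extChartAt_source_mem_nhds (I := I) x] with p hp
    rw [trivializationAt_tangent_apply hp]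
    simp only [Function.comp, coordField]
    rw [(extChartAt I x).left_inv hp]

/-- The coordinate field `∂_a` of a chart is smooth. -/
theorem contMDiffAt_coordinate_field [IsManifold I ∞ M] [IsManifold I 1 M] (x : M) (a : E) {p : M}
    (hp : p ∈ (extChartAt I x).source) : ContMDiffAt I I.tangent ∞ (fun p ↦
      (⟨p, mfderiv 𝓘(ℝ, E) I (extChartAt I x).symm (extChartAt I x p) a⟩ : TangentBundle I M)) p := by
  refine ((trivializationAt E (TangentSpace I) x).contMDiffAt_section_iff
    (s := fun p ↦ (show TangentSpace I p from
      mfderiv 𝓘(ℝ, E) I (extChartAt I x).symm (extChartAt I x p) a))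
      (by simpa using hp)).2 ?_
  refine (contMDiffAt_const (c := a)).congr_of_eventuallyEq ?_
  filter_upwards [(isOpen_extChartAt_source (I := I) x).mem_nhds hp] with q hq
  refine (trivializationAt_tangent_apply hq _).trans ?_
  have := mfderiv_chart_symm_apply ((extChartAt I x).map_source hq) a
  rw [(extChartAt I x).left_inv hq] at this
  exact this

/-- The components of a one-form in a chart. -/
def coordCovec (α : ∀ p : M, TangentSpace I p →L[ℝ] ℝ) (x : M) (y : E) : E →L[ℝ] ℝ :=
  (α ((extChartAt I x).symm y)).comp (mfderiv 𝓘(ℝ, E) I (extChartAt I x).symm y)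

/-- The components of a covariant 2-tensor in a chart, as a bilinear form. -/
def coordForm (g : Tensor2 I M) (x : M) (y : E) : E →L[ℝ] E →L[ℝ] ℝ :=
  pullback2 (mfderiv 𝓘(ℝ, E) I (extChartAt I x).symm y) (g ((extChartAt I x).symm y))

theorem coordForm_apply (g : Tensor2 I M) (x : M) (y a b : E) :
    coordForm g x y a b = coordTensor g x y a b := rfl

theorem coordLieDeriv_eq (g : Tensor2 I M) (X : VField I M) (x : M) (y a b : E) :
    coordLieDeriv g X x y a b
      = lieForm (fun z a b ↦ coordForm g x z a b) (coordField X x) y a b := rfl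

theorem coordCovec_coordField [IsManifold I 1 M] (α : ∀ p : M, TangentSpace I p →L[ℝ] ℝ)
    (X : VField I M) (x : M) {y : E} (hy : y ∈ (extChartAt I x).target) :
    coordCovec α x y (coordField X x y)
      = α ((extChartAt I x).symm y) (X ((extChartAt I x).symm y)) :=
  congrArg (α _) (mfderiv_symm_chart_apply hy _)

theorem coordForm_coordField [IsManifold I 1 M] (g : Tensor2 I M)
    (X : VField I M) (x : M) {y : E} (hy : y ∈ (extChartAt I x).target) (b : E) :
    coordForm g x y (coordField X x y) b
      = coordCovec (fun p ↦ g p (X p)) x y b :=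
  congrArg (fun w ↦ g ((extChartAt I x).symm y) w _) (mfderiv_symm_chart_apply hy _)

theorem coordCovec_ext [IsManifold I 1 M] {α β : ∀ p : M, TangentSpace I p →L[ℝ] ℝ}
    (h : ∀ x : M, ∀ y ∈ (extChartAt I x).target, ∀ a, coordCovec α x y a = coordCovec β x y a)
    (x : M) : α x = β x := by
  ext w
  have hx := mem_extChartAt_target (I := I) x
  have hl := (extChartAt I x).left_inv (mem_extChartAt_source (I := I) x)
  have := h x _ hx (mfderiv I 𝓘(ℝ, E) (extChartAt I x) ((extChartAt I x).symm (extChartAt I x x))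
    (show TangentSpace I _ from w))
  have e (α : ∀ p : M, TangentSpace I p →L[ℝ] ℝ) := congrArg
    (α ((extChartAt I x).symm (extChartAt I x x))) (mfderiv_symm_chart_apply hx w)
  have e' := (e α).symm.trans (this.trans (e β))
  rw [hl] at e'
  exact e'

theorem fderiv_comp_symm [IsManifold I ∞ M] [IsManifold I 1 M] {f : M → ℝ} {x : M} {y : E}
    (hf : MDifferentiableAt I 𝓘(ℝ, ℝ) f ((extChartAt I x).symm y))
    (hy : y ∈ (extChartAt I x).target) :
    fderiv ℝ (f ∘ (extChartAt I x).symm) y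
      = coordCovec (fun p ↦ (mfderiv I 𝓘(ℝ, ℝ) f p : TangentSpace I p →L[ℝ] ℝ)) x y := by
  rw [← mfderiv_eq_fderiv, mfderiv_comp y hf
    ((contMDiffAt_symm (I := I) hy).mdifferentiableAt (by simp))]
  rfl

theorem contDiffAt_coordForm [IsManifold I ∞ M] [IsManifold I 1 M] [FiniteDimensional ℝ E]
    {g : Tensor2 I M} (hg : ContMDiff I (I.prod 𝓘(ℝ, E →L[ℝ] E →L[ℝ] ℝ)) ∞
      (fun b ↦ Bundle.TotalSpace.mk' (E →L[ℝ] E →L[ℝ] ℝ)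
        (E := fun p : M ↦ TangentSpace I p →L[ℝ] TangentSpace I p →L[ℝ] ℝ) b (g b)))
    {x : M} {y : E} (hy : y ∈ (extChartAt I x).target) :
    ContDiffAt ℝ ∞ (coordForm g x) y := by
  have key (a b : E) : ∀ y ∈ (extChartAt I x).target,
      ContDiffAt ℝ ∞ (fun z ↦ coordForm g x z a b) y := by
    intro y hy
    have hp := (extChartAt I x).map_target hy
    have h1 := ContMDiffAt.clm_bundle_apply₂ (F₁ := E) (F₂ := E) (F₃ := ℝ)
      (E₁ := fun p : M ↦ TangentSpace I p) (E₂ := fun p : M ↦ TangentSpace I p)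
      (E₃ := Bundle.Trivial M ℝ) (b := fun p ↦ p) (ψ := g)
      hg.contMDiffAt (contMDiffAt_coordinate_field x a hp) (contMDiffAt_coordinate_field x b hp)
    have h2 := (Bundle.contMDiffAt_totalSpace.1 h1).2
    have h3 := (h2.comp y (contMDiffAt_symm hy)).contDiffAt
    refine h3.congr_of_eventuallyEq ?_
    filter_upwards [(isOpen_extChartAt_target x).mem_nhds hy] with z hz
    have := (extChartAt I x).right_inv hz
    simp only [coordForm_apply, coordTensor, Function.comp]
    rw [this]
    rfl
  -- In finite dimension, smoothness of an operator-valued map can be tested on fixed vectors, where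
  -- it is the tensor applied to smooth coordinate fields.
  have hon : ContDiffOn ℝ ∞ (coordForm g x) (extChartAt I x).target := by
    refine contDiffOn_clm_apply.2 fun a ↦ contDiffOn_clm_apply.2 fun b z hz ↦ ?_
    exact (key a b z hz).contDiffWithinAt
  exact hon.contDiffAt ((isOpen_extChartAt_target x).mem_nhds hy)

theorem contDiffAt_coordCovec [IsManifold I ∞ M] [IsManifold I 1 M] [FiniteDimensional ℝ E]
    {α : ∀ p : M, TangentSpace I p →L[ℝ] ℝ} (hα : ContMDiff I (I.prod 𝓘(ℝ, E →L[ℝ] ℝ)) ∞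
      (fun b ↦ Bundle.TotalSpace.mk' (E →L[ℝ] ℝ)
        (E := fun p : M ↦ (TangentSpace I p →L[ℝ] ℝ)) b (α b)))
    {x : M} {y : E} (hy : y ∈ (extChartAt I x).target) :
    ContDiffAt ℝ ∞ (coordCovec α x) y := by
  have key (a : E) : ∀ y ∈ (extChartAt I x).target,
      ContDiffAt ℝ ∞ (fun z ↦ coordCovec α x z a) y := by
    intro y hy
    have hp := (extChartAt I x).map_target hy
    have h1 := ContMDiffAt.clm_bundle_apply (F₁ := E) (F₂ := ℝ)
      (E₁ := fun p : M ↦ TangentSpace I p)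
      (E₂ := Bundle.Trivial M ℝ) (b := fun p ↦ p) (ϕ := α)
      hα.contMDiffAt (contMDiffAt_coordinate_field x a hp)
    have h2 := (Bundle.contMDiffAt_totalSpace.1 h1).2
    have h3 := (h2.comp y (contMDiffAt_symm hy)).contDiffAt
    refine h3.congr_of_eventuallyEq ?_
    filter_upwards [(isOpen_extChartAt_target x).mem_nhds hy] with z hz
    have := (extChartAt I x).right_inv hz
    simp only [coordCovec, Function.comp]
    rw [this]
    rfl
  have hon : ContDiffOn ℝ ∞ (coordCovec α x) (extChartAt I x).target :=
    contDiffOn_clm_apply.2 fun a z hz ↦ (key a z hz).contDiffWithinAt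
  exact hon.contDiffAt ((isOpen_extChartAt_target x).mem_nhds hy)

end ChartApi

/-! ### Inversion of the metric and linearity of the potential equations -/

section LinearComb

variable {E : Type*} [NormedAddCommGroup E] [NormedSpace ℝ E]

theorem _root_.ContinuousLinearMap.isInvertible_of_posDef [FiniteDimensional ℝ E]
    {B : E →L[ℝ] E →L[ℝ] ℝ} (hB : ∀ a, a ≠ 0 → 0 < B a a) : B.IsInvertible := by
  have hinj : Function.Injective (B : E →ₗ[ℝ] (E →L[ℝ] ℝ)) := by
    refine (injective_iff_map_eq_zero _).2 fun a ha ↦ ?_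
    by_contra h
    have := hB a h
    have ha' : B a = 0 := ha
    rw [ha'] at this
    simp at this
  have hdim : Module.finrank ℝ E = Module.finrank ℝ (E →L[ℝ] ℝ) := by
    rw [← (LinearMap.toContinuousLinearMap (𝕜 := ℝ) (E := E) (F' := ℝ)).finrank_eq]
    exact Subspace.dual_finrank_eq.symm
  refine ⟨(LinearMap.linearEquivOfInjective _ hinj hdim).toContinuousLinearEquiv, ?_⟩
  ext a b
  rfl

variable {G : E → E →L[ℝ] E →L[ℝ] ℝ} {σ : E → E →L[ℝ] ℝ} {η : E → ℝ} {f g : E → ℝ} {Z W : E → E}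
  {y : E}

theorem HessianEq.comb (hf : DifferentiableAt ℝ f y) (hg : DifferentiableAt ℝ g y)
    (hZ : DifferentiableAt ℝ Z y) (hW : DifferentiableAt ℝ W y) (c : ℝ)
    (h1 : HessianEq G σ f Z y) (h2 : HessianEq G σ g W y) :
    HessianEq G σ (c • f + g) (c • Z + W) y := by
  intro a b
  have e1 := h1 a b
  have e2 := h2 a b
  unfold lieForm at e1 e2 ⊢
  rw [fderiv_add (hf.const_smul c) hg, fderiv_add (hZ.const_smul c) hW, fderiv_const_smul hf,
    fderiv_const_smul hZ]
  simp only [Pi.add_apply, Pi.smul_apply, map_add, map_smul, add_apply,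
    smul_apply, smul_eq_mul] at e1 e2 ⊢
  linear_combination c * e1 + e2

theorem TorsionEq.comb (hσ : DifferentiableAt ℝ σ y)
    (hf : DifferentiableAt ℝ f y) (hg : DifferentiableAt ℝ g y)
    (hZ : DifferentiableAt ℝ Z y) (hW : DifferentiableAt ℝ W y) (c : ℝ)
    (h1 : TorsionEq σ η f Z y) (h2 : TorsionEq σ η g W y) :
    TorsionEq σ η (c • f + g) (c • Z + W) y := by
  intro b
  have e1 := h1 b
  have e2 := h2 b
  rw [fderiv_clm_apply_field hσ hZ] at e1
  rw [fderiv_clm_apply_field hσ hW] at e2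
  rw [fderiv_clm_apply_field hσ ((hZ.const_smul c).add hW), fderiv_add (hf.const_smul c) hg,
    fderiv_add (hZ.const_smul c) hW, fderiv_const_smul hf, fderiv_const_smul hZ]
  simp only [Pi.add_apply, Pi.smul_apply, map_add, map_smul, add_apply,
    smul_apply, smul_eq_mul] at e1 e2 ⊢
  linear_combination c * e1 + e2

theorem ScalarEq.comb (c : ℝ) (h1 : ScalarEq σ η Z y) (h2 : ScalarEq σ η W y) :
    ScalarEq σ η (c • Z + W) y := by
  unfold ScalarEq at *
  simp only [Pi.add_apply, Pi.smul_apply, map_add, map_smul, smul_eq_mul, h1, h2]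
  ring

theorem lieForm_zero (B : E → E →L[ℝ] E →L[ℝ] ℝ) (y a b : E) :
    lieForm (fun z a b ↦ B z a b) 0 y a b = 0 := by
  simp [lieForm]

end LinearComb

/-! ### The space of potentials on the cut -/

section Potential

variable {d : ℕ} {S : Type*} [TopologicalSpace S] [ChartedSpace (EuclideanSpace ℝ (Fin d)) S]
  [IsManifold (𝓡 d) ∞ S] (γ : RMetric d S) (s : OneForm d S) (h : S → ℝ)

/-- The gradient of a function. -/
def grad (f : S → ℝ) : VField (𝓡 d) S := fun x ↦
  ((metricForm γ x).toDual (metricForm_nondegenerate γ x)).symm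
    (diff (d := d) f x : TangentSpace (𝓡 d) x →ₗ[ℝ] ℝ)

theorem inner_grad (f : S → ℝ) (x : S) : γ.inner x (grad γ f x) = diff f x := by
  ext w
  exact LinearMap.BilinForm.apply_toDual_symm_apply (B := metricForm γ x)
    (hB := metricForm_nondegenerate γ x) (diff (d := d) f x : TangentSpace (𝓡 d) x →ₗ[ℝ] ℝ) w

theorem inner_injective (x : S) {w w' : TangentSpace (𝓡 d) x}
    (hw : γ.inner x w = γ.inner x w') : w = w' := by
  by_contra hne
  have := γ.pos x (w - w') (sub_ne_zero.2 hne)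
  have h0 : γ.inner x (w - w') = 0 := by rw [map_sub, hw, sub_self]
  rw [h0] at this
  simp at this

theorem normSqDiff_eq (f : S → ℝ) (x : S) :
    normSqDiff γ f x = diff (d := d) f x (grad γ f x) := rfl

theorem isGradient_coord {f : S → ℝ} (hf : ContMDiff (𝓡 d) 𝓘(ℝ, ℝ) ∞ f) (x : S)
    {y : EuclideanSpace ℝ (Fin d)} (hy : y ∈ (extChartAt (𝓡 d) x).target) :
    IsGradient (coordForm (fun x ↦ γ.inner x) x) (f ∘ (extChartAt (𝓡 d) x).symm)
      (coordField (grad γ f) x) y := by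
  have hG : ∀ y ∈ (extChartAt (𝓡 d) x).target,
      ContDiffAt ℝ ∞ (coordForm (fun x ↦ γ.inner x) x) y :=
    fun y hy ↦ contDiffAt_coordForm γ.contMDiff hy
  have hpos : ∀ y ∈ (extChartAt (𝓡 d) x).target, ∀ a, a ≠ 0 →
      0 < coordForm (fun x ↦ γ.inner x) x y a a := by
    intro y hy a ha
    refine γ.pos _ _ fun h0 ↦ ha ?_
    exact (mfderiv_chart_symm_apply hy a).symm.trans
      ((congrArg (mfderiv (𝓡 d) 𝓘(ℝ, EuclideanSpace ℝ (Fin d)) (extChartAt (𝓡 d) x)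
        ((extChartAt (𝓡 d) x).symm y)) h0).trans (map_zero _))
  have hff := contMDiff_iff_chart.1 hf x
  have hgr : ∀ y ∈ (extChartAt (𝓡 d) x).target,
      coordForm (fun x ↦ γ.inner x) x y (coordField (grad γ f) x y)
        = fderiv ℝ (f ∘ (extChartAt (𝓡 d) x).symm) y := by
    intro y hy
    rw [fderiv_comp_symm (hf.mdifferentiableAt (by simp)) hy]
    ext b
    rw [coordForm_coordField _ _ _ hy]
    simp only [inner_grad]
    rfl
  have hev := (isOpen_extChartAt_target (I := 𝓡 d) x).mem_nhds hy
  refine ⟨hG y hy, ?_, ?_, hff y hy, ?_, ?_⟩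
  · filter_upwards [hev] with z hz a b using γ.symm _ _ _
  · filter_upwards [hev] with z hz using hpos z hz
  -- The gradient is `G⁻¹ df`, and inversion is smooth at invertible operators.
  · have hinv := ContinuousLinearMap.isInvertible_of_posDef (hpos y hy)
    have h1 : ContDiffAt ℝ ∞ (fun z ↦ (coordForm (fun x ↦ γ.inner x) x z).inverse
        (fderiv ℝ (f ∘ (extChartAt (𝓡 d) x).symm) z)) y :=
      ((hinv.contDiffAt_map_inverse).comp y (hG y hy)).clm_apply
        (ContDiffAt.fderiv_top (hff y hy))
    refine h1.congr_of_eventuallyEq ?_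
    filter_upwards [hev] with z hz
    have hinv := ContinuousLinearMap.isInvertible_of_posDef (hpos z hz)
    rw [← hgr z hz, hinv.inverse_apply_self]
  · filter_upwards [hev] with z hz b
    rw [hgr z hz]

theorem eventually_isGradient {f : S → ℝ} (hf : ContMDiff (𝓡 d) 𝓘(ℝ, ℝ) ∞ f) (x : S)
    {y : EuclideanSpace ℝ (Fin d)} (hy : y ∈ (extChartAt (𝓡 d) x).target) :
    ∀ᶠ z in 𝓝 y, IsGradient (coordForm (fun x ↦ γ.inner x) x) (f ∘ (extChartAt (𝓡 d) x).symm)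
      (coordField (grad γ f) x) z := by
  filter_upwards [(isOpen_extChartAt_target (I := 𝓡 d) x).mem_nhds hy] with z hz
    using isGradient_coord γ hf x hz

theorem contDiffAt_s (x : S) {y : EuclideanSpace ℝ (Fin d)}
    (hy : y ∈ (extChartAt (𝓡 d) x).target) : ContDiffAt ℝ ∞ (coordCovec s.toFun x) y :=
  contDiffAt_coordCovec s.smooth hy

/-- The functions `f` for which `f ∂_v - (u ∇f)` extends to a Killing vector of the near horizon
geometry. -/
structure IsPotential (f : S → ℝ) : Prop where
  smooth : ContMDiff (𝓡 d) 𝓘(ℝ, ℝ) ∞ f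
  hessian : ∀ x : S, ∀ y ∈ (extChartAt (𝓡 d) x).target,
    HessianEq (coordForm (fun x ↦ γ.inner x) x) (coordCovec s.toFun x)
      (f ∘ (extChartAt (𝓡 d) x).symm) (coordField (grad γ f) x) y
  torsion : ∀ x : S, ∀ y ∈ (extChartAt (𝓡 d) x).target,
    TorsionEq (coordCovec s.toFun x) (h ∘ (extChartAt (𝓡 d) x).symm)
      (f ∘ (extChartAt (𝓡 d) x).symm) (coordField (grad γ f) x) y
  scalar : ∀ x : S, ∀ y ∈ (extChartAt (𝓡 d) x).target,
    ScalarEq (coordCovec s.toFun x) (h ∘ (extChartAt (𝓡 d) x).symm) (coordField (grad γ f) x) y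

theorem diff_comb {f g : S → ℝ} (hf : ContMDiff (𝓡 d) 𝓘(ℝ, ℝ) ∞ f)
    (hg : ContMDiff (𝓡 d) 𝓘(ℝ, ℝ) ∞ g) (c : ℝ) (x : S) :
    diff (d := d) (c • f + g) x = c • diff f x + diff g x := by
  have hf' := hf.mdifferentiableAt (x := x) (by simp)
  have hg' := hg.mdifferentiableAt (x := x) (by simp)
  unfold diff
  rw [mfderiv_add (hf'.const_smul c) hg', const_smul_mfderiv hf']
  rfl

theorem grad_comb {f g : S → ℝ} (hf : ContMDiff (𝓡 d) 𝓘(ℝ, ℝ) ∞ f)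
    (hg : ContMDiff (𝓡 d) 𝓘(ℝ, ℝ) ∞ g) (c : ℝ) :
    grad γ (c • f + g) = c • grad γ f + grad γ g := by
  funext x
  refine inner_injective γ x ?_
  rw [inner_grad, diff_comb hf hg]
  simp [inner_grad]

theorem coordField_comb (X Y : VField (𝓡 d) S) (c : ℝ) (x : S) :
    coordField (c • X + Y) x = c • coordField X x + coordField Y x := by
  funext y
  set L := mfderiv (𝓡 d) 𝓘(ℝ, EuclideanSpace ℝ (Fin d)) (extChartAt (𝓡 d) x)
    ((extChartAt (𝓡 d) x).symm y)
  exact (L.map_add (c • X _) (Y _)).trans (congrArg (· + L (Y _)) (L.map_smul c (X _)))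

theorem grad_const (c : ℝ) : grad γ (fun _ : S ↦ c) = 0 := by
  funext x
  refine inner_injective γ x ?_
  rw [inner_grad]
  simp [diff, mfderiv_const]
  rfl

theorem coordField_zero (x : S) : coordField (0 : VField (𝓡 d) S) x = 0 := by
  funext y
  exact map_zero (mfderiv (𝓡 d) 𝓘(ℝ, EuclideanSpace ℝ (Fin d)) (extChartAt (𝓡 d) x)
    ((extChartAt (𝓡 d) x).symm y))

theorem isPotential_const (c : ℝ) : IsPotential γ s h (fun _ ↦ c) := by
  have hc (x : S) : (fun _ : S ↦ c) ∘ (extChartAt (𝓡 d) x).symm = fun _ ↦ c := rfl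
  refine ⟨contMDiff_const, fun x y hy ↦ ?_, fun x y hy ↦ ?_, fun x y hy ↦ ?_⟩
  · rw [grad_const, coordField_zero, hc]
    intro a b
    rw [lieForm_zero]
    simp
  · rw [grad_const, coordField_zero, hc]
    intro b
    simp
  · rw [grad_const, coordField_zero]
    simp [ScalarEq]

theorem IsPotential.comb {f g : S → ℝ} (hf : IsPotential γ s h f) (hg : IsPotential γ s h g)
    (c : ℝ) : IsPotential γ s h (c • f + g) := by
  have hc (x : S) : (c • f + g) ∘ (extChartAt (𝓡 d) x).symm
    = c • (f ∘ (extChartAt (𝓡 d) x).symm) + g ∘ (extChartAt (𝓡 d) x).symm := rfl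
  have hsm : ContMDiff (𝓡 d) 𝓘(ℝ, ℝ) ∞ (fun x ↦ c * f x + g x) :=
    ((contMDiff_const (c := c)).mul hf.smooth).add hg.smooth
  refine ⟨hsm, fun x y hy ↦ ?_, fun x y hy ↦ ?_,
    fun x y hy ↦ ?_⟩
  all_goals
    have h1 := isGradient_coord γ hf.smooth x hy
    have h2 := isGradient_coord γ hg.smooth x hy
    rw [grad_comb γ hf.smooth hg.smooth, coordField_comb]
  · exact HessianEq.comb (h1.smooth_f.differentiableAt (by simp))
      (h2.smooth_f.differentiableAt (by simp)) (h1.smooth_Z.differentiableAt (by simp))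
      (h2.smooth_Z.differentiableAt (by simp)) c (hf.hessian x y hy) (hg.hessian x y hy)
  · exact TorsionEq.comb ((contDiffAt_s s x hy).differentiableAt (by simp))
      (h1.smooth_f.differentiableAt (by simp))
      (h2.smooth_f.differentiableAt (by simp)) (h1.smooth_Z.differentiableAt (by simp))
      (h2.smooth_Z.differentiableAt (by simp)) c (hf.torsion x y hy) (hg.torsion x y hy)
  · exact ScalarEq.comb c (hf.scalar x y hy) (hg.scalar x y hy)

/-- The vector space of potentials. -/
def potentials : Submodule ℝ (S → ℝ) where
  carrier := {f | IsPotential γ s h f}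
  zero_mem' := isPotential_const γ s h 0
  add_mem' {f g} hf hg := by simpa using IsPotential.comb γ s h hf hg 1
  smul_mem' c f hf := by
    have := IsPotential.comb γ s h hf (isPotential_const γ s h 0) c
    rwa [show (c • f + fun _ ↦ (0 : ℝ)) = c • f by ext; simp] at this

end Potential

/-- Since `Z = G⁻¹ df` with `G⁻¹` continuous, this bound closes the Hessian equation into a linear
equation for `df` alone. -/
theorem IsGradient.exists_norm_le {E : Type*} [NormedAddCommGroup E] [NormedSpace ℝ E]
    [FiniteDimensional ℝ E] {G : E → E →L[ℝ] E →L[ℝ] ℝ} {f : E → ℝ} {Z : E → E} {y : E}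
    (h : IsGradient G f Z y) : ∃ K, ∀ᶠ z in 𝓝 y, ‖Z z‖ ≤ K * ‖fderiv ℝ f z‖ := by
  have hinv := ContinuousLinearMap.isInvertible_of_posDef h.pos.self_of_nhds
  have hc : ContinuousAt (fun z ↦ ‖(G z).inverse‖) y :=
    (((hinv.contDiffAt_map_inverse (n := ∞)).comp y h.smooth_G).continuousAt).norm
  refine ⟨‖(G y).inverse‖ + 1, ?_⟩
  filter_upwards [hc.eventually (gt_mem_nhds (lt_add_one _)), h.pos, h.grad] with z hz hp hg
  have hinv := ContinuousLinearMap.isInvertible_of_posDef hp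
  have e : G z (Z z) = fderiv ℝ f z := by ext b; exact hg b
  rw [← hinv.inverse_apply_self (Z z), e]
  refine ((G z).inverse.le_opNorm _).trans ?_
  gcongr

/-! ### Rigidity of potentials and scale factors on a connected cut -/

section Potential

variable {d : ℕ} {S : Type*} [TopologicalSpace S] [ChartedSpace (EuclideanSpace ℝ (Fin d)) S]
  [IsManifold (𝓡 d) ∞ S] (γ : RMetric d S) (s : OneForm d S) (h : S → ℝ)

local notation "Ed" => EuclideanSpace ℝ (Fin d)

theorem coordCovec_eq_zero_iff (α : ∀ x : S, TangentSpace (𝓡 d) x →L[ℝ] ℝ) (x : S) {y : Ed}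
    (hy : y ∈ (extChartAt (𝓡 d) x).target) :
    coordCovec α x y = 0 ↔ α ((extChartAt (𝓡 d) x).symm y) = 0 := by
  constructor
  · intro h0
    ext w
    have := congrArg (fun L ↦ L (mfderiv (𝓡 d) 𝓘(ℝ, Ed) (extChartAt (𝓡 d) x)
      ((extChartAt (𝓡 d) x).symm y) w)) h0
    exact (congrArg (α _) (mfderiv_symm_chart_apply hy w)).symm.trans this
  · intro h0
    ext a
    exact congrArg (fun L ↦ L (mfderiv 𝓘(ℝ, Ed) (𝓡 d) (extChartAt (𝓡 d) x).symm y a)) h0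

theorem fderiv_coord {f : S → ℝ} (hf : ContMDiff (𝓡 d) 𝓘(ℝ, ℝ) ∞ f) (x : S) {y : Ed}
    (hy : y ∈ (extChartAt (𝓡 d) x).target) :
    fderiv ℝ (f ∘ (extChartAt (𝓡 d) x).symm) y = coordCovec (fun p ↦ diff (d := d) f p) x y :=
  fderiv_comp_symm (hf.mdifferentiableAt (by simp)) hy

theorem eventually_mem_target (x : S) {y : Ed} (hy : y ∈ (extChartAt (𝓡 d) x).target) :
    ∀ᶠ z in 𝓝 y, z ∈ (extChartAt (𝓡 d) x).target :=
  (isOpen_extChartAt_target (I := 𝓡 d) x).mem_nhds hy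

/-- A smooth solution of a linear homogeneous total differential equation on a connected manifold
vanishes as soon as it vanishes at a point. -/
theorem eq_zero_of_norm_fderiv_le [PreconnectedSpace S] {V : Type*} [NormedAddCommGroup V]
    [NormedSpace ℝ V] {z : S → V}
    (hz : ∀ x : S, ∀ y ∈ (extChartAt (𝓡 d) x).target,
      DifferentiableAt ℝ (z ∘ (extChartAt (𝓡 d) x).symm) y)
    (c : S → Ed → ℝ) (hc : ∀ x : S, ∀ y ∈ (extChartAt (𝓡 d) x).target, ContinuousAt (c x) y)
    (h : ∀ x : S, ∀ y ∈ (extChartAt (𝓡 d) x).target,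
      ‖fderiv ℝ (z ∘ (extChartAt (𝓡 d) x).symm) y‖
        ≤ c x y * ‖(z ∘ (extChartAt (𝓡 d) x).symm) y‖)
    {x₁ : S} (h1 : z x₁ = 0) (x : S) : z x = 0 := by
  refine eq_zero_of_chart_norm_le (I := 𝓡 d) (fun x ↦ ?_) h1 x
  have hx := mem_extChartAt_target (I := 𝓡 d) x
  refine norm_fderiv_le_of_continuousAt (hc x _ hx) ?_
  filter_upwards [eventually_mem_target x hx] with y hy using ⟨hz x y hy, h x y hy⟩

theorem contDiffAt_coord {f : S → ℝ} (hf : ContMDiff (𝓡 d) 𝓘(ℝ, ℝ) ∞ f) (x : S) {y : Ed}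
    (hy : y ∈ (extChartAt (𝓡 d) x).target) :
    ContDiffAt ℝ ∞ (f ∘ (extChartAt (𝓡 d) x).symm) y :=
  contMDiff_iff_chart.1 hf x y hy

theorem eq_of_diff_eq_zero [PreconnectedSpace S] {f : S → ℝ}
    (hf : ContMDiff (𝓡 d) 𝓘(ℝ, ℝ) ∞ f) (h0 : ∀ x, diff (d := d) f x = 0) (x x₁ : S) :
    f x = f x₁ := by
  have := eq_zero_of_norm_fderiv_le (d := d) (z := fun x ↦ f x - f x₁)
    (fun x y hy ↦ ((contDiffAt_coord hf x hy).differentiableAt (by simp)).sub_const _)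
    (fun _ _ ↦ 0) (fun _ _ _ ↦ continuousAt_const)
    (fun x y hy ↦ by
      have e : (fun x ↦ f x - f x₁) ∘ (extChartAt (𝓡 d) x).symm
        = fun z ↦ (f ∘ (extChartAt (𝓡 d) x).symm) z - f x₁ := rfl
      rw [e, fderiv_sub_const, fderiv_coord hf x hy, (coordCovec_eq_zero_iff _ x hy).2 (h0 _)]
      simp)
    (x₁ := x₁) (by simp) x
  linarith

variable {γ s h}

/-- The differential of a potential which vanishes at a point vanishes identically. -/
theorem IsPotential.diff_eq_zero [PreconnectedSpace S] {f : S → ℝ} (hf : IsPotential γ s h f)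
    {x₁ : S} (h1 : diff (d := d) f x₁ = 0) (x : S) : diff (d := d) f x = 0 := by
  have hiff (x : S) : ∀ᶠ y in 𝓝 (extChartAt (𝓡 d) x x),
      (fderiv ℝ (f ∘ (extChartAt (𝓡 d) x).symm) y = 0
        ↔ diff (d := d) f ((extChartAt (𝓡 d) x).symm y) = 0) := by
    filter_upwards [eventually_mem_target x (mem_extChartAt_target (I := 𝓡 d) x)] with y hy
    rw [fderiv_coord hf.smooth x hy, coordCovec_eq_zero_iff _ x hy]
  -- The differential is a section of the cotangent bundle, not a map to a fixed normed space, so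
  -- propagation is argued chart by chart: its zero set is closed by continuity and open by
  -- uniqueness for the linear equation.
  have hclopen : IsClopen {x | diff (d := d) f x = 0} := by
    constructor
    · refine ⟨isOpen_iff_mem_nhds.2 fun x hx ↦ ?_⟩
      have hx' := mem_extChartAt_target (I := 𝓡 d) x
      have hne : fderiv ℝ (f ∘ (extChartAt (𝓡 d) x).symm) (extChartAt (𝓡 d) x x) ≠ 0 := by
        rw [Ne, (hiff x).self_of_nhds, extChartAt_to_inv]
        exact hx
      have hev := (ContDiffAt.fderiv_top
        (contDiffAt_coord hf.smooth x hx')).continuousAt.eventually_ne hne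
      refine eventually_of_chart (I := 𝓡 d) (P := fun p ↦ p ∈ {x | diff (d := d) f x = 0}ᶜ) ?_
      filter_upwards [hev, hiff x] with y h1 h2 h3
      exact h1 (h2.2 h3)
    · refine isOpen_iff_mem_nhds.2 fun x hx ↦ ?_
      have hx' := mem_extChartAt_target (I := 𝓡 d) x
      have h0 : fderiv ℝ (f ∘ (extChartAt (𝓡 d) x).symm) (extChartAt (𝓡 d) x x) = 0 := by
        rw [(hiff x).self_of_nhds, extChartAt_to_inv]
        exact hx
      have hg := isGradient_coord γ hf.smooth x hx'
      obtain ⟨K, hK⟩ := hg.exists_norm_le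
      obtain ⟨C, hC⟩ := HessianEq.exists_norm_le (contDiffAt_s s x hx').continuousAt hg
        (by filter_upwards [eventually_mem_target x hx'] with z hz using hf.hessian x z hz)
        (eventually_isGradient γ hf.smooth x hx') hK
      have hev := eventually_eq_zero_of_norm_fderiv_le hC h0
      refine eventually_of_chart (I := 𝓡 d) (P := fun p ↦ p ∈ {x | diff (d := d) f x = 0}) ?_
      filter_upwards [hev, hiff x] with y h1 h2
      exact h2.1 h1
  have : x ∈ {x | diff (d := d) f x = 0} := hclopen.eq_univ ⟨x₁, h1⟩ ▸ mem_univ x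
  exact this

/-- Injectivity of the 1-jet at a point. It gives the dimension bound, and it shows that a potential
vanishing on an open set is zero. -/
theorem IsPotential.eq_zero [PreconnectedSpace S] {f : S → ℝ} (hf : IsPotential γ s h f)
    {x₁ : S} (h0 : f x₁ = 0) (h1 : diff (d := d) f x₁ = 0) : f = 0 := by
  funext x
  rw [eq_of_diff_eq_zero hf.smooth (hf.diff_eq_zero h1) x x₁, h0]
  rfl

/-! ### The squared norm of the differential -/

theorem normSqDiff_coord {f : S → ℝ} (hf : ContMDiff (𝓡 d) 𝓘(ℝ, ℝ) ∞ f) (x : S) {y : Ed}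
    (hy : y ∈ (extChartAt (𝓡 d) x).target) :
    normSqDiff γ f ((extChartAt (𝓡 d) x).symm y)
      = fderiv ℝ (f ∘ (extChartAt (𝓡 d) x).symm) y (coordField (grad γ f) x y) := by
  rw [fderiv_coord hf x hy, coordCovec_coordField _ _ _ hy, normSqDiff_eq]

theorem normSqDiff_coord_eventuallyEq {f : S → ℝ} (hf : ContMDiff (𝓡 d) 𝓘(ℝ, ℝ) ∞ f) (x : S)
    {y : Ed} (hy : y ∈ (extChartAt (𝓡 d) x).target) :
    normSqDiff γ f ∘ (extChartAt (𝓡 d) x).symm =ᶠ[𝓝 y] fun z ↦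
      fderiv ℝ (f ∘ (extChartAt (𝓡 d) x).symm) z (coordField (grad γ f) x z) := by
  filter_upwards [eventually_mem_target x hy] with z hz using normSqDiff_coord hf x hz

theorem contMDiff_normSqDiff {f : S → ℝ} (hf : ContMDiff (𝓡 d) 𝓘(ℝ, ℝ) ∞ f) :
    ContMDiff (𝓡 d) 𝓘(ℝ, ℝ) ∞ (normSqDiff γ f) :=
  contMDiff_iff_chart.2 fun x _ hy ↦
    (isGradient_coord γ hf x hy).contDiffAt_normSq.congr_of_eventuallyEq
      (normSqDiff_coord_eventuallyEq hf x hy)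

theorem normSqDiff_pos {f : S → ℝ} {x : S} (h0 : diff (d := d) f x ≠ 0) :
    0 < normSqDiff γ f x := by
  rw [normSqDiff_eq, ← inner_grad γ]
  refine γ.pos x _ fun hg ↦ h0 ?_
  rw [← inner_grad γ, hg, map_zero]

theorem fderiv_coord_ne_zero {f : S → ℝ} (hf : ContMDiff (𝓡 d) 𝓘(ℝ, ℝ) ∞ f)
    (h0 : ∀ x, diff (d := d) f x ≠ 0) (x : S) {y : Ed}
    (hy : y ∈ (extChartAt (𝓡 d) x).target) :
    fderiv ℝ (f ∘ (extChartAt (𝓡 d) x).symm) y ≠ 0 := by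
  rw [fderiv_coord hf x hy, Ne, coordCovec_eq_zero_iff _ x hy]
  exact h0 _

/-! ### Scale factors -/

variable (s) in
/-- The solutions of `dq = -2 q s`. -/
structure IsScale (q : S → ℝ) : Prop where
  smooth : ContMDiff (𝓡 d) 𝓘(ℝ, ℝ) ∞ q
  fderiv_eq : ∀ x : S, ∀ y ∈ (extChartAt (𝓡 d) x).target, ∀ b,
    fderiv ℝ (q ∘ (extChartAt (𝓡 d) x).symm) y b
      = -2 * q ((extChartAt (𝓡 d) x).symm y) * coordCovec s.toFun x y b

/-- The difference `q - c μ` solves the same linear equation and vanishes at `x₁` for this `c`. This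
proportionality lets Killing vectors with different representing functions be added. -/
theorem IsScale.eq_mul [PreconnectedSpace S] {q μ : S → ℝ} (hq : IsScale s q) (hμ : IsScale s μ)
    {x₁ : S} (h1 : μ x₁ ≠ 0) : ∃ c : ℝ, ∀ x, q x = c * μ x := by
  refine ⟨q x₁ / μ x₁, fun x ↦ ?_⟩
  have hd (x : S) (y : Ed) (hy : y ∈ (extChartAt (𝓡 d) x).target) :=
    ((contDiffAt_coord hq.smooth x hy).differentiableAt (by simp)).hasFDerivAt.sub
      (((contDiffAt_coord hμ.smooth x hy).differentiableAt (by simp)).hasFDerivAt.const_mul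
        (q x₁ / μ x₁))
  have := eq_zero_of_norm_fderiv_le (d := d) (z := fun x ↦ q x - q x₁ / μ x₁ * μ x)
    (fun x y hy ↦ (hd x y hy).differentiableAt)
    (fun x y ↦ 2 * ‖coordCovec s.toFun x y‖)
    (fun x y hy ↦ continuousAt_const.mul (contDiffAt_s s x hy).continuousAt.norm)
    (fun x y hy ↦ by
      refine ContinuousLinearMap.opNorm_le_bound _ (by positivity) fun b ↦ ?_
      have e : HasFDerivAt ((fun x ↦ q x - q x₁ / μ x₁ * μ x) ∘ (extChartAt (𝓡 d) x).symm) _ y :=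
        hd x y hy
      rw [e.fderiv]
      simp only [sub_apply, smul_apply, smul_eq_mul,
        hq.fderiv_eq x y hy, hμ.fderiv_eq x y hy, Function.comp]
      set p := (extChartAt (𝓡 d) x).symm y
      have e2 : -2 * q p * coordCovec s.toFun x y b
          - q x₁ / μ x₁ * (-2 * μ p * coordCovec s.toFun x y b)
          = (-2 * coordCovec s.toFun x y b) * (q p - q x₁ / μ x₁ * μ p) := by ring
      rw [e2, norm_mul, norm_mul]
      have := (coordCovec s.toFun x y).le_opNorm b
      have h3 := mul_le_mul_of_nonneg_right this (norm_nonneg (q p - q x₁ / μ x₁ * μ p))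
      simp only [Real.norm_eq_abs] at h3 ⊢
      norm_num
      linarith)
    (x₁ := x₁) (by field_simp; simp) x
  linarith

theorem coordField_smul (q : S → ℝ) (X : VField (𝓡 d) S) (x : S) :
    coordField (fun p ↦ q p • X p) x
      = fun y ↦ (q ∘ (extChartAt (𝓡 d) x).symm) y • coordField X x y := by
  funext y
  exact (mfderiv (𝓡 d) 𝓘(ℝ, Ed) (extChartAt (𝓡 d) x) ((extChartAt (𝓡 d) x).symm y)).map_smul _ _

/-- The terms `dq ⊗ df + df ⊗ dq` become `-2 q (s ⊗ df + df ⊗ s)`: for a scale factor without zeros,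
`q ∇f` satisfies the Killing equation exactly when `f` satisfies the Hessian equation. -/
theorem IsScale.coordLieDeriv_smul_grad {q : S → ℝ} (hq : IsScale s q) {f : S → ℝ}
    (hf : ContMDiff (𝓡 d) 𝓘(ℝ, ℝ) ∞ f) (x : S) {y : Ed}
    (hy : y ∈ (extChartAt (𝓡 d) x).target) (a b : Ed) :
    coordLieDeriv (fun x ↦ γ.inner x) (fun p ↦ q p • grad γ f p) x y a b
      = q ((extChartAt (𝓡 d) x).symm y) *
        (lieForm (fun z a b ↦ coordForm (fun x ↦ γ.inner x) x z a b)
            (coordField (grad γ f) x) y a b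
          - 2 * (coordCovec s.toFun x y a * fderiv ℝ (f ∘ (extChartAt (𝓡 d) x).symm) y b
          + coordCovec s.toFun x y b * fderiv ℝ (f ∘ (extChartAt (𝓡 d) x).symm) y a)) := by
  rw [coordLieDeriv_eq, coordField_smul, (isGradient_coord γ hf x hy).lieForm_smul
    ((contDiffAt_coord hq.smooth x hy).differentiableAt (by simp)), hq.fderiv_eq x y hy,
    hq.fderiv_eq x y hy]
  simp only [Function.comp]
  ring

theorem IsPotential.isKilling_smul_grad {f q : S → ℝ} (hf : IsPotential γ s h f)
    (hq : IsScale s q) :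
    IsKilling (I := 𝓡 d) (fun x ↦ γ.inner x) (fun p ↦ q p • grad γ f p) := by
  refine ⟨smoothField_iff_chart.2 fun x y hy ↦ ?_, fun x y hy a b ↦ ?_⟩
  · rw [coordField_smul]
    exact (contDiffAt_coord hq.smooth x hy).smul (isGradient_coord γ hf.smooth x hy).smooth_Z
  · rw [hq.coordLieDeriv_smul_grad hf.smooth x hy, hf.hessian x y hy]
    ring

end Potential

section CutKilling

variable {d : ℕ} {S : Type*} [TopologicalSpace S] [ChartedSpace (EuclideanSpace ℝ (Fin d)) S]
  [IsManifold (𝓡 d) ∞ S] {γ : RMetric d S} {s : OneForm d S} {h : S → ℝ}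

local notation "Ed" => EuclideanSpace ℝ (Fin d)

/-! ### From a representation to a potential -/

namespace IsRepresentedBy

variable {ς : VField (𝓡 d) S} {f : S → ℝ} {Q P : ℝ → ℝ}

theorem field_eq_smul (hr : IsRepresentedBy γ s h ς f Q P) :
    ς = fun x ↦ (Q (f x) / normSqDiff γ f x) • grad γ f x := by
  funext x
  refine inner_injective γ x ?_
  rw [hr.field_eq, map_smul, inner_grad]

theorem hasFDerivAt_comp (hr : IsRepresentedBy γ s h ς f Q P) {R : ℝ → ℝ}
    (hR : ∀ t ∈ range f, DifferentiableAt ℝ R t) (x : S) {y : Ed}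
    (hy : y ∈ (extChartAt (𝓡 d) x).target) :
    HasFDerivAt ((fun x ↦ R (f x)) ∘ (extChartAt (𝓡 d) x).symm)
      (deriv R (f ((extChartAt (𝓡 d) x).symm y)) •
        fderiv ℝ (f ∘ (extChartAt (𝓡 d) x).symm) y) y :=
  HasDerivAt.comp_hasFDerivAt (h₂ := R) y (hR _ (mem_range_self _)).hasDerivAt
    ((contDiffAt_coord hr.smooth_f x hy).differentiableAt (by simp)).hasFDerivAt

theorem contMDiff_comp (hr : IsRepresentedBy γ s h ς f Q P) {R : ℝ → ℝ}
    (hR : ∀ t ∈ range f, ContDiffAt ℝ ∞ R t) :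
    ContMDiff (𝓡 d) 𝓘(ℝ, ℝ) ∞ (fun x ↦ R (f x)) :=
  contMDiff_iff_chart.2 fun x y hy ↦
    ContDiffAt.comp (g := R) y (hR _ (mem_range_self _)) (contDiffAt_coord hr.smooth_f x hy)

/-- On connected `S` the function `Q ∘ f` solves the linear equation `d(Q ∘ f) = (P ∘ f) (Q ∘ f)
df`, so one zero would force it to vanish identically. -/
theorem Q_ne_zero [PreconnectedSpace S] (hr : IsRepresentedBy γ s h ς f Q P) (x : S) :
    Q (f x) ≠ 0 := by
  intro h0
  obtain ⟨_, ⟨x₂, rfl⟩, h2⟩ := hr.ode.nontrivial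
  refine h2 ?_
  have hQd := fun t ht ↦ (hr.ode.smooth_Q t ht).differentiableAt (by simp)
  refine eq_zero_of_norm_fderiv_le (d := d) (z := fun x ↦ Q (f x))
    (fun x y hy ↦ (hr.hasFDerivAt_comp hQd x hy).differentiableAt)
    (fun x y ↦ ‖P (f ((extChartAt (𝓡 d) x).symm y))‖
      * ‖fderiv ℝ (f ∘ (extChartAt (𝓡 d) x).symm) y‖)
    (fun x y hy ↦ ?_) (fun x y hy ↦ ?_) h0 x₂
  · refine ContinuousAt.mul ?_
      (ContDiffAt.fderiv_top (contDiffAt_coord hr.smooth_f x hy)).continuousAt.norm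
    exact (contDiffAt_coord (hr.contMDiff_comp hr.ode.smooth_P) x hy).continuousAt.norm
  · rw [(hr.hasFDerivAt_comp hQd x hy).fderiv, norm_smul, hr.ode.ode_Q _ (mem_range_self _),
      norm_mul]
    simp only [Function.comp]
    exact le_of_eq (by ring)

theorem s_coord (hr : IsRepresentedBy γ s h ς f Q P) (x : S) {y : Ed}
    (hy : y ∈ (extChartAt (𝓡 d) x).target) (b : Ed) :
    coordCovec s.toFun x y b = 1 / 2 *
      ((normSqDiff γ f ((extChartAt (𝓡 d) x).symm y))⁻¹
        * fderiv ℝ (normSqDiff γ f ∘ (extChartAt (𝓡 d) x).symm) y b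
      - P (f ((extChartAt (𝓡 d) x).symm y)) * fderiv ℝ (f ∘ (extChartAt (𝓡 d) x).symm) y b) := by
  rw [fderiv_coord hr.smooth_f x hy, fderiv_coord (contMDiff_normSqDiff hr.smooth_f) x hy]
  exact congrArg (fun L ↦ L (mfderiv 𝓘(ℝ, Ed) (𝓡 d) (extChartAt (𝓡 d) x).symm y b))
    (hr.s_eq ((extChartAt (𝓡 d) x).symm y))

/-- Logarithmically, `dQ/Q - dN/N = P df - dN/N = -2 s`. -/
theorem isScale (hr : IsRepresentedBy γ s h ς f Q P) :
    IsScale s (fun x ↦ Q (f x) / normSqDiff γ f x) := by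
  have hQ := hr.contMDiff_comp hr.ode.smooth_Q
  have hN := contMDiff_normSqDiff (γ := γ) hr.smooth_f
  have hN0 (x : S) : normSqDiff γ f x ≠ 0 := (normSqDiff_pos (hr.diff_ne_zero x)).ne'
  refine ⟨contMDiff_iff_chart.2 fun x y hy ↦
    (contDiffAt_coord hQ x hy).div (contDiffAt_coord hN x hy) (hN0 _), fun x y hy b ↦ ?_⟩
  have hNd := ((contDiffAt_coord hN x hy).differentiableAt (by simp)).hasFDerivAt
  have hQd := hr.hasFDerivAt_comp
    (fun t ht ↦ (hr.ode.smooth_Q t ht).differentiableAt (by simp)) x hy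
  have hinv : HasFDerivAt (fun z ↦ ((normSqDiff γ f ∘ (extChartAt (𝓡 d) x).symm) z)⁻¹) _ y :=
    (hasDerivAt_inv (hN0 _)).comp_hasFDerivAt y hNd
  have hd : HasFDerivAt ((fun x ↦ Q (f x) / normSqDiff γ f x) ∘ (extChartAt (𝓡 d) x).symm) _ y :=
    hQd.mul hinv
  rw [hd.fderiv, hr.s_coord x hy, hr.ode.ode_Q _ (mem_range_self _)]
  simp only [add_apply, smul_apply, smul_eq_mul, Function.comp]
  have := hN0 ((extChartAt (𝓡 d) x).symm y)
  field_simp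
  ring

theorem isPotential [PreconnectedSpace S]
    (hr : IsRepresentedBy γ s h ς f Q P)
    (hk : IsKilling (I := 𝓡 d) (fun x ↦ γ.inner x) ς) : IsPotential γ s h f := by
  have hess : ∀ x : S, ∀ y ∈ (extChartAt (𝓡 d) x).target,
      HessianEq (coordForm (fun x ↦ γ.inner x) x) (coordCovec s.toFun x)
        (f ∘ (extChartAt (𝓡 d) x).symm) (coordField (grad γ f) x) y := by
    intro x y hy a b
    have e := hk.2 x y hy a b
    rw [hr.field_eq_smul, hr.isScale.coordLieDeriv_smul_grad hr.smooth_f x hy] at e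
    have hne : Q (f ((extChartAt (𝓡 d) x).symm y))
        / normSqDiff γ f ((extChartAt (𝓡 d) x).symm y) ≠ 0 :=
      div_ne_zero (hr.Q_ne_zero _) (normSqDiff_pos (hr.diff_ne_zero _)).ne'
    have := (mul_eq_zero.1 e).resolve_left hne
    linarith
  have hdP : ∀ t ∈ range f, ContDiffAt ℝ ∞ (deriv P) t := fun t ht ↦ by
    have := (ContDiffAt.fderiv_top (hr.ode.smooth_P t ht)).clm_apply
      (contDiffAt_const (c := (1 : ℝ)))
    exact this
  have hR : ∀ t ∈ range f, ContDiffAt ℝ ∞ (fun r ↦ deriv P r + P r ^ 2) t := fun t ht ↦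
    (hdP t ht).add ((hr.ode.smooth_P t ht).pow 2)
  -- The roles of `p` and `r` are played by `P ∘ f` and `(P' + P²) ∘ f`; the equations for `dp` and
  -- `dr` are the chain rule and the third-order equation for `P`.
  have key (x : S) (y : Ed) (hy : y ∈ (extChartAt (𝓡 d) x).target) :=
    potentialEq_of_fderiv (σ := coordCovec s.toFun x) (η := h ∘ (extChartAt (𝓡 d) x).symm)
      (p := (fun x ↦ P (f x)) ∘ (extChartAt (𝓡 d) x).symm)
      (r := (fun x ↦ deriv P (f x) + P (f x) ^ 2) ∘ (extChartAt (𝓡 d) x).symm)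
      (isGradient_coord γ hr.smooth_f x hy) (contDiffAt_s s x hy)
      (contDiffAt_coord (hr.contMDiff_comp hr.ode.smooth_P) x hy)
      (contDiffAt_coord (hr.contMDiff_comp hR) x hy)
      (by filter_upwards [eventually_mem_target x hy] with z hz using hess x z hz)
      (eventually_isGradient γ hr.smooth_f x hy)
      (by
        filter_upwards [eventually_mem_target x hy] with z hz
          using fderiv_coord_ne_zero hr.smooth_f hr.diff_ne_zero x hz)
      (by
        filter_upwards [eventually_mem_target x hy] with z hz b
        rw [hr.s_coord x hz, ← normSqDiff_coord hr.smooth_f x hz,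
          (normSqDiff_coord_eventuallyEq hr.smooth_f x hz).fderiv_eq]
        rfl)
      (by
        filter_upwards [eventually_mem_target x hy] with z hz
        rw [← normSqDiff_coord hr.smooth_f x hz]
        simp only [Function.comp]
        rw [hr.h_eq]
        ring)
      (fun b ↦ by
        rw [(hr.hasFDerivAt_comp
          (fun t ht ↦ (hr.ode.smooth_P t ht).differentiableAt (by simp)) x hy).fderiv]
        simp)
      (fun b ↦ by
        have e := hr.ode.ode_P _ (mem_range_self ((extChartAt (𝓡 d) x).symm y))
        rw [(hr.hasFDerivAt_comp (fun t ht ↦ (hR t ht).differentiableAt (by simp)) x hy).fderiv]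
        simp only [smul_apply, smul_eq_mul, Function.comp]
        rw [← eq_neg_iff_add_eq_zero] at e
        rw [e])
  exact ⟨hr.smooth_f, hess, fun x y hy ↦ (key x y hy).1, fun x y hy ↦ (key x y hy).2⟩

end IsRepresentedBy

/-! ### From a potential to a representation -/

variable (γ s h) in
/-- The function `2 s(∇f) / N`. -/
def torsionRatio (f : S → ℝ) (x : S) : ℝ :=
  2 * s.toFun x (grad γ f x) / normSqDiff γ f x

variable (γ h) in
/-- The function `2 h / N`. -/
def scalarRatio (f : S → ℝ) (x : S) : ℝ := 2 * h x / normSqDiff γ f x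

namespace IsPotential

variable {f : S → ℝ}

theorem torsionRatio_coord (hf : IsPotential γ s h f) (h0 : ∀ x, diff (d := d) f x ≠ 0)
    (x : S) {y : Ed} (hy : y ∈ (extChartAt (𝓡 d) x).target) :
    2 * coordCovec s.toFun x y (coordField (grad γ f) x y)
      = (torsionRatio γ s f ∘ (extChartAt (𝓡 d) x).symm) y
        * fderiv ℝ (f ∘ (extChartAt (𝓡 d) x).symm) y (coordField (grad γ f) x y) := by
  rw [← normSqDiff_coord hf.smooth x hy, coordCovec_coordField _ _ _ hy]
  have := (normSqDiff_pos (γ := γ) (h0 ((extChartAt (𝓡 d) x).symm y))).ne'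
  simp only [Function.comp, torsionRatio]
  field_simp

theorem scalarRatio_coord (hf : IsPotential γ s h f) (h0 : ∀ x, diff (d := d) f x ≠ 0)
    (x : S) {y : Ed} (hy : y ∈ (extChartAt (𝓡 d) x).target) :
    2 * (h ∘ (extChartAt (𝓡 d) x).symm) y
      = (scalarRatio γ h f ∘ (extChartAt (𝓡 d) x).symm) y
        * fderiv ℝ (f ∘ (extChartAt (𝓡 d) x).symm) y (coordField (grad γ f) x y) := by
  rw [← normSqDiff_coord hf.smooth x hy]
  have := (normSqDiff_pos (γ := γ) (h0 ((extChartAt (𝓡 d) x).symm y))).ne'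
  simp only [Function.comp, scalarRatio]
  field_simp

theorem contMDiff_torsionRatio (hf : IsPotential γ s h f) (h0 : ∀ x, diff (d := d) f x ≠ 0) :
    ContMDiff (𝓡 d) 𝓘(ℝ, ℝ) ∞ (torsionRatio γ s f) := by
  refine contMDiff_iff_chart.2 fun x y hy ↦ ?_
  have h1 := ((contDiffAt_const (c := (2 : ℝ))).mul ((contDiffAt_s s x hy).clm_apply
    (isGradient_coord γ hf.smooth x hy).smooth_Z)).div
    (contDiffAt_coord (contMDiff_normSqDiff (γ := γ) hf.smooth) x hy)
    (normSqDiff_pos (h0 _)).ne'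
  refine h1.congr_of_eventuallyEq ?_
  filter_upwards [eventually_mem_target x hy] with z hz
  exact (congrArg (fun t ↦ 2 * t / normSqDiff γ f ((extChartAt (𝓡 d) x).symm z))
    (coordCovec_coordField s.toFun (grad γ f) x hz)).symm

theorem contMDiff_scalarRatio (hh : ContMDiff (𝓡 d) 𝓘(ℝ, ℝ) ∞ h) (hf : IsPotential γ s h f)
    (h0 : ∀ x, diff (d := d) f x ≠ 0) :
    ContMDiff (𝓡 d) 𝓘(ℝ, ℝ) ∞ (scalarRatio γ h f) := by
  refine contMDiff_iff_chart.2 fun x y hy ↦ ?_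
  exact ((contDiffAt_const (c := (2 : ℝ))).mul (contDiffAt_coord hh x hy)).div
    (contDiffAt_coord (contMDiff_normSqDiff (γ := γ) hf.smooth) x hy)
    (normSqDiff_pos (h0 _)).ne'

theorem fderiv_torsionRatio (hf : IsPotential γ s h f)
    (h0 : ∀ x, diff (d := d) f x ≠ 0) (x : S) {y : Ed} (hy : y ∈ (extChartAt (𝓡 d) x).target)
    (b : Ed) :
    fderiv ℝ (torsionRatio γ s f ∘ (extChartAt (𝓡 d) x).symm) y b
      = ((scalarRatio γ h f ∘ (extChartAt (𝓡 d) x).symm) y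
        - (torsionRatio γ s f ∘ (extChartAt (𝓡 d) x).symm) y ^ 2)
        * fderiv ℝ (f ∘ (extChartAt (𝓡 d) x).symm) y b :=
  TorsionEq.fderiv_p (isGradient_coord γ hf.smooth x hy) (contDiffAt_s s x hy)
    (contDiffAt_coord (hf.contMDiff_torsionRatio h0) x hy)
    (by filter_upwards [eventually_mem_target x hy] with z hz using hf.hessian x z hz)
    (eventually_isGradient γ hf.smooth x hy) (hf.torsion x y hy)
    (by
      filter_upwards [eventually_mem_target x hy] with z hz
        using fderiv_coord_ne_zero hf.smooth h0 x hz)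
    (by
      filter_upwards [eventually_mem_target x hy] with z hz
        using hf.torsionRatio_coord h0 x hz)
    (hf.scalarRatio_coord h0 x hy) b

theorem fderiv_scalarRatio (hh : ContMDiff (𝓡 d) 𝓘(ℝ, ℝ) ∞ h) (hf : IsPotential γ s h f)
    (h0 : ∀ x, diff (d := d) f x ≠ 0) (x : S) {y : Ed} (hy : y ∈ (extChartAt (𝓡 d) x).target)
    (b : Ed) :
    fderiv ℝ (scalarRatio γ h f ∘ (extChartAt (𝓡 d) x).symm) y b
      = -((torsionRatio γ s f ∘ (extChartAt (𝓡 d) x).symm) y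
        * (scalarRatio γ h f ∘ (extChartAt (𝓡 d) x).symm) y)
        * fderiv ℝ (f ∘ (extChartAt (𝓡 d) x).symm) y b :=
  ScalarEq.fderiv_r (isGradient_coord γ hf.smooth x hy) (contDiffAt_coord hh x hy)
    (contDiffAt_coord (hf.contMDiff_torsionRatio h0) x hy)
    (contDiffAt_coord (hf.contMDiff_scalarRatio hh h0) x hy)
    (hf.hessian x y hy) (hf.scalar x y hy) (fderiv_coord_ne_zero hf.smooth h0 x hy)
    (hf.torsionRatio_coord h0 x hy)
    (by
      filter_upwards [eventually_mem_target x hy] with z hz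
        using hf.scalarRatio_coord h0 x hz)
    (by
      filter_upwards [eventually_mem_target x hy] with z hz
        using hf.fderiv_torsionRatio h0 x hz) b

/-- The quadratic function `w` with `w(t₀) = 1`, `w'(t₀) = p₀`, `w'' = r₀`. -/
def _root_.NHG.quad (t₀ p₀ r₀ t : ℝ) : ℝ := 1 + p₀ * (t - t₀) + r₀ / 2 * (t - t₀) ^ 2

theorem _root_.NHG.hasDerivAt_quad (t₀ p₀ r₀ t : ℝ) :
    HasDerivAt (quad t₀ p₀ r₀) (p₀ + r₀ * (t - t₀)) t := by
  have h1 : HasDerivAt (fun t : ℝ ↦ t - t₀) 1 t := (hasDerivAt_id t).sub_const t₀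
  have h2 := ((h1.const_mul p₀).const_add 1).add ((h1.pow 2).const_mul (r₀ / 2))
  have h3 : HasDerivAt (quad t₀ p₀ r₀) _ t := h2
  convert h3 using 1
  simp
  ring

/-- The system `dp = (r - p²) df`, `dr = -p r df` is linearized by `p = w'/w`, `r = w''/w` with
`w''' = 0`. The polynomial `w` is fixed by initial data at `x₁`, and the identities then propagate
over `S` itself. Working on `S` avoids having to show beforehand that `p` and `r` are functions of
`f`, whose level sets may be disconnected. -/
theorem ratio_eq_quad [PreconnectedSpace S] (hh : ContMDiff (𝓡 d) 𝓘(ℝ, ℝ) ∞ h)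
    (hf : IsPotential γ s h f) (h0 : ∀ x, diff (d := d) f x ≠ 0) (x₁ : S) :
    ∃ t₀ p₀ r₀ : ℝ, ∀ x, quad t₀ p₀ r₀ (f x) ≠ 0 ∧
      torsionRatio γ s f x * quad t₀ p₀ r₀ (f x) = p₀ + r₀ * (f x - t₀) ∧
      scalarRatio γ h f x * quad t₀ p₀ r₀ (f x) = r₀ := by
  set p := torsionRatio γ s f with hp
  set r := scalarRatio γ h f with hr
  set w := quad (f x₁) (p x₁) (r x₁) with hw
  set w' : ℝ → ℝ := fun t ↦ p x₁ + r x₁ * (t - f x₁) with hw'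
  have hps := hf.contMDiff_torsionRatio h0
  have hrs := hf.contMDiff_scalarRatio hh h0
  -- With `A = p w - w'` and `B = r w - r(x₁)`, the system gives `dA = (B - p A) df` and `dB = -r A
  -- df`, linear and homogeneous, with zero data at `x₁`.
  have hAB : ∀ x, (p x * w (f x) - w' (f x), r x * w (f x) - r x₁) = (0 : ℝ × ℝ) := by
    have hd (x : S) (y : Ed) (hy : y ∈ (extChartAt (𝓡 d) x).target) :
        HasFDerivAt ((fun x ↦ (p x * w (f x) - w' (f x), r x * w (f x) - r x₁))
          ∘ (extChartAt (𝓡 d) x).symm)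
          ((fderiv ℝ (f ∘ (extChartAt (𝓡 d) x).symm) y).smulRight
            (((r ((extChartAt (𝓡 d) x).symm y) * w (f ((extChartAt (𝓡 d) x).symm y)) - r x₁)
              - p ((extChartAt (𝓡 d) x).symm y) *
                (p ((extChartAt (𝓡 d) x).symm y) * w (f ((extChartAt (𝓡 d) x).symm y))
                - w' (f ((extChartAt (𝓡 d) x).symm y))),
              -r ((extChartAt (𝓡 d) x).symm y) *
                (p ((extChartAt (𝓡 d) x).symm y) * w (f ((extChartAt (𝓡 d) x).symm y))
                - w' (f ((extChartAt (𝓡 d) x).symm y)))) : ℝ × ℝ)) y := by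
      have hfd := ((contDiffAt_coord hf.smooth x hy).differentiableAt (by simp)).hasFDerivAt
      have hpd := ((contDiffAt_coord hps x hy).differentiableAt (by simp)).hasFDerivAt
      have hrd := ((contDiffAt_coord hrs x hy).differentiableAt (by simp)).hasFDerivAt
      have hwd := (hasDerivAt_quad (f x₁) (p x₁) (r x₁)
        (f ((extChartAt (𝓡 d) x).symm y))).comp_hasFDerivAt y hfd
      have hw'd : HasFDerivAt (fun z ↦ w' ((f ∘ (extChartAt (𝓡 d) x).symm) z)) _ y :=
        ((hfd.sub_const (f x₁)).const_mul (r x₁)).const_add (p x₁)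
      have h1 := ((hpd.mul hwd).sub hw'd).prodMk ((hrd.mul hwd).sub_const (r x₁))
      have h2 : HasFDerivAt ((fun x ↦ (p x * w (f x) - w' (f x), r x * w (f x) - r x₁))
          ∘ (extChartAt (𝓡 d) x).symm) _ y := h1
      refine h2.congr_fderiv (ContinuousLinearMap.ext fun b ↦ Prod.ext ?_ ?_)
      · simp only [ContinuousLinearMap.smulRight_apply, ContinuousLinearMap.prod_apply,
          add_apply, sub_apply, smul_apply, smul_eq_mul, Prod.smul_mk,
          hf.fderiv_torsionRatio h0 x hy b, Function.comp, hw']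
        ring
      · simp only [ContinuousLinearMap.smulRight_apply, ContinuousLinearMap.prod_apply,
          add_apply, sub_apply, smul_apply, smul_eq_mul, Prod.smul_mk,
          hf.fderiv_scalarRatio hh h0 x hy b, Function.comp, hw']
        ring
    refine eq_zero_of_norm_fderiv_le (d := d) (fun x y hy ↦ (hd x y hy).differentiableAt)
      (fun x y ↦ ‖fderiv ℝ (f ∘ (extChartAt (𝓡 d) x).symm) y‖ *
        (1 + ‖(p ∘ (extChartAt (𝓡 d) x).symm) y‖ + ‖(r ∘ (extChartAt (𝓡 d) x).symm) y‖))
      (fun x y hy ↦ ?_) (fun x y hy ↦ ?_) (x₁ := x₁) ?_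
    · exact (ContDiffAt.fderiv_top (contDiffAt_coord hf.smooth x hy)).continuousAt.norm.mul
        ((continuousAt_const.add (contDiffAt_coord hps x hy).continuousAt.norm).add
          (contDiffAt_coord hrs x hy).continuousAt.norm)
    · rw [(hd x y hy).fderiv, ContinuousLinearMap.norm_smulRight_apply, mul_assoc]
      refine mul_le_mul_of_nonneg_left ?_ (norm_nonneg _)
      simp only [Function.comp]
      generalize p ((extChartAt (𝓡 d) x).symm y) * w (f ((extChartAt (𝓡 d) x).symm y))
                - w' (f ((extChartAt (𝓡 d) x).symm y)) = A
      generalize r ((extChartAt (𝓡 d) x).symm y) * w (f ((extChartAt (𝓡 d) x).symm y))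
        - r x₁ = B
      generalize p ((extChartAt (𝓡 d) x).symm y) = p
      generalize r ((extChartAt (𝓡 d) x).symm y) = r
      have hA : ‖A‖ ≤ ‖(A, B)‖ := norm_fst_le (A, B)
      have hB : ‖B‖ ≤ ‖(A, B)‖ := norm_snd_le (A, B)
      refine norm_prod_le_iff.2 ⟨?_, ?_⟩
      · refine (norm_sub_le _ _).trans ?_
        rw [norm_mul]
        have := mul_le_mul_of_nonneg_left hA (norm_nonneg p)
        have := mul_nonneg (norm_nonneg r) (norm_nonneg (A, B))
        linarith
      · rw [norm_mul, norm_neg]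
        have := mul_le_mul_of_nonneg_left hA (norm_nonneg r)
        have := mul_nonneg (norm_nonneg p) (norm_nonneg (A, B))
        have := norm_nonneg (A, B)
        linarith
    · simp [hw, hw', quad]
  refine ⟨f x₁, p x₁, r x₁, fun x ↦ ?_⟩
  have e1 : p x * w (f x) - w' (f x) = 0 := congrArg Prod.fst (hAB x)
  have e2 : r x * w (f x) - r x₁ = 0 := congrArg Prod.snd (hAB x)
  -- At a zero of `w ∘ f`, the identities force `w'' = 0` and then `w' = 0`, so `w` would be the
  -- constant 1.
  refine ⟨fun hw0 ↦ ?_, sub_eq_zero.1 e1, sub_eq_zero.1 e2⟩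
  have hw0' : w (f x) = 0 := hw0
  rw [hw0'] at e1 e2
  have e3 : r x₁ = 0 := by linarith
  have e4 : p x₁ = 0 := by simp only [hw', e3] at e1; linarith
  simp [quad, e3, e4] at hw0

/-- With `P = w'/w` one has `P' + P² = w''/w = r₀/w`, from which both differential equations follow.
The factor `c` stays free so that `Q/N` can later be matched with a prescribed scale factor. -/
theorem exists_isRepresentedBy [PreconnectedSpace S] [Nonempty S]
    (hh : ContMDiff (𝓡 d) 𝓘(ℝ, ℝ) ∞ h)
    (hf : IsPotential γ s h f) (h0 : ∀ x, diff (d := d) f x ≠ 0) :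
    ∃ w P : ℝ → ℝ, (∀ x, w (f x) ≠ 0) ∧ ∀ c : ℝ, c ≠ 0 →
      IsRepresentedBy γ s h (fun x ↦ (c * w (f x) / normSqDiff γ f x) • grad γ f x) f
        (fun t ↦ c * w t) P := by
  obtain ⟨x₁⟩ := ‹Nonempty S›
  obtain ⟨t₀, p₀, r₀, hq⟩ := hf.ratio_eq_quad hh h0 x₁
  set w := quad t₀ p₀ r₀ with hw
  have hwd := hasDerivAt_quad t₀ p₀ r₀
  have hws : ContDiff ℝ ∞ w := by
    have : ContDiff ℝ ∞ fun t : ℝ ↦ 1 + p₀ * (t - t₀) + r₀ / 2 * (t - t₀) ^ 2 := by fun_prop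
    exact this
  set w' : ℝ → ℝ := fun t ↦ p₀ + r₀ * (t - t₀) with hw'
  have hw's : ContDiff ℝ ∞ w' := by fun_prop
  have hw'd (t : ℝ) : HasDerivAt w' r₀ t := by
    have : HasDerivAt w' (r₀ * 1) t := (((hasDerivAt_id t).sub_const t₀).const_mul r₀).const_add p₀
    rwa [mul_one] at this
  have hP (t : ℝ) (ht : w t ≠ 0) :
      HasDerivAt (fun t ↦ w' t / w t) ((r₀ * w t - w' t * w' t) / w t ^ 2) t :=
    (hw'd t).div (hwd t) ht
  have hR (t : ℝ) (ht : w t ≠ 0) :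
      deriv (fun t ↦ w' t / w t) t + (w' t / w t) ^ 2 = r₀ / w t := by
    rw [(hP t ht).deriv]
    field_simp
    ring
  have hp (x : S) : torsionRatio γ s f x = w' (f x) / w (f x) :=
    eq_div_of_mul_eq (hq x).1 (hq x).2.1
  have hr (x : S) : scalarRatio γ h f x = r₀ / w (f x) := eq_div_of_mul_eq (hq x).1 (hq x).2.2
  have hN0 (x : S) : normSqDiff γ f x ≠ 0 := (normSqDiff_pos (h0 x)).ne'
  refine ⟨w, fun t ↦ w' t / w t, fun x ↦ (hq x).1, fun c hc ↦ ⟨hf.smooth, h0, ⟨?_, ?_, ?_, ?_, ?_⟩,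
    fun x ↦ ?_, fun x ↦ ?_, fun x ↦ ?_⟩⟩
  · exact fun t _ ↦ (contDiff_const.mul hws).contDiffAt
  · rintro _ ⟨x, rfl⟩
    exact hw's.contDiffAt.div hws.contDiffAt (hq x).1
  · rintro _ ⟨x, rfl⟩
    rw [((hwd (f x)).const_mul c).deriv]
    have := (hq x).1
    field_simp
    rfl
  · rintro _ ⟨x, rfl⟩
    have hx := (hq x).1
    have hev : (fun t ↦ deriv (fun t ↦ w' t / w t) t + (w' t / w t) ^ 2)
        =ᶠ[𝓝 (f x)] fun t ↦ r₀ / w t := by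
      filter_upwards [hws.continuous.continuousAt.eventually_ne hx] with t ht using hR t ht
    have hdw : HasDerivAt (fun t ↦ r₀ / w t) _ (f x) :=
      (hasDerivAt_const (f x) r₀).div (hwd (f x)) hx
    rw [hev.deriv_eq, hR _ hx, hdw.deriv]
    field_simp
    simp [hw']
  · exact ⟨f x₁, mem_range_self _, mul_ne_zero hc (hq x₁).1⟩
  · rw [map_smul, inner_grad]
  · refine coordCovec_ext (I := 𝓡 d) (α := s.toFun) (β := fun x ↦ (1 / 2 : ℝ) •
      ((normSqDiff γ f x)⁻¹ • diff (d := d) (normSqDiff γ f) x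
      - (w' (f x) / w (f x)) • diff (d := d) f x)) (fun x y hy b ↦ ?_) x
    have e : coordCovec (fun x ↦ (1 / 2 : ℝ) •
        ((normSqDiff γ f x)⁻¹ • diff (d := d) (normSqDiff γ f) x
        - (w' (f x) / w (f x)) • diff (d := d) f x)) x y b = 1 / 2 *
        ((normSqDiff γ f ((extChartAt (𝓡 d) x).symm y))⁻¹
          * coordCovec (fun p ↦ diff (d := d) (normSqDiff γ f) p) x y b
        - torsionRatio γ s f ((extChartAt (𝓡 d) x).symm y)
          * coordCovec (fun p ↦ diff (d := d) f p) x y b) := by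
      rw [hp]
      rfl
    rw [e, ← fderiv_coord hf.smooth x hy, ← fderiv_coord (contMDiff_normSqDiff hf.smooth) x hy,
      (normSqDiff_coord_eventuallyEq hf.smooth x hy).fderiv_eq,
      (hf.hessian x y hy).fderiv_normSq (isGradient_coord γ hf.smooth x hy),
      ← normSqDiff_coord hf.smooth x hy, coordCovec_coordField _ _ _ hy]
    have := hN0 ((extChartAt (𝓡 d) x).symm y)
    simp only [torsionRatio]
    field_simp
    ring
  · rw [hR _ (hq x).1, ← hr]
    simp only [scalarRatio]
    have := hN0 x
    field_simp

end IsPotential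

theorem isKilling_zero : IsKilling (I := 𝓡 d) (fun x ↦ γ.inner x) (0 : VField (𝓡 d) S) := by
  refine ⟨smoothField_iff_chart.2 fun x y hy ↦ ?_, fun x y hy a b ↦ ?_⟩
  · rw [coordField_zero]
    exact contDiffAt_const
  · rw [coordLieDeriv_eq, coordField_zero, lieForm_zero]

theorem grad_eq_zero_of_diff_eq_zero {f : S → ℝ} {x : S} (h0 : diff (d := d) f x = 0) :
    grad γ f x = 0 :=
  inner_injective γ x (by rw [inner_grad, h0, map_zero])

/-- `cutKilling` is the image of the space of potentials under `f ↦ μ ∇f`. -/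
theorem exists_cutKilling_eq [PreconnectedSpace S] [Nonempty S]
    (hh : ContMDiff (𝓡 d) 𝓘(ℝ, ℝ) ∞ h) :
    ∃ μ : S → ℝ, (∀ x, μ x ≠ 0) ∧ cutKilling γ s h
      = {ς | ∃ f ∈ potentials γ s h, ς = fun x ↦ μ x • grad γ f x} := by
  have hzero : (0 : VField (𝓡 d) S) ∈ cutKilling γ s h := ⟨isKilling_zero, Or.inl rfl⟩
  -- If some potential is nonconstant, its own scale factor is taken as `μ`. Otherwise all gradients
  -- vanish, `cutKilling` contains only 0, and any `μ` without zeros will do.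
  by_cases hc : ∃ f₀ ∈ potentials γ s h, ∃ x₀, diff (d := d) f₀ x₀ ≠ 0
  · obtain ⟨f₀, hf₀, x₀, hx₀⟩ := hc
    have hne₀ : ∀ x, diff (d := d) f₀ x ≠ 0 := fun x hx ↦ hx₀ (IsPotential.diff_eq_zero hf₀ hx x₀)
    obtain ⟨w₀, P₀, hw₀, hrep₀⟩ := IsPotential.exists_isRepresentedBy hh hf₀ hne₀
    have hscale₀ := (hrep₀ 1 one_ne_zero).isScale
    set μ : S → ℝ := fun x ↦ 1 * w₀ (f₀ x) / normSqDiff γ f₀ x with hμ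
    have hμ0 (x : S) : μ x ≠ 0 :=
      div_ne_zero (mul_ne_zero one_ne_zero (hw₀ x)) (normSqDiff_pos (hne₀ x)).ne'
    refine ⟨μ, hμ0, ?_⟩
    ext ς
    constructor
    · rintro ⟨hk, rfl | ⟨f, Q, P, hr⟩⟩
      · refine ⟨0, Submodule.zero_mem _, ?_⟩
        funext x
        have := congrFun (grad_const (d := d) (S := S) γ 0) x
        exact ((congrArg (μ x • ·) this).trans (smul_zero _)).symm
      · have hf := hr.isPotential hk
        -- All scale factors are proportional, so `Q/N = c μ` and the field equals `μ ∇(c f)`.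
        obtain ⟨c, hc⟩ := hr.isScale.eq_mul hscale₀ (hμ0 x₀)
        refine ⟨c • f, Submodule.smul_mem _ c hf, ?_⟩
        rw [hr.field_eq_smul]
        funext x
        have e : grad γ (c • f) = c • grad γ f := by
          have := grad_comb γ hf.smooth (isPotential_const γ s h 0).smooth c
          rw [grad_const] at this
          rw [show (c • f + fun _ ↦ (0 : ℝ)) = c • f by ext; simp] at this
          rw [this, add_zero]
        rw [e, hc x, mul_comm, mul_smul]
        rfl
    · rintro ⟨f, hf, rfl⟩
      by_cases hd : ∀ x, diff (d := d) f x ≠ 0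
      · refine ⟨IsPotential.isKilling_smul_grad hf hscale₀, Or.inr ?_⟩
        obtain ⟨w, P, hw, hrep⟩ := IsPotential.exists_isRepresentedBy hh hf hd
        -- Here `μ` is `c` times the scale factor constructed from `f`, so `Q = c w` represents `μ
        -- ∇f` exactly; `c` is nonzero because `μ` is.
        obtain ⟨c, hc⟩ := hscale₀.eq_mul (hrep 1 one_ne_zero).isScale (x₁ := x₀)
          (div_ne_zero (mul_ne_zero one_ne_zero (hw x₀)) (normSqDiff_pos (hd x₀)).ne')
        have hc0 : c ≠ 0 := by
          rintro rfl
          exact hμ0 x₀ ((hc x₀).trans (zero_mul _))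
        refine ⟨f, fun t ↦ c * w t, P, ?_⟩
        convert hrep c hc0 using 3 with x
        exact (hc x).trans (by ring)
      · push Not at hd
        obtain ⟨x₁, hx₁⟩ := hd
        convert hzero using 1
        funext x
        rw [grad_eq_zero_of_diff_eq_zero (IsPotential.diff_eq_zero hf hx₁ x), smul_zero]
        rfl
  · push Not at hc
    refine ⟨fun _ ↦ 1, fun _ ↦ one_ne_zero, ?_⟩
    ext ς
    constructor
    · rintro ⟨hk, rfl | ⟨f, Q, P, hr⟩⟩
      · refine ⟨0, Submodule.zero_mem _, ?_⟩
        funext x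
        have := congrFun (grad_const (d := d) (S := S) γ 0) x
        exact ((congrArg ((1 : ℝ) • ·) this).trans (smul_zero _)).symm
      · obtain ⟨x₁⟩ := ‹Nonempty S›
        exact absurd (hc f (hr.isPotential hk) x₁) (hr.diff_ne_zero x₁)
    · rintro ⟨f, hf, rfl⟩
      convert hzero using 1
      funext x
      rw [grad_eq_zero_of_diff_eq_zero (hc f hf x), smul_zero]
      rfl

end CutKilling

/-! ### Killing vectors of the near horizon metric in a chart -/

section ChartKilling

variable {E : Type*} [NormedAddCommGroup E] [NormedSpace ℝ E]
  {G : E → E →L[ℝ] E →L[ℝ] ℝ} {σ : E → E →L[ℝ] ℝ} {η : E → ℝ}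

theorem lieForm_nhgForm_lift_eq_zero {f : E → ℝ} {Z : E → E} {y : E} (hg : IsGradient G f Z y)
    (hσ : ContDiffAt ℝ ∞ σ y) (hη : ContDiffAt ℝ ∞ η y) (h1 : HessianEq G σ f Z y)
    (h2 : TorsionEq σ η f Z y) (h3 : ScalarEq σ η Z y) (c : ℝ) (w : ℝ × ℝ)
    (A B : E × (ℝ × ℝ)) :
    lieForm (nhgForm G σ η) (liftForm (fun q ↦ c * q.2 + f q.1) (fun _ ↦ c)
      (fun q ↦ σ q.1 (Z q.1)) (fun q ↦ Z q.1)) (y, w) A B = 0 := by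
  obtain ⟨v, u⟩ := w
  obtain ⟨a, av, au⟩ := A
  obtain ⟨b, bv, bu⟩ := B
  have hσd := hσ.differentiableAt (by simp)
  have hηd := hη.differentiableAt (by simp)
  have hfd := hg.smooth_f.differentiableAt (by simp)
  have hZd := hg.smooth_Z.differentiableAt (by simp)
  have hfst : HasFDerivAt (fun q : E × ℝ ↦ q.1) (ContinuousLinearMap.fst ℝ E ℝ) (y, v) :=
    hasFDerivAt_fst
  have hsnd : HasFDerivAt (fun q : E × ℝ ↦ q.2) (ContinuousLinearMap.snd ℝ E ℝ) (y, v) :=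
    hasFDerivAt_snd
  have hF : HasFDerivAt (fun q : E × ℝ ↦ c * q.2 + f q.1) _ (y, v) :=
    (hsnd.const_mul c).add (HasFDerivAt.comp (y, v) (f := fun q : E × ℝ ↦ q.1) hfd.hasFDerivAt hfst)
  have hZ : HasFDerivAt (fun q : E × ℝ ↦ Z q.1) _ (y, v) :=
    HasFDerivAt.comp (y, v) (f := fun q : E × ℝ ↦ q.1) hZd.hasFDerivAt hfst
  have hk0 : HasFDerivAt (fun z ↦ σ z (Z z)) (fderiv ℝ (fun z ↦ σ z (Z z)) y) y :=
    (hσd.clm_apply hZd).hasFDerivAt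
  have hκ : HasFDerivAt (fun q : E × ℝ ↦ σ q.1 (Z q.1)) _ (y, v) :=
    HasFDerivAt.comp (y, v) (f := fun q : E × ℝ ↦ q.1) hk0 hfst
  rw [lieForm_nhgForm_liftForm u hg.hasFDerivAt_G hσd.hasFDerivAt hηd.hasFDerivAt hF
    (hasFDerivAt_const c _) hκ hZ]
  have e1 := h1 a b
  have ea := h2 a
  have eb := h2 b
  unfold ScalarEq at h3
  unfold lieForm at e1
  rw [hg.fderiv_G] at e1
  have ga := hg.grad.self_of_nhds a
  have gb := hg.grad.self_of_nhds b
  have sa := hg.symm.self_of_nhds a (Z y)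
  simp only [liftForm, nhgForm, add_apply, smul_apply, smul_eq_mul, ContinuousLinearMap.comp_apply,
    ContinuousLinearMap.coe_fst', ContinuousLinearMap.coe_snd', map_smul, map_sub, map_neg,
    sub_apply, neg_apply, zero_apply, neg_smul, sub_zero, mul_zero] at e1 ⊢
  rw [sa, ga, gb]
  -- The Lie derivative is a cubic in `u`: the Hessian, torsion and scalar equations enter at
  -- degrees 1, 2 and 3.
  linear_combination (-u) * e1 + u ^ 2 * bv * ea + u ^ 2 * av * eb - u ^ 3 * av * bv * h3

theorem nhgForm_du (z B : E × (ℝ × ℝ)) : nhgForm G σ η z (0, (0, 1)) B = B.2.1 := by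
  simp [nhgForm]

/-- Because `g(∂_u, ·) = dv` has constant coefficients, the `∂_u` components of the Killing equation
contain no derivative of the metric and integrate directly in `u`. -/
theorem lieForm_nhgForm_du (X : E × (ℝ × ℝ) → E × (ℝ × ℝ)) (z B : E × (ℝ × ℝ)) :
    lieForm (nhgForm G σ η) X z (0, (0, 1)) B
      = nhgForm G σ η z (fderiv ℝ X z (0, (0, 1))) B + (fderiv ℝ X z B).2.1 := by
  unfold lieForm
  simp [nhgForm_du]

variable (G σ η) in
/-- `X` is a Killing field of the near horizon metric over the open set `T` of a chart, and it is
a multiple of `∂_v` on the horizon. -/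
structure IsChartKilling (T : Set E) (X : E × (ℝ × ℝ) → E × (ℝ × ℝ)) : Prop where
  isOpen : IsOpen T
  smooth_G : ∀ y ∈ T, ContDiffAt ℝ ∞ G y
  smooth_σ : ∀ y ∈ T, ContDiffAt ℝ ∞ σ y
  smooth_η : ∀ y ∈ T, ContDiffAt ℝ ∞ η y
  symm : ∀ y ∈ T, ∀ a b, G y a b = G y b a
  pos : ∀ y ∈ T, ∀ a, a ≠ 0 → 0 < G y a a
  smooth : ∀ y ∈ T, ∀ w, ContDiffAt ℝ ∞ X (y, w)
  killing : ∀ y ∈ T, ∀ w A B, lieForm (nhgForm G σ η) X (y, w) A B = 0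
  fst_eq_zero : ∀ y ∈ T, ∀ v, (X (y, (v, 0))).1 = 0
  u_eq_zero : ∀ y ∈ T, ∀ v, (X (y, (v, 0))).2.2 = 0

namespace IsChartKilling

variable {T : Set E} {X : E × (ℝ × ℝ) → E × (ℝ × ℝ)} {y : E}

theorem differentiableAt (h : IsChartKilling G σ η T X) (hy : y ∈ T) (w : ℝ × ℝ) :
    DifferentiableAt ℝ X (y, w) := (h.smooth y hy w).differentiableAt (by simp)

theorem hasDerivAt_u (h : IsChartKilling G σ η T X) (hy : y ∈ T) (v u : ℝ) :
    HasDerivAt (fun u ↦ X (y, (v, u))) (fderiv ℝ X (y, (v, u)) (0, (0, 1))) u := by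
  have hc : HasDerivAt (fun u : ℝ ↦ (y, (v, u))) ((0 : E), ((0 : ℝ), (1 : ℝ))) u :=
    (hasDerivAt_const u y).prodMk ((hasDerivAt_const u v).prodMk (hasDerivAt_id u))
  exact (h.differentiableAt hy (v, u)).hasFDerivAt.comp_hasDerivAt u hc

theorem fderiv_du_v (h : IsChartKilling G σ η T X) (hy : y ∈ T) (w : ℝ × ℝ) :
    (fderiv ℝ X (y, w) (0, (0, 1))).2.1 = 0 := by
  have := h.killing y hy w (0, (0, 1)) (0, (0, 1))
  rw [lieForm_nhgForm_du] at this
  simp [nhgForm] at this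
  linarith

theorem v_eq (h : IsChartKilling G σ η T X) (hy : y ∈ T) (v u : ℝ) :
    (X (y, (v, u))).2.1 = (X (y, (v, 0))).2.1 := by
  have hd (u : ℝ) : HasDerivAt (fun u ↦ (X (y, (v, u))).2.1) 0 u := by
    have := (hasFDerivAt_snd (𝕜 := ℝ) (p := X (y, (v, u)))).comp_hasDerivAt u (h.hasDerivAt_u hy v u)
    have := (hasFDerivAt_fst (𝕜 := ℝ) (p := (X (y, (v, u))).2)).comp_hasDerivAt u this
    exact this.congr_deriv (h.fderiv_du_v hy _)
  exact is_const_of_deriv_eq_zero (fun u ↦ (hd u).differentiableAt) (fun u ↦ (hd u).deriv) u 0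

/-- The `∂_v` component on the horizon. -/
def _root_.NHG.vComp (X : E × (ℝ × ℝ) → E × (ℝ × ℝ)) (q : E × ℝ) : ℝ := (X (q.1, (q.2, 0))).2.1

/-- The coefficient of `-u` in the components along the cut. -/
def _root_.NHG.cutComp (X : E × (ℝ × ℝ) → E × (ℝ × ℝ)) (q : E × ℝ) : E := -(X (q.1, (q.2, 1))).1

theorem contDiffAt_slice (h : IsChartKilling G σ η T X) (hy : y ∈ T) (v u : ℝ) :
    ContDiffAt ℝ ∞ (fun q : E × ℝ ↦ X (q.1, (q.2, u))) (y, v) := by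
  have hp : ContDiffAt ℝ ∞ (fun q : E × ℝ ↦ (q.1, (q.2, u))) (y, v) :=
    contDiffAt_fst.prodMk (contDiffAt_snd.prodMk contDiffAt_const)
  exact ContDiffAt.comp (y, v) (g := X) (f := fun q : E × ℝ ↦ (q.1, (q.2, u)))
    (h.smooth y hy (v, u)) hp

theorem contDiffAt_vComp (h : IsChartKilling G σ η T X) (hy : y ∈ T) (v : ℝ) :
    ContDiffAt ℝ ∞ (vComp X) (y, v) := (h.contDiffAt_slice hy v 0).snd.fst

theorem contDiffAt_cutComp (h : IsChartKilling G σ η T X) (hy : y ∈ T) (v : ℝ) :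
    ContDiffAt ℝ ∞ (cutComp X) (y, v) := (h.contDiffAt_slice hy v 1).fst.neg

theorem fderiv_vComp (h : IsChartKilling G σ η T X) (hy : y ∈ T) (v u : ℝ) (b : E) (bv : ℝ) :
    (fderiv ℝ X (y, (v, u)) (b, (bv, 0))).2.1 = fderiv ℝ (vComp X) (y, v) (b, bv) := by
  have hp : HasFDerivAt (fun q : E × ℝ ↦ (q.1, (q.2, u)))
      ((ContinuousLinearMap.fst ℝ E ℝ).prod ((ContinuousLinearMap.snd ℝ E ℝ).prod 0)) (y, v) :=
    hasFDerivAt_fst.prodMk (hasFDerivAt_snd.prodMk (hasFDerivAt_const u _))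
  have hc := HasFDerivAt.comp (y, v) (g := X) (f := fun q : E × ℝ ↦ (q.1, (q.2, u)))
    (h.differentiableAt hy (v, u)).hasFDerivAt hp
  have h1 : HasFDerivAt (fun q : E × ℝ ↦ (X (q.1, (q.2, u))).2.1) _ (y, v) := hc.snd.fst
  have h2 : vComp X =ᶠ[𝓝 (y, v)] fun q : E × ℝ ↦ (X (q.1, (q.2, u))).2.1 := by
    have : ∀ᶠ q : E × ℝ in 𝓝 (y, v), q.1 ∈ T := continuousAt_fst.eventually (h.isOpen.mem_nhds hy)
    filter_upwards [this] with q hq using (h.v_eq hq q.2 u).symm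
  rw [h2.fderiv_eq, h1.fderiv]
  simp

/-- The component along `∂_u` and the cut: `∂_u X^A` is minus the gradient of the `∂_v` component,
which does not depend on `u`. -/
theorem inner_fderiv_du (h : IsChartKilling G σ η T X) (hy : y ∈ T) (v u : ℝ) (b : E) :
    G y (fderiv ℝ X (y, (v, u)) (0, (0, 1))).1 b = -fderiv ℝ (vComp X) (y, v) (b, 0) := by
  have := h.killing y hy (v, u) (0, (0, 1)) (b, (0, 0))
  rw [lieForm_nhgForm_du, h.fderiv_vComp hy] at this
  simp [nhgForm, h.fderiv_du_v hy] at this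
  linarith

theorem inner_injective (h : IsChartKilling G σ η T X) (hy : y ∈ T) {a a' : E}
    (ha : ∀ b, G y a b = G y a' b) : a = a' := by
  by_contra hne
  have := h.pos y hy (a - a') (sub_ne_zero.2 hne)
  have e : G y (a - a') = 0 := by
    ext b
    simp [ha]
  rw [e] at this
  exact this.false

/-- The cut component is affine in `u` and vanishes at `u = 0`, so its value at `u = 1` determines
it; this is why `cutComp` is evaluated there. -/
theorem fst_eq (h : IsChartKilling G σ η T X) (hy : y ∈ T) (v u : ℝ) :
    (X (y, (v, u))).1 = -u • cutComp X (y, v) := by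
  set k := (fderiv ℝ X (y, (v, 0)) (0, (0, 1))).1 with hk
  have hd (u : ℝ) : HasDerivAt (fun u ↦ (X (y, (v, u))).1 - u • k) 0 u := by
    have h1 := (hasFDerivAt_fst (𝕜 := ℝ) (p := X (y, (v, u)))).comp_hasDerivAt u
      (h.hasDerivAt_u hy v u)
    have h2 := h1.sub ((hasDerivAt_id u).smul_const k)
    refine h2.congr_deriv ?_
    rw [one_smul, sub_eq_zero]
    refine h.inner_injective hy fun b ↦ ?_
    rw [hk, h.inner_fderiv_du hy]
    exact h.inner_fderiv_du hy v u b
  have key (u u' : ℝ) := is_const_of_deriv_eq_zero (fun u ↦ (hd u).differentiableAt)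
    (fun u ↦ (hd u).deriv) u u'
  have h1 := key 1 0
  have hu := key u 0
  simp only [h.fst_eq_zero y hy v, one_smul, zero_smul, sub_zero, sub_eq_zero] at h1 hu
  simp only [cutComp]
  rw [h1, hu]
  simp

theorem inner_cutComp (h : IsChartKilling G σ η T X) (hy : y ∈ T) (v : ℝ) (b : E) :
    G y (cutComp X (y, v)) b = fderiv ℝ (vComp X) (y, v) (b, 0) := by
  have h1 := (hasFDerivAt_fst (𝕜 := ℝ) (p := X (y, (v, 0)))).comp_hasDerivAt 0
    (h.hasDerivAt_u hy v 0)
  have h2 : HasDerivAt (fun u : ℝ ↦ -u • cutComp X (y, v)) (-1 • cutComp X (y, v)) 0 := by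
    simpa using (hasDerivAt_id (0 : ℝ)).neg.smul_const (cutComp X (y, v))
  have h3 := h1.unique (h2.congr_of_eventuallyEq
    (Filter.Eventually.of_forall fun u ↦ h.fst_eq hy v u))
  have h4 := h.inner_fderiv_du hy v 0 b
  have h5 : (fderiv ℝ X (y, (v, 0)) (0, (0, 1))).1 = -1 • cutComp X (y, v) := h3
  rw [h5] at h4
  simp at h4
  exact h4

/-- The component along `∂_u` and `∂_v` prescribes `∂_u X^u`; integration starts from `X^u = 0` on
the horizon. -/
theorem u_eq (h : IsChartKilling G σ η T X) (hy : y ∈ T) (v u : ℝ) :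
    (X (y, (v, u))).2.2 = -u * fderiv ℝ (vComp X) (y, v) (0, 1)
      + u ^ 2 * σ y (cutComp X (y, v)) := by
  have hd (u : ℝ) : HasDerivAt (fun u ↦ (X (y, (v, u))).2.2
      - (-u * fderiv ℝ (vComp X) (y, v) (0, 1) + u ^ 2 * σ y (cutComp X (y, v)))) 0 u := by
    have h0 := h.hasDerivAt_u hy v u
    have h1 := (hasFDerivAt_snd (𝕜 := ℝ) (p := X (y, (v, u)))).comp_hasDerivAt u h0
    have h1 := (hasFDerivAt_snd (𝕜 := ℝ) (p := (X (y, (v, u))).2)).comp_hasDerivAt u h1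
    have h2 := h1.sub (((hasDerivAt_id u).neg.mul_const (fderiv ℝ (vComp X) (y, v) (0, 1))).add
      (((hasDerivAt_id u).pow 2).mul_const (σ y (cutComp X (y, v)))))
    refine h2.congr_deriv ?_
    have h3 := h.killing y hy (v, u) (0, (0, 1)) (0, (1, 0))
    have h4 : (fderiv ℝ X (y, (v, u)) (0, (0, 1))).1 = -cutComp X (y, v) := by
      refine h.inner_injective hy fun b ↦ ?_
      rw [h.inner_fderiv_du hy, map_neg, neg_apply, h.inner_cutComp hy]
    rw [lieForm_nhgForm_du, h.fderiv_vComp hy] at h3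
    simp [nhgForm, h.fderiv_du_v hy, h4] at h3
    simp
    linear_combination h3
  have key := is_const_of_deriv_eq_zero (fun u ↦ (hd u).differentiableAt)
    (fun u ↦ (hd u).deriv) u 0
  rw [h.u_eq_zero y hy] at key
  simp at key
  linear_combination key

theorem eq_liftForm (h : IsChartKilling G σ η T X) (hy : y ∈ T) (w : ℝ × ℝ) :
    X (y, w) = liftForm (vComp X) (fun q ↦ fderiv ℝ (vComp X) q (0, 1))
      (fun q ↦ σ q.1 (cutComp X q)) (cutComp X) (y, w) :=
  Prod.ext (h.fst_eq hy w.1 w.2) (Prod.ext (h.v_eq hy w.1 w.2) (h.u_eq hy w.1 w.2))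

end IsChartKilling

end ChartKilling

/-! ### The remaining components of the Killing equation, as polynomials in `u` -/

section ChartKilling

variable {E : Type*} [NormedAddCommGroup E] [NormedSpace ℝ E]
  {G : E → E →L[ℝ] E →L[ℝ] ℝ} {σ : E → E →L[ℝ] ℝ} {η : E → ℝ}

namespace IsChartKilling

variable {T : Set E} {X : E × (ℝ × ℝ) → E × (ℝ × ℝ)} {y : E}

theorem eventually_mem (h : IsChartKilling G σ η T X) (hy : y ∈ T) (v : ℝ) :
    ∀ᶠ q : E × ℝ in 𝓝 (y, v), q.1 ∈ T := continuousAt_fst.eventually (h.isOpen.mem_nhds hy)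

theorem contDiffAt_dv (h : IsChartKilling G σ η T X) (hy : y ∈ T) (v : ℝ) :
    ContDiffAt ℝ ∞ (fun q ↦ fderiv ℝ (vComp X) q (0, 1)) (y, v) :=
  (ContDiffAt.fderiv_top (h.contDiffAt_vComp hy v)).clm_apply contDiffAt_const

theorem contDiffAt_κ (h : IsChartKilling G σ η T X) (hy : y ∈ T) (v : ℝ) :
    ContDiffAt ℝ ∞ (fun q ↦ σ q.1 (cutComp X q)) (y, v) :=
  (ContDiffAt.comp (y, v) (f := fun q : E × ℝ ↦ q.1) (h.smooth_σ y hy)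
    contDiffAt_fst).clm_apply (h.contDiffAt_cutComp hy v)

theorem lieForm_eq (h : IsChartKilling G σ η T X) (hy : y ∈ T) (v u : ℝ)
    (a b : E) (av bv : ℝ) :
      let Xu : ℝ := -u * fderiv ℝ (vComp X) (y, v) (0, 1) + u ^ 2 * σ y (cutComp X (y, v))
      let D : E → ℝ → E × (ℝ × ℝ) := fun c cv ↦
        (-u • fderiv ℝ (cutComp X) (y, v) (c, cv), (fderiv ℝ (vComp X) (y, v) (c, cv),
          -u * fderiv ℝ (fun q ↦ fderiv ℝ (vComp X) q (0, 1)) (y, v) (c, cv)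
            + u ^ 2 * fderiv ℝ (fun q ↦ σ q.1 (cutComp X q)) (y, v) (c, cv)))
      (av * (2 * Xu * σ y b - 2 * u ^ 2 * fderiv ℝ σ y (cutComp X (y, v)) b + u * Xu * η y * bv
          - 1 / 2 * u ^ 3 * fderiv ℝ η y (cutComp X (y, v)) * bv)
        + (2 * Xu * σ y a - 2 * u ^ 2 * fderiv ℝ σ y (cutComp X (y, v)) a + u * Xu * η y * av
          - 1 / 2 * u ^ 3 * fderiv ℝ η y (cutComp X (y, v)) * av) * bv
        - u * fderiv ℝ G y (cutComp X (y, v)) a b)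
      + nhgForm G σ η (y, (v, u)) (D a av) (b, (bv, 0))
      + nhgForm G σ η (y, (v, u)) (a, (av, 0)) (D b bv) = 0 := by
  have h0 := h.killing y hy (v, u) (a, (av, 0)) (b, (bv, 0))
  have he : X =ᶠ[𝓝 (y, (v, u))] liftForm (vComp X) (fun q ↦ fderiv ℝ (vComp X) q (0, 1))
      (fun q ↦ σ q.1 (cutComp X q)) (cutComp X) := by
    have : ∀ᶠ q : E × (ℝ × ℝ) in 𝓝 (y, (v, u)), q.1 ∈ T :=
      continuousAt_fst.eventually (h.isOpen.mem_nhds hy)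
    filter_upwards [this] with q hq using h.eq_liftForm hq q.2
  unfold lieForm at h0
  rw [he.fderiv_eq, he.eq_of_nhds] at h0
  have h1 := lieForm_nhgForm_liftForm u
    ((h.smooth_G y hy).differentiableAt (by simp)).hasFDerivAt
    ((h.smooth_σ y hy).differentiableAt (by simp)).hasFDerivAt
    ((h.smooth_η y hy).differentiableAt (by simp)).hasFDerivAt
    ((h.contDiffAt_vComp hy v).differentiableAt (by simp)).hasFDerivAt
    ((h.contDiffAt_dv hy v).differentiableAt (by simp)).hasFDerivAt
    ((h.contDiffAt_κ hy v).differentiableAt (by simp)).hasFDerivAt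
    ((h.contDiffAt_cutComp hy v).differentiableAt (by simp)).hasFDerivAt a b av 0 bv 0
  have h2 := h1.symm.trans h0
  simp only [liftForm, neg_smul, zero_smul, neg_zero, zero_mul, mul_zero, add_zero, neg_mul,
    zero_sub, map_neg, map_smul, neg_apply, smul_apply, smul_eq_mul] at h2 ⊢
  linear_combination h2

/-- The components along the cut are homogeneous of degree one in `u`, so `u = 1` carries all their
content. -/
theorem hess (h : IsChartKilling G σ η T X) (hy : y ∈ T) (v : ℝ) (a b : E) :
    fderiv ℝ G y (cutComp X (y, v)) a b + G y (fderiv ℝ (cutComp X) (y, v) (a, 0)) b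
      + G y a (fderiv ℝ (cutComp X) (y, v) (b, 0))
      = 2 * (σ y a * fderiv ℝ (vComp X) (y, v) (b, 0)
        + σ y b * fderiv ℝ (vComp X) (y, v) (a, 0)) := by
  have := h.lieForm_eq hy v 1 a b 0 0
  simp [nhgForm] at this
  linear_combination -this

theorem inner_dv_cutComp (h : IsChartKilling G σ η T X) (hy : y ∈ T) (v : ℝ) (b : E) :
    G y (fderiv ℝ (cutComp X) (y, v) (0, 1)) b
      = fderiv ℝ (fun q ↦ fderiv ℝ (vComp X) q (0, 1)) (y, v) (b, 0) := by
  have hG := ((h.smooth_G y hy).differentiableAt (by simp)).hasFDerivAt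
  have hZ := ((h.contDiffAt_cutComp hy v).differentiableAt (by simp)).hasFDerivAt
  have hF := h.contDiffAt_vComp hy v
  have hdF := (ContDiffAt.fderiv_top hF).differentiableAt (by simp)
  rw [fderiv_clm_apply_const hdF, ← fderiv_fderiv_symm hF, ← fderiv_clm_apply_const hdF]
  have h1 : (fun q : E × ℝ ↦ fderiv ℝ (vComp X) q (b, 0))
      =ᶠ[𝓝 (y, v)] fun q ↦ G q.1 (cutComp X q) b := by
    filter_upwards [h.eventually_mem hy v] with q hq using (h.inner_cutComp hq q.2 b).symm
  rw [h1.fderiv_eq]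
  have hG1 : HasFDerivAt (fun z ↦ G z.1) _ (y, v) :=
    HasFDerivAt.comp (y, v) (f := fun q : E × ℝ ↦ q.1) hG hasFDerivAt_fst
  rw [HasFDerivAt.bilin_apply hG1 hZ (hasFDerivAt_const b _)]
  simp

/-- The component along `∂_v` and the cut has only a linear and a quadratic term in `u`. Comparing
`u = 1` with `u = -1` separates them in the next two lemmas. -/
theorem torsion_aux (h : IsChartKilling G σ η T X) (hy : y ∈ T) (v u : ℝ) (b : E) :
    2 * u * fderiv ℝ (fun q ↦ fderiv ℝ (vComp X) q (0, 1)) (y, v) (b, 0)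
      = u ^ 2 * (η y * fderiv ℝ (vComp X) (y, v) (b, 0)
        + fderiv ℝ (fun q ↦ σ q.1 (cutComp X q)) (y, v) (b, 0)
        + 2 * σ y (cutComp X (y, v)) * σ y b
        - 2 * (fderiv ℝ σ y (cutComp X (y, v)) b
          + σ y (fderiv ℝ (cutComp X) (y, v) (b, 0)))) := by
  have h1 := h.lieForm_eq hy v u 0 b 1 0
  simp [nhgForm, h.inner_dv_cutComp hy] at h1
  linear_combination -h1

theorem fderiv_dv_fst (h : IsChartKilling G σ η T X) (hy : y ∈ T) (v : ℝ) (b : E) :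
    fderiv ℝ (fun q ↦ fderiv ℝ (vComp X) q (0, 1)) (y, v) (b, 0) = 0 := by
  linear_combination (h.torsion_aux hy v 1 b - h.torsion_aux hy v (-1) b) / 4

theorem torsion (h : IsChartKilling G σ η T X) (hy : y ∈ T) (v : ℝ) (b : E) :
    η y * fderiv ℝ (vComp X) (y, v) (b, 0)
        + fderiv ℝ (fun q ↦ σ q.1 (cutComp X q)) (y, v) (b, 0)
        + 2 * σ y (cutComp X (y, v)) * σ y b
        - 2 * (fderiv ℝ σ y (cutComp X (y, v)) b
          + σ y (fderiv ℝ (cutComp X) (y, v) (b, 0))) = 0 := by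
  linear_combination -(h.torsion_aux hy v 1 b + h.torsion_aux hy v (-1) b) / 2

theorem fderiv_dv_eq_zero (h : IsChartKilling G σ η T X) (hy : y ∈ T) (v : ℝ) :
    fderiv ℝ (fun q ↦ fderiv ℝ (vComp X) q (0, 1)) (y, v) = 0 ∧
      fderiv ℝ η y (cutComp X (y, v)) = 2 * η y * σ y (cutComp X (y, v)) := by
  -- The component along `∂_v` twice is a cubic in `u` without constant term, so the three values
  -- `1`, `-1`, `2` isolate its coefficients.
  have key (u : ℝ) := h.lieForm_eq hy v u 0 0 1 1
  simp [nhgForm] at key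
  have h1 := key 1
  have h2 := key (-1)
  have h3 := key 2
  constructor
  · refine ContinuousLinearMap.ext fun q ↦ ?_
    obtain ⟨b, t⟩ := q
    have e : ((b, t) : E × ℝ) = (b, 0) + t • ((0 : E), (1 : ℝ)) := by ext <;> simp
    rw [e, map_add, map_smul, h.fderiv_dv_fst hy]
    simp
    right
    linarith
  · linarith

/-- The difference quotient of the `∂_v` component on the horizon. -/
def _root_.NHG.vSlope (X : E × (ℝ × ℝ) → E × (ℝ × ℝ)) (y : E) : ℝ := vComp X (y, 1) - vComp X (y, 0)

/-- The vanishing of `F_vv` makes `F` affine in `v`. Writing the slope as `F(1) - F(0)` expresses it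
through values of the field, hence independently of the chart. -/
theorem vComp_eq (h : IsChartKilling G σ η T X) (hy : y ∈ T) (v : ℝ) :
    vComp X (y, v) = vSlope X y * v + vComp X (y, 0) ∧
      fderiv ℝ (vComp X) (y, v) (0, 1) = vSlope X y := by
  have hc (v : ℝ) : HasDerivAt (fun v : ℝ ↦ (y, v)) ((0 : E), (1 : ℝ)) v :=
    (hasDerivAt_const v y).prodMk (hasDerivAt_id v)
  have hdd (v : ℝ) : HasDerivAt (fun v ↦ fderiv ℝ (vComp X) (y, v) (0, 1)) 0 v := by
    have := HasFDerivAt.comp_hasDerivAt v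
      ((h.contDiffAt_dv hy v).differentiableAt (by simp)).hasFDerivAt (hc v)
    rw [(h.fderiv_dv_eq_zero hy v).1] at this
    exact this
  have hcst (v : ℝ) : fderiv ℝ (vComp X) (y, v) (0, 1) = fderiv ℝ (vComp X) (y, 0) (0, 1) :=
    is_const_of_deriv_eq_zero (fun u ↦ (hdd u).differentiableAt) (fun u ↦ (hdd u).deriv) v 0
  set c := fderiv ℝ (vComp X) (y, 0) (0, 1)
  have hd (v : ℝ) : HasDerivAt (fun v ↦ vComp X (y, v) - c * v) 0 v := by
    have := HasFDerivAt.comp_hasDerivAt v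
      ((h.contDiffAt_vComp hy v).differentiableAt (by simp)).hasFDerivAt (hc v)
    refine (this.sub ((hasDerivAt_id v).const_mul c)).congr_deriv ?_
    rw [hcst]
    ring
  have key (v : ℝ) := is_const_of_deriv_eq_zero (fun u ↦ (hd u).differentiableAt)
    (fun u ↦ (hd u).deriv) v 0
  have e : vSlope X y = c := by
    have := key 1
    simp only [vSlope]
    linarith
  refine ⟨?_, (hcst v).trans e.symm⟩
  rw [e]
  linarith [key v]

theorem hasFDerivAt_vComp_slice (h : IsChartKilling G σ η T X) (hy : y ∈ T) (v : ℝ) :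
    HasFDerivAt (fun z ↦ vComp X (z, v))
      ((fderiv ℝ (vComp X) (y, v)).comp (ContinuousLinearMap.inl ℝ E ℝ)) y :=
  HasFDerivAt.comp y (f := fun z : E ↦ (z, v))
    ((h.contDiffAt_vComp hy v).differentiableAt (by simp)).hasFDerivAt
    (hasFDerivAt_prodMk_left y v)

theorem fderiv_vSlope (h : IsChartKilling G σ η T X) (hy : y ∈ T) : fderiv ℝ (vSlope X) y = 0 := by
  have h1 : HasFDerivAt (fun z ↦ fderiv ℝ (vComp X) (z, 0) (0, 1)) _ y :=
    HasFDerivAt.comp y (g := fun q ↦ fderiv ℝ (vComp X) q (0, 1)) (f := fun z : E ↦ (z, (0 : ℝ)))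
      ((h.contDiffAt_dv hy 0).differentiableAt (by simp)).hasFDerivAt
      (hasFDerivAt_prodMk_left y 0)
  have h2 : vSlope X =ᶠ[𝓝 y] fun z ↦ fderiv ℝ (vComp X) (z, 0) (0, 1) := by
    filter_upwards [h.isOpen.mem_nhds hy] with z hz using (h.vComp_eq hz 0).2.symm
  rw [h2.fderiv_eq, h1.fderiv, (h.fderiv_dv_eq_zero hy 0).1]
  simp

/-- The slope of `F` in `v` is locally constant along the cut, so the gradient of `F` along the cut
does not involve `v`. -/
theorem cutComp_eq (h : IsChartKilling G σ η T X) (hy : y ∈ T) (v : ℝ) :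
    cutComp X (y, v) = cutComp X (y, 0) := by
  refine h.inner_injective hy fun b ↦ ?_
  rw [h.inner_cutComp hy, h.inner_cutComp hy]
  have e1 : fderiv ℝ (vComp X) (y, v) (b, 0) = fderiv ℝ (fun z ↦ vComp X (z, v)) y b := by
    rw [(h.hasFDerivAt_vComp_slice hy v).fderiv]
    simp
  have e2 : fderiv ℝ (vComp X) (y, 0) (b, 0) = fderiv ℝ (fun z ↦ vComp X (z, 0)) y b := by
    rw [(h.hasFDerivAt_vComp_slice hy 0).fderiv]
    simp
  have hs : HasFDerivAt (vSlope X) (0 : E →L[ℝ] ℝ) y := by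
    have : DifferentiableAt ℝ (vSlope X) y :=
      ((h.hasFDerivAt_vComp_slice hy 1).sub (h.hasFDerivAt_vComp_slice hy 0)).differentiableAt
    exact h.fderiv_vSlope hy ▸ this.hasFDerivAt
  have h3 : (fun z ↦ vComp X (z, v)) =ᶠ[𝓝 y] fun z ↦ vSlope X z * v + vComp X (z, 0) := by
    filter_upwards [h.isOpen.mem_nhds hy] with z hz using (h.vComp_eq hz v).1
  have h4 : HasFDerivAt (fun z ↦ vSlope X z * v + vComp X (z, 0)) _ y :=
    (hs.mul_const v).add (h.hasFDerivAt_vComp_slice hy 0)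
  rw [e1, e2, h3.fderiv_eq, h4.fderiv, (h.hasFDerivAt_vComp_slice hy 0).fderiv]
  simp

theorem apply_eq (h : IsChartKilling G σ η T X) (hy : y ∈ T) (v u : ℝ) :
    X (y, (v, u)) = (-u • cutComp X (y, 0), (vSlope X y * v + vComp X (y, 0),
      -u * vSlope X y + u ^ 2 * σ y (cutComp X (y, 0)))) := by
  rw [h.eq_liftForm hy]
  simp only [liftForm]
  rw [h.cutComp_eq hy, (h.vComp_eq hy v).1, (h.vComp_eq hy v).2]

theorem isGradient (h : IsChartKilling G σ η T X) (hy : y ∈ T) :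
    IsGradient G (fun z ↦ vComp X (z, 0)) (fun z ↦ cutComp X (z, 0)) y := by
  have hp : ContDiffAt ℝ ∞ (fun z : E ↦ (z, (0 : ℝ))) y := contDiffAt_id.prodMk contDiffAt_const
  refine ⟨h.smooth_G y hy, ?_, ?_,
    ContDiffAt.comp y (f := fun z : E ↦ (z, (0 : ℝ))) (h.contDiffAt_vComp hy 0) hp,
    ContDiffAt.comp y (f := fun z : E ↦ (z, (0 : ℝ))) (h.contDiffAt_cutComp hy 0) hp, ?_⟩
  all_goals filter_upwards [h.isOpen.mem_nhds hy] with z hz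
  · exact h.symm z hz
  · exact h.pos z hz
  · intro b
    rw [h.inner_cutComp hz, (h.hasFDerivAt_vComp_slice hz 0).fderiv]
    simp

theorem potentialEq (h : IsChartKilling G σ η T X) (hy : y ∈ T) :
    HessianEq G σ (fun z ↦ vComp X (z, 0)) (fun z ↦ cutComp X (z, 0)) y ∧
      TorsionEq σ η (fun z ↦ vComp X (z, 0)) (fun z ↦ cutComp X (z, 0)) y ∧
      ScalarEq σ η (fun z ↦ cutComp X (z, 0)) y := by
  have hF := (h.hasFDerivAt_vComp_slice hy 0).fderiv
  have hZ : HasFDerivAt (fun z ↦ cutComp X (z, 0)) _ y :=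
    HasFDerivAt.comp y (f := fun z : E ↦ (z, (0 : ℝ)))
      ((h.contDiffAt_cutComp hy 0).differentiableAt (by simp)).hasFDerivAt
      (hasFDerivAt_prodMk_left y 0)
  have hκ : HasFDerivAt (fun z ↦ σ z (cutComp X (z, 0))) _ y :=
    HasFDerivAt.comp y (g := fun q ↦ σ q.1 (cutComp X q)) (f := fun z : E ↦ (z, (0 : ℝ)))
      ((h.contDiffAt_κ hy 0).differentiableAt (by simp)).hasFDerivAt
      (hasFDerivAt_prodMk_left y 0)
  refine ⟨fun a b ↦ ?_, fun b ↦ ?_, (h.fderiv_dv_eq_zero hy 0).2⟩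
  · unfold lieForm
    rw [(h.isGradient hy).fderiv_G, hF, hZ.fderiv]
    simpa using h.hess hy 0 a b
  · rw [hF, hZ.fderiv, hκ.fderiv]
    simpa using h.torsion hy 0 b

end IsChartKilling

end ChartKilling

/-! ### Product charts of the near horizon geometry -/

section ProductChart

variable {d : ℕ} {S : Type*} [TopologicalSpace S] [ChartedSpace (EuclideanSpace ℝ (Fin d)) S]
  [IsManifold (𝓡 d) ∞ S] (γ : RMetric d S) (s : OneForm d S) (h : S → ℝ)

local notation "Ed" => EuclideanSpace ℝ (Fin d)

theorem dv_apply (p : NHGSpace S) (w : Ed × (ℝ × ℝ)) : dv (d := d) p w = w.2.1 := by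
  have h2 : HasMFDerivAt (nhgModel d) 𝓘(ℝ, ℝ × ℝ) (Prod.snd : NHGSpace S → ℝ × ℝ) p _ :=
    hasMFDerivAt_snd p
  have h1 : HasMFDerivAt 𝓘(ℝ, ℝ × ℝ) 𝓘(ℝ, ℝ) (Prod.fst : ℝ × ℝ → ℝ) p.2 _ :=
    (hasFDerivAt_fst (𝕜 := ℝ) (p := p.2)).hasMFDerivAt
  have := (HasMFDerivAt.comp p h1 h2).mfderiv
  exact congrArg (fun L ↦ L w) this

theorem du_apply (p : NHGSpace S) (w : Ed × (ℝ × ℝ)) : du (d := d) p w = w.2.2 := by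
  have h2 : HasMFDerivAt (nhgModel d) 𝓘(ℝ, ℝ × ℝ) (Prod.snd : NHGSpace S → ℝ × ℝ) p _ :=
    hasMFDerivAt_snd p
  have h1 : HasMFDerivAt 𝓘(ℝ, ℝ × ℝ) 𝓘(ℝ, ℝ) (Prod.snd : ℝ × ℝ → ℝ) p.2 _ :=
    (hasFDerivAt_snd (𝕜 := ℝ) (p := p.2)).hasMFDerivAt
  have := (HasMFDerivAt.comp p h1 h2).mfderiv
  exact congrArg (fun L ↦ L w) this

theorem dpr_apply (p : NHGSpace S) (w : Ed × (ℝ × ℝ)) : dpr (d := d) p w = w.1 := by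
  have h2 : HasMFDerivAt (nhgModel d) (𝓡 d) (Prod.fst : NHGSpace S → S) p _ :=
    hasMFDerivAt_fst p
  exact congrArg (fun L ↦ L w) h2.mfderiv

/-- The second factor of each chart is the identity, so the chart at `(x, (0, 0))` already covers
all values of `v` and `u` over its base. -/
theorem extChartAt_nhg (p : NHGSpace S) :
    extChartAt (nhgModel d) p = (extChartAt (𝓡 d) p.1).prod (PartialEquiv.refl (ℝ × ℝ)) := by
  rw [extChartAt_prod, extChartAt_model_space_eq_id]

theorem mem_target_nhg {p : NHGSpace S} {z : Ed × (ℝ × ℝ)} :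
    z ∈ (extChartAt (nhgModel d) p).target ↔ z.1 ∈ (extChartAt (𝓡 d) p.1).target := by
  rw [extChartAt_nhg]
  simp [PartialEquiv.prod_target, mem_prod]

theorem extChartAt_nhg_apply (p q : NHGSpace S) :
    extChartAt (nhgModel d) p q = (extChartAt (𝓡 d) p.1 q.1, q.2) := by
  rw [extChartAt_nhg]
  rfl

theorem extChartAt_nhg_symm_apply (p : NHGSpace S) (z : Ed × (ℝ × ℝ)) :
    (extChartAt (nhgModel d) p).symm z = ((extChartAt (𝓡 d) p.1).symm z.1, z.2) := by
  rw [extChartAt_nhg]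
  rfl

theorem mfderiv_nhg_symm_apply {p : NHGSpace S} {z : Ed × (ℝ × ℝ)}
    (hz : z.1 ∈ (extChartAt (𝓡 d) p.1).target) (a : Ed × (ℝ × ℝ)) :
    (mfderiv 𝓘(ℝ, Ed × (ℝ × ℝ)) (nhgModel d) (extChartAt (nhgModel d) p).symm z a : Ed × (ℝ × ℝ))
      = ((mfderiv 𝓘(ℝ, Ed) (𝓡 d) (extChartAt (𝓡 d) p.1).symm z.1 a.1 : Ed), a.2) := by
  have e : ((extChartAt (nhgModel d) p).symm : Ed × (ℝ × ℝ) → NHGSpace S)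
      = fun z ↦ ((extChartAt (𝓡 d) p.1).symm z.1, z.2) := funext (extChartAt_nhg_symm_apply p)
  rw [e]
  have h1 : MDifferentiableAt 𝓘(ℝ, Ed) (𝓡 d) (extChartAt (𝓡 d) p.1).symm z.1 :=
    (contMDiffAt_symm (I := 𝓡 d) hz).mdifferentiableAt (by simp)
  have h2 := HasMFDerivAt.comp z h1.hasMFDerivAt
    (hasFDerivAt_fst (𝕜 := ℝ) (p := z)).hasMFDerivAt
  have h3 := h2.prodMk (hasFDerivAt_snd (𝕜 := ℝ) (p := z)).hasMFDerivAt
  exact congrArg (fun L ↦ L a) h3.mfderiv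

theorem mfderiv_nhg_apply {p q : NHGSpace S}
    (hq : q.1 ∈ (extChartAt (𝓡 d) p.1).source) (w : Ed × (ℝ × ℝ)) :
    (mfderiv (nhgModel d) 𝓘(ℝ, Ed × (ℝ × ℝ)) (extChartAt (nhgModel d) p) q w : Ed × (ℝ × ℝ))
      = ((mfderiv (𝓡 d) 𝓘(ℝ, Ed) (extChartAt (𝓡 d) p.1) q.1 (show Ed from w.1) : Ed), w.2) := by
  have e : (extChartAt (nhgModel d) p : NHGSpace S → Ed × (ℝ × ℝ))
      = fun q ↦ (extChartAt (𝓡 d) p.1 q.1, q.2) := funext (extChartAt_nhg_apply p)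
  rw [e]
  have h1 : MDifferentiableAt (𝓡 d) 𝓘(ℝ, Ed) (extChartAt (𝓡 d) p.1) q.1 :=
    mdifferentiableAt_extChartAt (by rwa [extChartAt_source] at hq)
  have h2 := HasMFDerivAt.comp q h1.hasMFDerivAt
    (hasMFDerivAt_fst (I := 𝓡 d) (I' := 𝓘(ℝ, ℝ × ℝ)) q)
  have h2' := hasMFDerivAt_snd (I := 𝓡 d) (I' := 𝓘(ℝ, ℝ × ℝ)) q
  have h3 : HasMFDerivAt (nhgModel d) 𝓘(ℝ, Ed × (ℝ × ℝ))
      (fun q : NHGSpace S ↦ (extChartAt (𝓡 d) p.1 q.1, q.2)) q _ :=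
    ⟨h2.1.prodMk h2'.1, h2.2.prodMk h2'.2⟩
  exact congrArg (fun L ↦ L w) h3.mfderiv

theorem nhgMetric_apply (p : NHGSpace S) (a b : Ed × (ℝ × ℝ)) :
    nhgMetric γ s h p a b =
      a.2.1 * (b.2.2 + 2 * p.2.2 * s.toFun p.1 b.1 + 1 / 2 * p.2.2 ^ 2 * h p.1 * b.2.1)
      + (a.2.2 + 2 * p.2.2 * s.toFun p.1 a.1 + 1 / 2 * p.2.2 ^ 2 * h p.1 * a.2.1) * b.2.1
      + γ.inner p.1 a.1 b.1 := by
  have e : nhgMetric γ s h p a b =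
      dv (d := d) p a * (du (d := d) p b + (2 * p.2.2) * s.toFun p.1 (dpr (d := d) p b)
        + ((1 / 2) * p.2.2 ^ 2 * h p.1) * dv (d := d) p b)
      + (du (d := d) p a + (2 * p.2.2) * s.toFun p.1 (dpr (d := d) p a)
        + ((1 / 2) * p.2.2 ^ 2 * h p.1) * dv (d := d) p a) * dv (d := d) p b
      + γ.inner p.1 (dpr (d := d) p a) (dpr (d := d) p b) := rfl
  rw [e, dv_apply, dv_apply, du_apply, du_apply, dpr_apply, dpr_apply]

theorem coordTensor_nhgMetric (p : NHGSpace S) {z : Ed × (ℝ × ℝ)}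
    (hz : z.1 ∈ (extChartAt (𝓡 d) p.1).target) (a b : Ed × (ℝ × ℝ)) :
    coordTensor (nhgMetric γ s h) p z a b = nhgForm (coordForm (fun x ↦ γ.inner x) p.1)
      (coordCovec s.toFun p.1) (h ∘ (extChartAt (𝓡 d) p.1).symm) z a b := by
  unfold coordTensor
  have ea := mfderiv_nhg_symm_apply hz a
  have eb := mfderiv_nhg_symm_apply hz b
  rw [extChartAt_nhg_symm_apply]
  refine (congrArg₂ (fun a b : Ed × (ℝ × ℝ) ↦ nhgMetric γ s h
    ((extChartAt (𝓡 d) p.1).symm z.1, z.2) a b) ea eb).trans ?_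
  exact nhgMetric_apply γ s h ((extChartAt (𝓡 d) p.1).symm z.1, z.2) _ _

/-- The components of a vector field on the near horizon geometry. -/
theorem coordField_nhg (X : VField (nhgModel d) (NHGSpace S)) (p : NHGSpace S)
    {z : Ed × (ℝ × ℝ)} (hz : z.1 ∈ (extChartAt (𝓡 d) p.1).target) :
    coordField X p z = ((mfderiv (𝓡 d) 𝓘(ℝ, Ed) (extChartAt (𝓡 d) p.1)
      ((extChartAt (𝓡 d) p.1).symm z.1)
      (show Ed from (show Ed × (ℝ × ℝ) from X ((extChartAt (𝓡 d) p.1).symm z.1, z.2)).1) : Ed),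
      (show Ed × (ℝ × ℝ) from X ((extChartAt (𝓡 d) p.1).symm z.1, z.2)).2) := by
  unfold coordField
  rw [extChartAt_nhg_symm_apply]
  exact mfderiv_nhg_apply (p := p) (q := ((extChartAt (𝓡 d) p.1).symm z.1, z.2))
    ((extChartAt (𝓡 d) p.1).map_target hz) _

theorem coordLieDeriv_nhgMetric (X : VField (nhgModel d) (NHGSpace S)) (p : NHGSpace S)
    {z : Ed × (ℝ × ℝ)} (hz : z.1 ∈ (extChartAt (𝓡 d) p.1).target) (a b : Ed × (ℝ × ℝ)) :
    coordLieDeriv (nhgMetric γ s h) X p z a b = lieForm (nhgForm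
      (coordForm (fun x ↦ γ.inner x) p.1) (coordCovec s.toFun p.1)
      (h ∘ (extChartAt (𝓡 d) p.1).symm)) (coordField X p) z a b := by
  have he : (fun z ↦ coordTensor (nhgMetric γ s h) p z a b) =ᶠ[𝓝 z] fun z ↦ nhgForm
      (coordForm (fun x ↦ γ.inner x) p.1) (coordCovec s.toFun p.1)
      (h ∘ (extChartAt (𝓡 d) p.1).symm) z a b := by
    have : ∀ᶠ z' : Ed × (ℝ × ℝ) in 𝓝 z, z'.1 ∈ (extChartAt (𝓡 d) p.1).target :=
      continuousAt_fst.eventually ((isOpen_extChartAt_target (I := 𝓡 d) p.1).mem_nhds hz)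
    filter_upwards [this] with z' hz' using coordTensor_nhgMetric γ s h p hz' a b
  unfold coordLieDeriv lieForm
  rw [he.fderiv_eq, coordTensor_nhgMetric γ s h p hz, coordTensor_nhgMetric γ s h p hz]

end ProductChart

/-! ### The horizon -/

section Horizon

theorem coordCovec_chart_apply {E : Type*} [NormedAddCommGroup E] [NormedSpace ℝ E]
    {H : Type*} [TopologicalSpace H] {I : ModelWithCorners ℝ E H} [I.Boundaryless]
    {M : Type*} [TopologicalSpace M] [ChartedSpace H M] [IsManifold I 1 M]
    (α : ∀ p : M, TangentSpace I p →L[ℝ] ℝ) (x : M) {q : M} (hq : q ∈ (extChartAt I x).source)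
    (w : TangentSpace I q) :
    coordCovec α x (extChartAt I x q) (mfderiv I 𝓘(ℝ, E) (extChartAt I x) q w) = α q w := by
  obtain ⟨y, hy, rfl⟩ : ∃ y ∈ (extChartAt I x).target, (extChartAt I x).symm y = q :=
    ⟨_, (extChartAt I x).map_source hq, (extChartAt I x).left_inv hq⟩
  rw [(extChartAt I x).right_inv hy]
  exact congrArg (α _) (mfderiv_symm_chart_apply hy w)

theorem field_ext_of_coordField {E : Type*} [NormedAddCommGroup E] [NormedSpace ℝ E]
    {H : Type*} [TopologicalSpace H] {I : ModelWithCorners ℝ E H} [I.Boundaryless]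
    {M : Type*} [TopologicalSpace M] [ChartedSpace H M] [IsManifold I 1 M]
    {X Y : VField I M} (x : M) {q : M} (hq : q ∈ (extChartAt I x).source)
    (h : coordField X x (extChartAt I x q) = coordField Y x (extChartAt I x q)) : X q = Y q := by
  obtain ⟨y, hy, rfl⟩ : ∃ y ∈ (extChartAt I x).target, (extChartAt I x).symm y = q :=
    ⟨_, (extChartAt I x).map_source hq, (extChartAt I x).left_inv hq⟩
  rw [(extChartAt I x).right_inv hy] at h
  have := congrArg (mfderiv 𝓘(ℝ, E) I (extChartAt I x).symm y) h
  exact (mfderiv_symm_chart_apply hy _).symm.trans (this.trans (mfderiv_symm_chart_apply hy _))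

variable {d : ℕ} {S : Type*} [TopologicalSpace S] [ChartedSpace (EuclideanSpace ℝ (Fin d)) S]
  [IsManifold (𝓡 d) ∞ S] {γ : RMetric d S} {s : OneForm d S} {h : S → ℝ}

local notation "Ed" => EuclideanSpace ℝ (Fin d)

theorem isLocalDefiningFunction_u {V : Set (NHGSpace S)} (hV : IsOpen V) {p : NHGSpace S}
    (hp : p ∈ V) : IsLocalDefiningFunction (nhgModel d) (horizon S ∩ V) p V (fun q ↦ q.2.2) := by
  refine ⟨hV, hp, ?_, fun q _ h0 ↦ ?_, ?_⟩
  · have h2 : ContMDiff (nhgModel d) 𝓘(ℝ, ℝ × ℝ) ∞ (Prod.snd : NHGSpace S → ℝ × ℝ) :=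
      contMDiff_snd
    have h1 : ContMDiff 𝓘(ℝ, ℝ × ℝ) 𝓘(ℝ, ℝ) ∞ (Prod.snd : ℝ × ℝ → ℝ) := contDiff_snd.contMDiff
    exact (h1.comp h2).contMDiffOn
  · have e := du_apply (d := d) q ((0, (0, 1)) : Ed × (ℝ × ℝ))
    have e' : du (d := d) q = 0 := h0
    rw [e'] at e
    exact zero_ne_one e
  · ext q
    simp only [horizon, mem_inter_iff, mem_ofPred_eq]
    tauto

/-- Vectors tangent to a hypersurface contained in the horizon are tangent to the horizon. -/
theorem du_eq_zero_of_isLocalDefiningFunction {N U : Set (NHGSpace S)} {F : NHGSpace S → ℝ}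
    {p : NHGSpace S} (hN : N ⊆ horizon S) (hp : p ∈ N)
    (hF : IsLocalDefiningFunction (nhgModel d) N p U F) {w : Ed × (ℝ × ℝ)}
    (hw : mfderiv (nhgModel d) 𝓘(ℝ, ℝ) F p w = 0) : w.2.2 = 0 := by
  set φ := extChartAt (nhgModel d) p with hφ
  have hy : φ p ∈ φ.target := mem_extChartAt_target p
  have hinv : φ.symm (φ p) = p := extChartAt_to_inv p
  have hFp : ContMDiffAt (nhgModel d) 𝓘(ℝ, ℝ) ∞ F p :=
    hF.smooth.contMDiffAt (hF.isOpen.mem_nhds hF.mem)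
  have hFs : ContDiffAt ℝ ∞ (F ∘ φ.symm) (φ p) := by
    rw [← hinv] at hFp
    exact (hFp.comp (φ p) (contMDiffAt_symm hy)).contDiffAt
  have hstrict := hFs.hasStrictFDerivAt (by simp)
  have hu : HasStrictFDerivAt (fun z : Ed × (ℝ × ℝ) ↦ z.2.2)
      ((ContinuousLinearMap.snd ℝ ℝ ℝ).comp (ContinuousLinearMap.snd ℝ Ed (ℝ × ℝ))) (φ p) :=
    ((ContinuousLinearMap.snd ℝ ℝ ℝ).comp (ContinuousLinearMap.snd ℝ Ed (ℝ × ℝ))).hasStrictFDerivAt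
  have hF0 : F p = 0 := by
    have : p ∈ N ∩ U := ⟨hp, hF.mem⟩
    rw [hF.inter_eq] at this
    exact this.2
  -- Lagrange multipliers replace the implicit function theorem: `u` vanishes on `{F = 0}` near `p`,
  -- hence is extremal there, and `a dF + b du = 0`. Since `dF ≠ 0`, `b` cannot be zero, so `dF(w) =
  -- 0` implies `du(w) = 0`.
  have hext : IsLocalExtrOn (fun z : Ed × (ℝ × ℝ) ↦ z.2.2)
      {z | (F ∘ φ.symm) z = (F ∘ φ.symm) (φ p)} (φ p) := by
    refine Or.inl ?_
    have hcont : ContinuousAt φ.symm (φ p) := continuousAt_extChartAt_symm p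
    have hU : ∀ᶠ z in 𝓝 (φ p), φ.symm z ∈ U :=
      hcont.eventually (by rw [hinv]; exact hF.isOpen.mem_nhds hF.mem)
    have key (z : Ed × (ℝ × ℝ)) (hz : φ.symm z ∈ U) (hz0 : F (φ.symm z) = 0) : z.2.2 = 0 := by
      have : φ.symm z ∈ N ∩ U := by
        rw [hF.inter_eq]
        exact ⟨hz, hz0⟩
      have h0 : (φ.symm z).2.2 = 0 := hN this.1
      rwa [hφ, extChartAt_nhg_symm_apply] at h0
    have h0 := key (φ p) hU.self_of_nhds (by rw [hinv, hF0])
    filter_upwards [nhdsWithin_le_nhds hU, self_mem_nhdsWithin] with z hz hz0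
    have hz0' : F (φ.symm z) = 0 := by
      have : F (φ.symm z) = F (φ.symm (φ p)) := hz0
      rw [this, hinv, hF0]
    exact (h0.trans (key z hz hz0').symm).le
  obtain ⟨a, b, hab, hmul⟩ := hext.exists_multipliers_of_hasStrictFDerivAt_1d hstrict hu
  set α : ∀ p : NHGSpace S, TangentSpace (nhgModel d) p →L[ℝ] ℝ :=
    fun p ↦ mfderiv (nhgModel d) 𝓘(ℝ, ℝ) F p with hα
  have hder : fderiv ℝ (F ∘ φ.symm) (φ p) = coordCovec α p (φ p) :=
    fderiv_comp_symm (by rw [← hφ, hinv]; exact hFp.mdifferentiableAt (by simp)) hy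
  have key (w : Ed × (ℝ × ℝ)) : a * α p w + b * w.2.2 = 0 := by
    have h1 := congrArg (fun L ↦ L (mfderiv (nhgModel d) 𝓘(ℝ, Ed × (ℝ × ℝ)) φ p w)) hmul
    have h2 := congrArg (fun q : Ed × (ℝ × ℝ) ↦ q.2.2) (mfderiv_nhg_apply (p := p) (q := p)
      (mem_extChartAt_source (I := 𝓡 d) p.1) w)
    rw [hder] at h1
    have h3 : a * coordCovec α p (φ p) (mfderiv (nhgModel d) 𝓘(ℝ, Ed × (ℝ × ℝ)) φ p w)
        + b * (mfderiv (nhgModel d) 𝓘(ℝ, Ed × (ℝ × ℝ)) φ p w : Ed × (ℝ × ℝ)).2.2 = 0 := h1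
    have h4 := coordCovec_chart_apply (I := nhgModel d) α p
      (mem_extChartAt_source (I := nhgModel d) p) w
    exact (congrArg₂ (fun t r ↦ a * t + b * r) h4 h2).symm.trans h3
  by_cases hb : b = 0
  · refine absurd ?_ (hF.regular p hF.mem)
    have ha : a ≠ 0 := by
      rintro rfl
      exact hab (by rw [hb]; rfl)
    refine ContinuousLinearMap.ext fun w ↦ ?_
    have := key w
    rw [hb, zero_mul, add_zero] at this
    exact (mul_eq_zero.1 this).resolve_left ha
  · have := key w
    have hw' : α p w = 0 := hw
    rw [hw', mul_zero, zero_add] at this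
    exact (mul_eq_zero.1 this).resolve_left hb

theorem TangentTo.du_eq_zero {N : Set (NHGSpace S)} {p : NHGSpace S} (hN : N ⊆ horizon S)
    (hp : p ∈ N) {w : Ed × (ℝ × ℝ)} (hw : TangentTo (nhgModel d) N p w) : w.2.2 = 0 := by
  obtain ⟨U, F, hF, h0⟩ := hw
  exact du_eq_zero_of_isLocalDefiningFunction hN hp hF h0

theorem tangentTo_horizon_inter {V : Set (NHGSpace S)} (hV : IsOpen V) {p : NHGSpace S}
    (hp : p ∈ V) {w : Ed × (ℝ × ℝ)} (hw : w.2.2 = 0) :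
    TangentTo (nhgModel d) (horizon S ∩ V) p w :=
  ⟨V, _, isLocalDefiningFunction_u hV hp, (du_apply (d := d) p w).trans hw⟩

/-- The open set `V` allows the zeros of a Killing vector to be cut out of the horizon. The
degenerate direction is `∂_v`. -/
theorem isNullHypersurface_horizon_inter {V : Set (NHGSpace S)} (hV : IsOpen V) :
    IsNullHypersurface (nhgMetric γ s h) (horizon S ∩ V) := by
  refine ⟨fun p hp ↦ ⟨V, _, isLocalDefiningFunction_u hV hp.2⟩, fun p hp ↦ ?_⟩
  have hu : p.2.2 = 0 := hp.1
  refine ⟨((0, (1, 0)) : Ed × (ℝ × ℝ)), fun h0 ↦ ?_, tangentTo_horizon_inter hV hp.2 rfl,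
    fun w hw ↦ ?_⟩
  · exact one_ne_zero (congrArg (fun q : Ed × (ℝ × ℝ) ↦ q.2.1) h0)
  · have hw0 := TangentTo.du_eq_zero (d := d) inter_subset_left hp hw
    have := nhgMetric_apply γ s h p ((0, (1, 0)) : Ed × (ℝ × ℝ)) w
    rw [hu] at this
    refine this.trans ?_
    have e0 : γ.inner p.1 (0 : TangentSpace (𝓡 d) p.1) = 0 := map_zero _
    have e1 : γ.inner p.1 (0 : TangentSpace (𝓡 d) p.1) ((w : Ed × (ℝ × ℝ)).1) = 0 := by
      rw [e0]; rfl
    refine (congrArg (fun t ↦ _ + t) e1).trans ?_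
    simp [hw0]

theorem isNullHypersurface_horizon : IsNullHypersurface (nhgMetric γ s h) (horizon S) := by
  have := isNullHypersurface_horizon_inter (γ := γ) (s := s) (h := h) (V := univ) isOpen_univ
  rwa [inter_univ] at this

theorem isClosed_horizon : IsClosed (horizon S) :=
  isClosed_eq (continuous_snd.comp continuous_snd) continuous_const

theorem isConnected_horizon [ConnectedSpace S] : IsConnected (horizon S) := by
  have : horizon S = range (fun q : S × ℝ ↦ ((q.1, (q.2, 0)) : NHGSpace S)) := by
    ext ⟨x, v, u⟩
    simp [horizon, eq_comm]
  rw [this]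
  exact isConnected_range (by fun_prop)

theorem hypersurfaceInterior_horizon :
    hypersurfaceInterior (nhgModel d) (horizon S) = horizon S := by
  ext p
  refine ⟨fun hp ↦ hp.1, fun hp ↦ ⟨hp, univ, isOpen_univ, mem_univ p, fun q _ ↦ ?_⟩⟩
  exact ⟨univ, _, isLocalDefiningFunction_u isOpen_univ (mem_univ q)⟩

end Horizon

/-! ### The Killing vectors defined by potentials -/

section KillingLift

variable {d : ℕ} {S : Type*} [TopologicalSpace S] [ChartedSpace (EuclideanSpace ℝ (Fin d)) S]
  [IsManifold (𝓡 d) ∞ S] {γ : RMetric d S} {s : OneForm d S} {h : S → ℝ}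

local notation "Ed" => EuclideanSpace ℝ (Fin d)

variable (γ s) in
/-- The vector field `(c v + f) ∂_v - u ∇f + (-u c + u² s(∇f)) ∂_u`. -/
def killingLift (c : ℝ) (f : S → ℝ) : VField (nhgModel d) (NHGSpace S) := fun p ↦
  (show Ed × (ℝ × ℝ) from (-p.2.2 • (show Ed from grad γ f p.1),
    (c * p.2.1 + f p.1, -p.2.2 * c + p.2.2 ^ 2 * s.toFun p.1 (grad γ f p.1))))

theorem killingLift_zero : killingLift γ s 0 0 = 0 := by
  have hg : grad γ (0 : S → ℝ) = 0 := grad_const γ 0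
  funext p
  have hgp : grad γ (0 : S → ℝ) p.1 = 0 := congrFun hg p.1
  refine Prod.ext ?_ (Prod.ext ?_ ?_)
  · exact (congrArg (fun w : Ed ↦ -p.2.2 • w) hgp).trans (smul_zero (A := Ed) (-p.2.2))
  · exact (add_zero _).trans (zero_mul _)
  · refine (congrArg (fun w : TangentSpace (𝓡 d) p.1 ↦
      -p.2.2 * 0 + p.2.2 ^ 2 * s.toFun p.1 w) hgp).trans ?_
    rw [map_zero, mul_zero, mul_zero, add_zero]
    rfl

theorem coordField_killingLift (c : ℝ) (f : S → ℝ) (p : NHGSpace S) {z : Ed × (ℝ × ℝ)}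
    (hz : z.1 ∈ (extChartAt (𝓡 d) p.1).target) :
    coordField (killingLift γ s c f) p z =
      liftForm (fun q ↦ c * q.2 + (f ∘ (extChartAt (𝓡 d) p.1).symm) q.1) (fun _ ↦ c)
        (fun q ↦ coordCovec s.toFun p.1 q.1 (coordField (grad γ f) p.1 q.1))
        (fun q ↦ coordField (grad γ f) p.1 q.1) z := by
  refine (coordField_nhg _ p hz).trans (Prod.ext ?_ (Prod.ext rfl ?_))
  · exact map_smul (mfderiv (𝓡 d) 𝓘(ℝ, Ed) (extChartAt (𝓡 d) p.1)
      ((extChartAt (𝓡 d) p.1).symm z.1)) (-z.2.2) _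
  · exact congrArg (fun t ↦ -z.2.2 * c + z.2.2 ^ 2 * t)
      (coordCovec_coordField s.toFun (grad γ f) p.1 hz).symm

theorem eventually_mem_target_nhg (p : NHGSpace S) {z : Ed × (ℝ × ℝ)}
    (hz : z.1 ∈ (extChartAt (𝓡 d) p.1).target) :
    ∀ᶠ z' : Ed × (ℝ × ℝ) in 𝓝 z, z'.1 ∈ (extChartAt (𝓡 d) p.1).target :=
  continuousAt_fst.eventually (eventually_mem_target p.1 hz)

theorem IsPotential.isKilling_killingLift {f : S → ℝ} (hf : IsPotential γ s h f)
    (hh : ContMDiff (𝓡 d) 𝓘(ℝ, ℝ) ∞ h) (c : ℝ) :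
    IsKilling (nhgMetric γ s h) (killingLift γ s c f) := by
  have heq (p : NHGSpace S) (z : Ed × (ℝ × ℝ)) (hz : z.1 ∈ (extChartAt (𝓡 d) p.1).target) :
      coordField (killingLift γ s c f) p =ᶠ[𝓝 z]
        liftForm (fun q ↦ c * q.2 + (f ∘ (extChartAt (𝓡 d) p.1).symm) q.1) (fun _ ↦ c)
        (fun q ↦ coordCovec s.toFun p.1 q.1 (coordField (grad γ f) p.1 q.1))
        (fun q ↦ coordField (grad γ f) p.1 q.1) := by
    filter_upwards [eventually_mem_target_nhg p hz] with z hz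
      using coordField_killingLift c f p hz
  refine ⟨smoothField_iff_chart.2 fun p z hz ↦ ?_, fun p z hz A B ↦ ?_⟩
  · have hz := mem_target_nhg.1 hz
    refine ContDiffAt.congr_of_eventuallyEq ?_ (heq p z hz)
    have hg := isGradient_coord γ hf.smooth p.1 hz
    have h1 : ContDiffAt ℝ ∞ (fun z : Ed × (ℝ × ℝ) ↦ z.1) z := contDiffAt_fst
    have hv : ContDiffAt ℝ ∞ (fun z : Ed × (ℝ × ℝ) ↦ z.2.1) z := contDiffAt_snd.fst
    have hu : ContDiffAt ℝ ∞ (fun z : Ed × (ℝ × ℝ) ↦ z.2.2) z := contDiffAt_snd.snd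
    have hZ : ContDiffAt ℝ ∞ (fun z : Ed × (ℝ × ℝ) ↦ coordField (grad γ f) p.1 z.1) z :=
      ContDiffAt.comp z (f := fun z : Ed × (ℝ × ℝ) ↦ z.1) hg.smooth_Z h1
    have hσ : ContDiffAt ℝ ∞ (fun z : Ed × (ℝ × ℝ) ↦ coordCovec s.toFun p.1 z.1) z :=
      ContDiffAt.comp z (f := fun z : Ed × (ℝ × ℝ) ↦ z.1) (contDiffAt_s s p.1 hz) h1
    have hfc : ContDiffAt ℝ ∞ (fun z : Ed × (ℝ × ℝ) ↦ (f ∘ (extChartAt (𝓡 d) p.1).symm) z.1) z :=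
      ContDiffAt.comp z (f := fun z : Ed × (ℝ × ℝ) ↦ z.1) hg.smooth_f h1
    exact (hu.neg.smul hZ).prodMk (((contDiffAt_const.mul hv).add hfc).prodMk
      ((hu.neg.mul contDiffAt_const).add ((hu.pow 2).mul (hσ.clm_apply hZ))))
  · have hz := mem_target_nhg.1 hz
    rw [coordLieDeriv_nhgMetric γ s h _ p hz]
    have := lieForm_nhgForm_lift_eq_zero (isGradient_coord γ hf.smooth p.1 hz)
      (contDiffAt_s s p.1 hz) (contDiffAt_coord hh p.1 hz) (hf.hessian p.1 _ hz)
      (hf.torsion p.1 _ hz) (hf.scalar p.1 _ hz) c z.2 A B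
    unfold lieForm at this ⊢
    rw [(heq p z hz).fderiv_eq, (heq p z hz).eq_of_nhds]
    exact this

variable (d) in
theorem diff_eq_zero_of_eventuallyEq {f : S → ℝ} {x : S} {c : ℝ} (h0 : ∀ᶠ y in 𝓝 x, f y = c) :
    diff (d := d) f x = 0 := by
  have : f =ᶠ[𝓝 x] fun _ ↦ c := h0
  unfold diff
  rw [this.mfderiv_eq, mfderiv_const]
  rfl

theorem IsPotential.killingLift_mem [ConnectedSpace S] {f : S → ℝ} (hf : IsPotential γ s h f)
    (hh : ContMDiff (𝓡 d) 𝓘(ℝ, ℝ) ∞ h) (c : ℝ) :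
    killingLift γ s c f ∈ killingGenerators (nhgMetric γ s h) (horizon S) := by
  by_cases h0 : c = 0 ∧ f = 0
  · refine Or.inl ?_
    obtain ⟨rfl, rfl⟩ := h0
    exact killingLift_zero
  · set V : Set (NHGSpace S) := {p | c * p.2.1 + f p.1 ≠ 0} with hVdef
    have hfc : Continuous f := hf.smooth.continuous
    have hV : IsOpen V := isOpen_ne_fun (by fun_prop) continuous_const
    -- If `c v + f` vanished on an open piece of the horizon, varying `v` would give `c = 0`, and
    -- then `f` would have zero 1-jet at a point and vanish identically.
    have hcl : closure (horizon S ∩ V) = horizon S := by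
      refine subset_antisymm (closure_minimal inter_subset_left isClosed_horizon) fun p hp ↦ ?_
      by_contra hcon
      have hev : ∀ᶠ q in 𝓝 p, q ∉ horizon S ∩ V := by
        have := isClosed_closure.isOpen_compl.mem_nhds hcon
        filter_upwards [this] with q hq hq' using hq (subset_closure hq')
      obtain ⟨x, v, u⟩ := p
      have hu : u = 0 := hp
      subst hu
      have hev' : ∀ᶠ q : S × ℝ in 𝓝 (x, v), c * q.2 + f q.1 = 0 := by
        have hc : ContinuousAt (fun q : S × ℝ ↦ ((q.1, (q.2, 0)) : NHGSpace S)) (x, v) := by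
          fun_prop
        filter_upwards [hc.eventually hev] with q hq
        by_contra hne
        exact hq ⟨rfl, hne⟩
      have hevx : ∀ᶠ y in 𝓝 x, f y = -(c * v) := by
        have hc : ContinuousAt (fun y : S ↦ (y, v)) x := by fun_prop
        filter_upwards [hc.eventually hev'] with y hy
        linarith
      have hevv : ∀ᶠ t in 𝓝 v, c * t + f x = 0 := by
        have hc : ContinuousAt (fun t : ℝ ↦ (x, t)) v := by fun_prop
        exact hc.eventually hev'
      have hc0 : c = 0 := by
        have h1 : HasDerivAt (fun t : ℝ ↦ c * t + f x) (c * 1) v :=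
          ((hasDerivAt_id v).const_mul c).add_const (f x)
        have h2 : (fun t : ℝ ↦ c * t + f x) =ᶠ[𝓝 v] fun _ ↦ 0 := hevv
        have := h1.unique ((hasDerivAt_const v (0 : ℝ)).congr_of_eventuallyEq h2)
        linarith
      refine h0 ⟨hc0, hf.eq_zero (x₁ := x) ?_ (diff_eq_zero_of_eventuallyEq d hevx)⟩
      have := hevx.self_of_nhds
      rw [this, hc0]
      ring
    refine Or.inr ⟨horizon S ∩ V, ⟨hf.isKilling_killingLift hh c,
      isNullHypersurface_horizon_inter hV, fun p hp ↦ ?_, fun p hp h0 ↦ ?_, fun p hp ↦ ?_,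
      fun _ ↦ ?_⟩, by rw [hcl, isClosed_horizon.closure_eq]⟩
    · have hu : p.2.2 = 0 := hp.1
      have e : (show Ed × (ℝ × ℝ) from killingLift γ s c f p) = (0, (c * p.2.1 + f p.1, 0)) := by
        refine Prod.ext ?_ (Prod.ext rfl ?_)
        · refine (congrArg (fun t : ℝ ↦ -t • (show Ed from grad γ f p.1)) hu).trans ?_
          rw [neg_zero]
          exact zero_smul ℝ (show Ed from grad γ f p.1)
        · simp [killingLift, hu]
      refine (congrArg (fun w : Ed × (ℝ × ℝ) ↦ nhgMetric γ s h p w w) e).trans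
        ((nhgMetric_apply γ s h p _ _).trans ?_)
      have e0 : γ.inner p.1 (0 : TangentSpace (𝓡 d) p.1) = 0 := map_zero _
      have e1 : γ.inner p.1 (0 : TangentSpace (𝓡 d) p.1) (0 : TangentSpace (𝓡 d) p.1) = 0 := by
        rw [e0]; rfl
      refine (congrArg (fun t ↦ _ + t) e1).trans ?_
      simp [hu]
    · exact hp.2 (congrArg (fun q : Ed × (ℝ × ℝ) ↦ q.2.1) h0)
    · have hu : p.2.2 = 0 := hp.1
      refine tangentTo_horizon_inter hV hp.2 ?_
      simp [killingLift, hu]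
    · rw [hcl, hypersurfaceInterior_horizon]
      exact ⟨isNullHypersurface_horizon (γ := γ) (s := s) (h := h).1, isConnected_horizon⟩

end KillingLift

/-! ### Killing vectors with the given horizon -/

section Forward

section Congr

variable {E : Type*} [NormedAddCommGroup E] [NormedSpace ℝ E]
  {G : E → E →L[ℝ] E →L[ℝ] ℝ} {σ : E → E →L[ℝ] ℝ} {η : E → ℝ} {f g : E → ℝ} {Z W : E → E}
  {y : E}

theorem HessianEq.congr (h : HessianEq G σ f Z y) (hf : g =ᶠ[𝓝 y] f) (hZ : W =ᶠ[𝓝 y] Z) :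
    HessianEq G σ g W y := by
  intro a b
  have := h a b
  unfold lieForm at this ⊢
  rwa [hf.fderiv_eq, hZ.fderiv_eq, hZ.eq_of_nhds]

theorem TorsionEq.congr (h : TorsionEq σ η f Z y) (hf : g =ᶠ[𝓝 y] f) (hZ : W =ᶠ[𝓝 y] Z) :
    TorsionEq σ η g W y := by
  intro b
  have e : (fun z ↦ σ z (W z)) =ᶠ[𝓝 y] fun z ↦ σ z (Z z) := by
    filter_upwards [hZ] with z hz
    rw [hz]
  rw [hf.fderiv_eq, hZ.fderiv_eq, hZ.eq_of_nhds, e.fderiv_eq]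
  exact h b

theorem ScalarEq.congr (h : ScalarEq σ η Z y) (hZ : W y = Z y) : ScalarEq σ η W y := by
  unfold ScalarEq at *
  rwa [hZ]

end Congr

variable {d : ℕ} {S : Type*} [TopologicalSpace S] [ChartedSpace (EuclideanSpace ℝ (Fin d)) S]
  [IsManifold (𝓡 d) ∞ S] {γ : RMetric d S} {s : OneForm d S} {h : S → ℝ}

local notation "Ed" => EuclideanSpace ℝ (Fin d)

theorem coordField_continuousAt {X : VField (nhgModel d) (NHGSpace S)} (hX : SmoothField X)
    (p : NHGSpace S) :
    ContinuousAt (fun q ↦ coordField X p (extChartAt (nhgModel d) p q)) p :=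
  ContinuousAt.comp (g := coordField X p)
    (smoothField_iff_chart.1 hX p _ (mem_extChartAt_target p)).continuousAt
    (continuousAt_extChartAt p)

/-- A Killing vector with horizon dense in `{u = 0}` is a multiple of `∂_v` on `{u = 0}`. -/
theorem IsKillingHorizon.eq_on_horizon {X : VField (nhgModel d) (NHGSpace S)}
    {N : Set (NHGSpace S)} (hX : IsKillingHorizon (nhgMetric γ s h) X N)
    (hN : closure N = closure (horizon S)) {p : NHGSpace S} (hp : p ∈ horizon S) :
    (X p : Ed × (ℝ × ℝ)).1 = 0 ∧ (X p : Ed × (ℝ × ℝ)).2.2 = 0 := by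
  rw [isClosed_horizon.closure_eq] at hN
  have hsub : N ⊆ horizon S := hN ▸ subset_closure
  have honN (q : NHGSpace S) (hq : q ∈ N) :
      (X q : Ed × (ℝ × ℝ)).1 = 0 ∧ (X q : Ed × (ℝ × ℝ)).2.2 = 0 := by
    -- Tangency kills the `∂_u` component; at `u = 0` the null condition then reduces to `γ(X, X) =
    -- 0` for the cut component.
    have h2 := TangentTo.du_eq_zero hsub hq (hX.tangent q hq)
    have hu : q.2.2 = 0 := hsub hq
    have h0 := (nhgMetric_apply γ s h q (X q) (X q)).symm.trans (hX.null q hq)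
    rw [hu, h2] at h0
    refine ⟨?_, h2⟩
    by_contra hne
    have := γ.pos q.1 (show Ed from (X q : Ed × (ℝ × ℝ)).1) hne
    simp only [mul_zero, zero_mul, zero_add, ne_eq, OfNat.ofNat_ne_zero, not_false_eq_true,
      zero_pow] at h0
    exact this.ne' h0
  set φ := fun q ↦ coordField X p (extChartAt (nhgModel d) p q) with hφ
  have hφq (q : NHGSpace S) (hq : q ∈ (extChartAt (nhgModel d) p).source) :
      φ q = ((mfderiv (𝓡 d) 𝓘(ℝ, Ed) (extChartAt (𝓡 d) p.1) q.1
        (show Ed from (show Ed × (ℝ × ℝ) from X q).1) : Ed), (show Ed × (ℝ × ℝ) from X q).2) := by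
    have := mfderiv_nhg_apply (p := p) (q := q) (by
      rw [extChartAt_nhg] at hq
      exact hq.1) (X q)
    refine Eq.trans ?_ this
    simp only [hφ, coordField]
    rw [(extChartAt (nhgModel d) p).left_inv hq]
  have hcont := coordField_continuousAt hX.killing.1 p
  have hfreq : ∃ᶠ q in 𝓝 p, q ∈ N := mem_closure_iff_frequently.1 (hN ▸ hp)
  have hsrc := extChartAt_source_mem_nhds (I := nhgModel d) p
  -- Passage from `N` to its closure: in a fixed chart the components are continuous, and points of
  -- `N` accumulate at `p`.
  have hp0 : (φ p).1 = 0 ∧ (φ p).2.2 = 0 := by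
    constructor
    · by_contra hne
      have h1 : ContinuousAt (fun q ↦ (φ q).1) p := continuousAt_fst.comp hcont
      refine hfreq ?_
      filter_upwards [h1.eventually_ne hne, hsrc] with q hq1 hq2 hq3
      refine hq1 ((congrArg Prod.fst (hφq q hq2)).trans ?_)
      exact (congrArg (mfderiv (𝓡 d) 𝓘(ℝ, Ed) (extChartAt (𝓡 d) p.1) q.1)
        (honN q hq3).1).trans (map_zero _)
    · by_contra hne
      have h1 : ContinuousAt (fun q ↦ (φ q).2.2) p :=
        continuousAt_snd.comp (continuousAt_snd.comp hcont)
      refine hfreq ?_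
      filter_upwards [h1.eventually_ne hne, hsrc] with q hq1 hq2 hq3
      exact hq1 ((congrArg (fun t : Ed × (ℝ × ℝ) ↦ t.2.2) (hφq q hq2)).trans (honN q hq3).2)
  have hpp := hφq p (mem_extChartAt_source p)
  refine ⟨?_, (congrArg (fun t : Ed × (ℝ × ℝ) ↦ t.2.2) hpp).symm.trans hp0.2⟩
  have h1 := (congrArg Prod.fst hpp).symm.trans hp0.1
  have hx := mem_extChartAt_target (I := 𝓡 d) p.1
  have hl := (extChartAt (𝓡 d) p.1).left_inv (mem_extChartAt_source (I := 𝓡 d) p.1)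
  have key : ∀ x : S, x ∈ (extChartAt (𝓡 d) p.1).source → ∀ w : Ed,
      (mfderiv (𝓡 d) 𝓘(ℝ, Ed) (extChartAt (𝓡 d) p.1) x w : Ed) = 0 → w = 0 := by
    intro x hx w hw
    obtain ⟨y, hy, rfl⟩ : ∃ y ∈ (extChartAt (𝓡 d) p.1).target,
      (extChartAt (𝓡 d) p.1).symm y = x :=
      ⟨_, (extChartAt (𝓡 d) p.1).map_source hx, (extChartAt (𝓡 d) p.1).left_inv hx⟩
    exact (mfderiv_symm_chart_apply hy w).symm.trans
      ((congrArg (mfderiv 𝓘(ℝ, Ed) (𝓡 d) (extChartAt (𝓡 d) p.1).symm y) hw).trans (map_zero _))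
  exact key p.1 (mem_extChartAt_source p.1) _ h1

theorem isChartKilling {X : VField (nhgModel d) (NHGSpace S)}
    (hh : ContMDiff (𝓡 d) 𝓘(ℝ, ℝ) ∞ h) (hX : IsKilling (nhgMetric γ s h) X)
    (h0 : ∀ p ∈ horizon S, (X p : Ed × (ℝ × ℝ)).1 = 0 ∧ (X p : Ed × (ℝ × ℝ)).2.2 = 0) (x : S) :
    IsChartKilling (coordForm (fun x ↦ γ.inner x) x) (coordCovec s.toFun x)
      (h ∘ (extChartAt (𝓡 d) x).symm) (extChartAt (𝓡 d) x).target
      (coordField X ((x, (0, 0)) : NHGSpace S)) := by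
  have hc := contMDiff_const (I := 𝓡 d) (I' := 𝓘(ℝ, ℝ)) (n := ∞) (M := S) (c := (0 : ℝ))
  have hg (y : Ed) (hy : y ∈ (extChartAt (𝓡 d) x).target) := isGradient_coord γ hc x hy
  refine ⟨isOpen_extChartAt_target x, fun y hy ↦ (hg y hy).smooth_G,
    fun y hy ↦ contDiffAt_s s x hy, fun y hy ↦ contDiffAt_coord hh x hy,
    fun y hy ↦ (hg y hy).symm.self_of_nhds, fun y hy ↦ (hg y hy).pos.self_of_nhds,
    fun y hy w ↦ ?_, fun y hy w A B ↦ ?_, fun y hy v ↦ ?_, fun y hy v ↦ ?_⟩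
  · exact smoothField_iff_chart.1 hX.1 _ _ (mem_target_nhg.2 hy)
  · rw [← hX.2 (x, (0, 0)) (y, w) (mem_target_nhg.2 hy) A B]
    exact (coordLieDeriv_nhgMetric γ s h X (x, (0, 0)) (z := (y, w)) hy A B).symm
  · refine (congrArg Prod.fst (coordField_nhg X (x, (0, 0)) (z := (y, (v, 0))) hy)).trans ?_
    exact (congrArg (mfderiv (𝓡 d) 𝓘(ℝ, Ed) (extChartAt (𝓡 d) x) ((extChartAt (𝓡 d) x).symm y))
      (h0 ((extChartAt (𝓡 d) x).symm y, (v, 0)) rfl).1).trans (map_zero _)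
  · exact (congrArg (fun t : Ed × (ℝ × ℝ) ↦ t.2.2)
      (coordField_nhg X (x, (0, 0)) (z := (y, (v, 0))) hy)).trans
      (h0 ((extChartAt (𝓡 d) x).symm y, (v, 0)) rfl).2

/-- The functions `f` and `k` are read off from the `∂_v` component at `v = 0` and `v = 1`, so they
are global on `S`. The chart analysis makes `f` a potential and gives `dk = 0`, so `k` is one
constant by connectedness. -/
theorem exists_eq_killingLift [ConnectedSpace S] {X : VField (nhgModel d) (NHGSpace S)}
    (hh : ContMDiff (𝓡 d) 𝓘(ℝ, ℝ) ∞ h) (hX : IsKilling (nhgMetric γ s h) X)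
    (h0 : ∀ p ∈ horizon S, (X p : Ed × (ℝ × ℝ)).1 = 0 ∧ (X p : Ed × (ℝ × ℝ)).2.2 = 0) :
    ∃ c f, IsPotential γ s h f ∧ X = killingLift γ s c f := by
  have hK := isChartKilling hh hX h0
  set f : S → ℝ := fun x ↦ (X ((x, (0, 0)) : NHGSpace S) : Ed × (ℝ × ℝ)).2.1 with hf
  set k : S → ℝ := fun x ↦ (X ((x, (1, 0)) : NHGSpace S) : Ed × (ℝ × ℝ)).2.1 - f x with hk
  have hv (x : S) {y : Ed} (hy : y ∈ (extChartAt (𝓡 d) x).target) (v : ℝ) :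
      vComp (coordField X ((x, (0, 0)) : NHGSpace S)) (y, v)
        = (X (((extChartAt (𝓡 d) x).symm y, (v, 0)) : NHGSpace S) : Ed × (ℝ × ℝ)).2.1 := by
    have := congrArg (fun t : Ed × (ℝ × ℝ) ↦ t.2.1)
      (coordField_nhg X (x, (0, 0)) (z := (y, (v, 0))) hy)
    exact this
  have hvf (x : S) {y : Ed} (hy : y ∈ (extChartAt (𝓡 d) x).target) :
      f ∘ (extChartAt (𝓡 d) x).symm
        =ᶠ[𝓝 y] fun z ↦ vComp (coordField X ((x, (0, 0)) : NHGSpace S)) (z, 0) := by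
    filter_upwards [eventually_mem_target x hy] with z hz using (hv x hz 0).symm
  have hvk (x : S) {y : Ed} (hy : y ∈ (extChartAt (𝓡 d) x).target) :
      k ∘ (extChartAt (𝓡 d) x).symm
        =ᶠ[𝓝 y] vSlope (coordField X ((x, (0, 0)) : NHGSpace S)) := by
    filter_upwards [eventually_mem_target x hy] with z hz
    exact (congrArg₂ (· - ·) (hv x hz 1) (hv x hz 0)).symm
  have hslice (x : S) {y : Ed} (hy : y ∈ (extChartAt (𝓡 d) x).target) (v : ℝ) :
      ContDiffAt ℝ ∞ (fun z ↦ vComp (coordField X ((x, (0, 0)) : NHGSpace S)) (z, v)) y :=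
    ContDiffAt.comp y (f := fun z : Ed ↦ (z, v)) ((hK x).contDiffAt_vComp hy v)
      (contDiffAt_id.prodMk contDiffAt_const)
  have hfs : ContMDiff (𝓡 d) 𝓘(ℝ, ℝ) ∞ f := contMDiff_iff_chart.2 fun x y hy ↦
    (hslice x hy 0).congr_of_eventuallyEq (hvf x hy)
  have hks : ContMDiff (𝓡 d) 𝓘(ℝ, ℝ) ∞ k := contMDiff_iff_chart.2 fun x y hy ↦
    ((hslice x hy 1).sub (hslice x hy 0)).congr_of_eventuallyEq (hvk x hy)
  have hkd (x : S) : diff (d := d) k x = 0 := by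
    have hx := mem_extChartAt_target (I := 𝓡 d) x
    have h1 := fderiv_coord hks x hx
    rw [(hvk x hx).fderiv_eq, (hK x).fderiv_vSlope hx] at h1
    have := (coordCovec_eq_zero_iff _ x hx).1 h1.symm
    rwa [extChartAt_to_inv] at this
  obtain ⟨x₁⟩ := ‹ConnectedSpace S›.toNonempty
  have hkc (x : S) : k x = k x₁ := eq_of_diff_eq_zero hks hkd x x₁
  have hZ (x : S) {y : Ed} (hy : y ∈ (extChartAt (𝓡 d) x).target) :
      coordField (grad γ f) x y = cutComp (coordField X ((x, (0, 0)) : NHGSpace S)) (y, 0) := by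
    refine (hK x).inner_injective hy fun b ↦ ?_
    rw [(isGradient_coord γ hfs x hy).grad.self_of_nhds,
      ((hK x).isGradient hy).grad.self_of_nhds, (hvf x hy).fderiv_eq]
  have hZe (x : S) {y : Ed} (hy : y ∈ (extChartAt (𝓡 d) x).target) :
      coordField (grad γ f) x =ᶠ[𝓝 y]
        fun z ↦ cutComp (coordField X ((x, (0, 0)) : NHGSpace S)) (z, 0) := by
    filter_upwards [eventually_mem_target x hy] with z hz using hZ x hz
  refine ⟨k x₁, f, ⟨hfs, fun x y hy ↦ ?_, fun x y hy ↦ ?_, fun x y hy ↦ ?_⟩, ?_⟩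
  · exact ((hK x).potentialEq hy).1.congr (hvf x hy) (hZe x hy)
  · exact ((hK x).potentialEq hy).2.1.congr (hvf x hy) (hZe x hy)
  · exact ((hK x).potentialEq hy).2.2.congr (hZ x hy)
  · funext p
    obtain ⟨x, v, u⟩ := p
    have hx := mem_extChartAt_target (I := 𝓡 d) x
    refine field_ext_of_coordField ((x, (0, 0)) : NHGSpace S) (by
      rw [extChartAt_nhg]
      exact ⟨mem_extChartAt_source x, mem_univ _⟩) ?_
    rw [extChartAt_nhg_apply]
    refine ((hK x).apply_eq hx v u).trans ?_
    refine Eq.trans ?_ (coordField_killingLift (γ := γ) (s := s) (k x₁) f (x, (0, 0))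
      (z := (extChartAt (𝓡 d) x x, (v, u))) hx).symm
    have e1 : vSlope (coordField X ((x, (0, 0)) : NHGSpace S)) (extChartAt (𝓡 d) x x) = k x₁ :=
      (hvk x hx).eq_of_nhds.symm.trans (hkc _)
    have e2 := (hvf x hx).eq_of_nhds
    simp only [liftForm, e1, hZ x hx, e2]

theorem exists_of_mem_killingGenerators [ConnectedSpace S]
    {X : VField (nhgModel d) (NHGSpace S)} (hh : ContMDiff (𝓡 d) 𝓘(ℝ, ℝ) ∞ h)
    (hX : X ∈ killingGenerators (nhgMetric γ s h) (horizon S)) :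
    ∃ c f, IsPotential γ s h f ∧ X = killingLift γ s c f := by
  obtain rfl | ⟨N, hN, hcl⟩ := hX
  · exact ⟨0, 0, isPotential_const γ s h 0, killingLift_zero.symm⟩
  · exact exists_eq_killingLift hh hN.killing fun p hp ↦ hN.eq_on_horizon hcl hp

end Forward

/-! ### Dimensions -/

section Dimension

/-- A map compatible with the operations `(c, f, g) ↦ c f + g` is linear. -/
def linearMapOfComb {V W : Type*} [AddCommGroup V] [Module ℝ V] [AddCommGroup W] [Module ℝ W]
    (φ : V → W) (hφ : ∀ (c : ℝ) f g, φ (c • f + g) = c • φ f + φ g) : V →ₗ[ℝ] W where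
  toFun := φ
  map_add' f g := by simpa using hφ 1 f g
  map_smul' c f := by
    have h0 : φ 0 = 0 := by simpa using hφ 1 0 0
    simpa [h0] using hφ c f 0

theorem IsSubspaceOfDim.unique {V : Type*} [AddCommGroup V] [Module ℝ V] {A : Set V} {m n : ℕ}
    (hm : IsSubspaceOfDim A m) (hn : IsSubspaceOfDim A n) : m = n := by
  obtain ⟨W, hW, -, rfl⟩ := hm
  obtain ⟨W', hW', -, rfl⟩ := hn
  rw [SetLike.coe_injective (hW.trans hW'.symm)]

variable {d : ℕ} {S : Type*} [TopologicalSpace S] [ChartedSpace (EuclideanSpace ℝ (Fin d)) S]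
  [IsManifold (𝓡 d) ∞ S] (γ : RMetric d S) (s : OneForm d S) (h : S → ℝ)

local notation "Ed" => EuclideanSpace ℝ (Fin d)

/-- The 1-jet of a potential at a point. -/
def potentialJet (x : S) : potentials γ s h →ₗ[ℝ] ℝ × (Ed →L[ℝ] ℝ) :=
  linearMapOfComb (fun f ↦ (f.1 x, (diff (d := d) f.1 x : Ed →L[ℝ] ℝ))) fun c f g ↦
    Prod.ext rfl (diff_comb f.2.smooth g.2.smooth c x)

theorem potentialJet_injective [PreconnectedSpace S] (x : S) :
    Function.Injective (potentialJet γ s h x) := by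
  refine (injective_iff_map_eq_zero _).2 fun f hf ↦ ?_
  exact Subtype.ext (f.2.eq_zero (congrArg Prod.fst hf) (congrArg Prod.snd hf))

theorem finiteDimensional_potentials [ConnectedSpace S] :
    FiniteDimensional ℝ (potentials γ s h) := by
  obtain ⟨x⟩ := ‹ConnectedSpace S›.toNonempty
  exact FiniteDimensional.of_injective _ (potentialJet_injective γ s h x)

theorem finrank_potentials_le [ConnectedSpace S] :
    Module.finrank ℝ (potentials γ s h) ≤ d + 1 := by
  obtain ⟨x⟩ := ‹ConnectedSpace S›.toNonempty
  refine (LinearMap.finrank_le_finrank_of_injective (potentialJet_injective γ s h x)).trans ?_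
  have h1 : Module.finrank ℝ (Ed →L[ℝ] ℝ) = d := by
    rw [← (LinearMap.toContinuousLinearMap (𝕜 := ℝ) (E := Ed) (F' := ℝ)).finrank_eq]
    exact Subspace.dual_finrank_eq.trans (by simp)
  rw [Module.finrank_prod, h1, Module.finrank_self, add_comm]

/-- The map `f ↦ μ ∇f`. -/
def scaledGrad (μ : S → ℝ) : potentials γ s h →ₗ[ℝ] VField (𝓡 d) S :=
  linearMapOfComb (fun f x ↦ μ x • grad γ f.1 x) fun c f g ↦ by
    have hc : grad γ ((c • f + g : potentials γ s h) : S → ℝ) = c • grad γ f.1 + grad γ g.1 :=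
      grad_comb γ f.2.smooth g.2.smooth c
    funext x
    refine (congrArg (μ x • ·) (congrFun hc x)).trans ?_
    refine (smul_add (μ x) (c • grad γ f.1 x) (grad γ g.1 x)).trans ?_
    exact congrArg (· + μ x • grad γ g.1 x) (smul_comm (μ x) c (grad γ f.1 x))

/-- Since `μ` has no zeros, the kernel is the potentials with zero gradient, which are the constants
on connected `S`. -/
theorem finrank_ker_scaledGrad [ConnectedSpace S] {μ : S → ℝ} (hμ : ∀ x, μ x ≠ 0) :
    Module.finrank ℝ (LinearMap.ker (scaledGrad γ s h μ)) = 1 := by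
  obtain ⟨x₁⟩ := ‹ConnectedSpace S›.toNonempty
  have hone : (⟨fun _ ↦ 1, isPotential_const γ s h 1⟩ : potentials γ s h)
      ∈ LinearMap.ker (scaledGrad γ s h μ) := by
    funext x
    exact (congrArg (μ x • ·) (congrFun (grad_const γ 1) x)).trans (smul_zero _)
  refine finrank_eq_one (⟨_, hone⟩ : LinearMap.ker (scaledGrad γ s h μ)) (fun h0 ↦ ?_)
    fun f ↦ ⟨f.1.1 x₁, ?_⟩
  · exact one_ne_zero (congrArg (fun f : LinearMap.ker (scaledGrad γ s h μ) ↦ f.1.1 x₁) h0)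
  · refine Subtype.ext (Subtype.ext (funext fun x ↦ ?_))
    have hd (x : S) : diff (d := d) f.1.1 x = 0 := by
      have h0 : μ x • grad γ f.1.1 x = 0 := congrFun f.2 x
      have h1 := (smul_eq_zero.1 h0).resolve_left (hμ x)
      rw [← inner_grad γ, h1, map_zero]
    refine Eq.trans ?_ (eq_of_diff_eq_zero f.1.2.smooth hd x x₁).symm
    exact mul_one _

/-- The map `(c, f) ↦ (c v + f) ∂_v + …` to the Killing vectors of the near horizon geometry. -/
def killingLiftMap : ℝ × potentials γ s h →ₗ[ℝ] VField (nhgModel d) (NHGSpace S) :=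
  linearMapOfComb (fun q ↦ killingLift γ s q.1 q.2.1) fun c q q' ↦ by
    have hc : grad γ ((c • q.2 + q'.2 : potentials γ s h) : S → ℝ)
        = c • grad γ q.2.1 + grad γ q'.2.1 :=
      grad_comb γ q.2.2.smooth q'.2.2.smooth c
    funext p
    have hcp : grad γ ((c • q.2 + q'.2 : potentials γ s h) : S → ℝ) p.1
        = c • grad γ q.2.1 p.1 + grad γ q'.2.1 p.1 := congrFun hc p.1
    refine Prod.ext ?_ (Prod.ext ?_ ?_)
    · refine (congrArg (fun w : Ed ↦ -p.2.2 • w) hcp).trans ?_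
      refine (smul_add (A := Ed) (-p.2.2) (c • grad γ q.2.1 p.1) (grad γ q'.2.1 p.1)).trans ?_
      exact congrArg (fun w : Ed ↦ w + -p.2.2 • (show Ed from grad γ q'.2.1 p.1))
        (smul_comm (α := Ed) (-p.2.2) c (grad γ q.2.1 p.1))
    · have e : (c * q.1 + q'.1) * p.2.1 + (c * q.2.1 p.1 + q'.2.1 p.1)
          = c * (q.1 * p.2.1 + q.2.1 p.1) + (q'.1 * p.2.1 + q'.2.1 p.1) := by ring
      exact e
    · have e : -p.2.2 * (c * q.1 + q'.1) + p.2.2 ^ 2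
          * s.toFun p.1 (grad γ ((c • q.2 + q'.2 : potentials γ s h) : S → ℝ) p.1)
          = c * (-p.2.2 * q.1 + p.2.2 ^ 2 * s.toFun p.1 (grad γ q.2.1 p.1))
            + (-p.2.2 * q'.1 + p.2.2 ^ 2 * s.toFun p.1 (grad γ q'.2.1 p.1)) := by
        rw [hcp, map_add, map_smul, smul_eq_mul]
        ring
      exact e

theorem killingLiftMap_injective [Nonempty S] : Function.Injective (killingLiftMap γ s h) := by
  refine (injective_iff_map_eq_zero _).2 fun q hq ↦ ?_
  have hv (x : S) (v : ℝ) : q.1 * v + q.2.1 x = 0 :=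
    congrArg (fun w : Ed × (ℝ × ℝ) ↦ w.2.1) (congrFun hq ((x, (v, 0)) : NHGSpace S))
  obtain ⟨x⟩ := ‹Nonempty S›
  have h0 := hv x 0
  have h1 := hv x 1
  refine Prod.ext (by simp only [Prod.fst_zero]; linarith) (Subtype.ext (funext fun x ↦ ?_))
  have := hv x 0
  rw [mul_zero, zero_add] at this
  exact this

theorem range_killingLiftMap [ConnectedSpace S] (hh : ContMDiff (𝓡 d) 𝓘(ℝ, ℝ) ∞ h) :
    (LinearMap.range (killingLiftMap γ s h) : Set (VField (nhgModel d) (NHGSpace S)))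
      = killingGenerators (nhgMetric γ s h) (horizon S) := by
  ext X
  constructor
  · rintro ⟨q, rfl⟩
    exact IsPotential.killingLift_mem q.2.2 hh q.1
  · intro hX
    obtain ⟨c, f, hf, rfl⟩ := exists_of_mem_killingGenerators hh hX
    exact ⟨(c, ⟨f, hf⟩), rfl⟩

/-- The dimension count: rank-nullity with the constants as kernel gives `dim potentials = p + 1`,
and the generators are isomorphic to `ℝ × potentials`, of dimension `p + 2`. -/
theorem exists_isSubspaceOfDim [ConnectedSpace S] (hh : ContMDiff (𝓡 d) 𝓘(ℝ, ℝ) ∞ h) :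
    ∃ p ≤ d, IsSubspaceOfDim (cutKilling γ s h) p ∧
      IsSubspaceOfDim (killingGenerators (nhgMetric γ s h) (horizon S)) (p + 2) := by
  have hfin := finiteDimensional_potentials γ s h
  obtain ⟨μ, hμ, hK⟩ := exists_cutKilling_eq (γ := γ) (s := s) hh
  have hrk := LinearMap.finrank_range_add_finrank_ker (scaledGrad γ s h μ)
  rw [finrank_ker_scaledGrad γ s h hμ] at hrk
  have hle := finrank_potentials_le γ s h
  refine ⟨Module.finrank ℝ (LinearMap.range (scaledGrad γ s h μ)), by omega,
    ⟨_, ?_, inferInstance, rfl⟩, ⟨_, range_killingLiftMap γ s h hh, inferInstance, ?_⟩⟩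
  · rw [hK]
    ext ς
    constructor
    · rintro ⟨f, rfl⟩
      exact ⟨f.1, f.2, rfl⟩
    · rintro ⟨f, hf, rfl⟩
      exact ⟨⟨f, hf⟩, rfl⟩
  · rw [LinearMap.finrank_range_of_inj (killingLiftMap_injective γ s h), Module.finrank_prod,
      Module.finrank_self, ← hrk]
    omega

end Dimension

end NHG

end

theorem mainTheorem5 {d : ℕ} {S : Type*} [TopologicalSpace S]
    [ChartedSpace (EuclideanSpace ℝ (Fin d)) S] [IsManifold (𝓡 d) ∞ S]
    [T2Space S] [SecondCountableTopology S] [ConnectedSpace S]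
    (γ : NHG.RMetric d S) (s : NHG.OneForm d S) (h : S → ℝ)
    (hh : ContMDiff (𝓡 d) 𝓘(ℝ, ℝ) ∞ h) :
    (∀ m : ℕ, 2 ≤ m →
      (NHG.IsMultipleKillingHorizon (NHG.nhgMetric γ s h) (NHG.horizon S) m ↔
        NHG.IsSubspaceOfDim (NHG.cutKilling γ s h) (m - 2))) ∧
    ∃ p : ℕ, p ≤ d ∧ NHG.IsSubspaceOfDim (NHG.cutKilling γ s h) p := by
  obtain ⟨p, hpd, hK, hA⟩ := NHG.exists_isSubspaceOfDim γ s h hh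
  refine ⟨fun m hm ↦ ⟨fun hH ↦ ?_, fun hKm ↦ ?_⟩, p, hpd, hK⟩
  · have := hH.dim.unique hA
    rwa [this, Nat.add_sub_cancel]
  · have := hKm.unique hK
    -- The truncated difference `m - 2` equals `p`, and `2 ≤ m` makes the subtraction exact.
    have hmp : m = p + 2 := by omega
    exact ⟨NHG.isNullHypersurface_horizon, hm, hmp ▸ hA⟩
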